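/- Let $H^2$ be the Hardy space of the upper half-plane $\mathbb{C}_+$, identified through boundary values with the closed subspace of $L^2(\mathbb{R})$ of functions whose Fourier transform is supported on $[0,\infty)$, and let $P_+$ be the orthogonal projection of $L^2(\mathbb{R})$ onto $H^2$. For $U\in L^\infty(\mathbb{R})$ let $T_U:H^2\to H^2$, $T_Uf=P_+(Uf)$, be the Toeplitz operator with symbol $U$, and $N[U]=\ker T_U$. An inner function is a bounded analytic function in $\mathbb{C}_+$ whose boundary values are unimodular almost everywhere on $\mathbb{R}$. For an inner function $\theta$ put $K_\theta=H^2\ominus\theta H^2$ and $\mathcal{D}(\theta)=\{L \text{ inner} : N[\bar\theta L]\neq 0\}$. Inner functions $I$ and $J$ are Toeplitz equivalent, $I\approx J$, if $\mathcal{D}(I)=\mathcal{D}(J)$. An argument of an inner function $\theta$ is a measurable function $\arg\theta:\mathbb{R}\to\mathbb{R}$ such that $\theta/e^{i\arg\theta}>0$ almost everywhere on $\mathbb{R}$. **Theorem.** Let $I$ and $J$ be inner functions in $\mathbb{C}_+$ (not necessarily meromorphic). Then $I\approx J$ if and only if the arguments $\arg I$ and $\arg J$ can be chosen so that $\phi=\tfrac12(\arg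 I-\arg J)$ is Poisson-summable, i.e. $\int_{\mathbb{R}}|\phi(x)|\,\frac{dx}{1+x^2}<\infty$, the function $h=h(I,J)=\exp(\tilde\phi-i\phi)$ is outer in $\mathbb{C}_+$, and multiplication by $h$ is a bounded invertible operator from $K_I$ onto $K_J$. Here, in $\mathbb{C}_+$, $\phi$ denotes the Poisson extension and $\tilde\phi$ its harmonic conjugate normalized by $\tilde\phi(i)=0$; and $h$ is called outer if $h(z)=c\exp\left(\frac{1}{\pi i}\int_{\mathbb{R}}\left[\frac{1}{t-z}-\frac{t}{1+t^2}\right]u(t)\,dt\right)$ for some Poisson-summable real function $u$ and some constant $c$ with $|c|=1$. -/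

import Mathlib

open MeasureTheory Filter Topology Complex
open scoped FourierTransform ENNReal ComplexConjugate

noncomputable section

namespace ToeplitzOrder

/-- The Hilbert space `L²(ℝ)` of complex-valued functions. -/
abbrev L2 : Type := Lp ℂ 2 (volume : Measure ℝ)

/-- Multiplication by a bounded measurable function `U` on `L²(ℝ)`. -/
def mulL2 (U : ℝ → ℂ) (hU : MemLp U ∞ volume) : L2 →L[ℂ] L2 :=
  (ContinuousLinearMap.mul ℂ ℂ).holderL volume ∞ 2 2 (hU.toLp U)

theorem coeFn_mulL2 (U : ℝ → ℂ) (hU : MemLp U ∞ volume) (f : L2) :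
    mulL2 U hU f =ᵐ[volume] fun x => U x * f x := by
  have h := ContinuousLinearMap.coeFn_holder (r := 2) (ContinuousLinearMap.mul ℂ ℂ) (hU.toLp U) f
  filter_upwards [h, hU.coeFn_toLp] with x hx hx'
  change (ContinuousLinearMap.holder 2 (ContinuousLinearMap.mul ℂ ℂ) (hU.toLp U) f : ℝ → ℂ) x = _
  rw [hx, hx']
  rfl

/-- The Hardy space `H²` of the upper half-plane, identified through boundary values with the
subspace of all `f ∈ L²(ℝ)` whose Fourier transform is supported on `[0, ∞)`. -/
def H2 : Submodule ℂ L2 where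
  carrier := {f | ∀ᵐ ξ : ℝ, ξ < 0 → (𝓕 f : L2) ξ = 0}
  zero_mem' := by
    have h : (𝓕 (0 : L2) : L2) = 0 := (Lp.fourierTransformₗᵢ ℝ ℂ).map_zero
    simp only [Set.mem_ofPred_eq, h]
    filter_upwards [Lp.coeFn_zero ℂ 2 (volume : Measure ℝ)] with x hx _
    exact hx
  add_mem' := by
    intro f g hf hg
    have h : (𝓕 (f + g) : L2) = 𝓕 f + 𝓕 g := (Lp.fourierTransformₗᵢ ℝ ℂ).map_add f g
    simp only [Set.mem_ofPred_eq, h] at *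
    filter_upwards [hf, hg, Lp.coeFn_add (𝓕 f : L2) (𝓕 g)] with x h1 h2 h3 hx
    rw [h3, Pi.add_apply, h1 hx, h2 hx, add_zero]
  smul_mem' := by
    intro c f hf
    have h : (𝓕 (c • f) : L2) = c • 𝓕 f := (Lp.fourierTransformₗᵢ ℝ ℂ).map_smul c f
    simp only [Set.mem_ofPred_eq, h] at *
    filter_upwards [hf, Lp.coeFn_smul c (𝓕 f : L2)] with x h1 h3 hx
    rw [h3, Pi.smul_apply, h1 hx, smul_zero]

theorem memLp_indicator_Iio :
    MemLp (Set.indicator (Set.Iio (0 : ℝ)) fun _ => (1 : ℂ)) ∞ volume :=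
  (memLp_top_const (1 : ℂ)).indicator measurableSet_Iio

theorem isClosed_H2 : IsClosed (H2 : Set L2) := by
  have h : (H2 : Set L2) =
      {f | mulL2 _ memLp_indicator_Iio (Lp.fourierTransformₗᵢ ℝ ℂ f) = 0} := by
    ext f
    change (∀ᵐ ξ : ℝ, ξ < 0 → (Lp.fourierTransformₗᵢ ℝ ℂ f : L2) ξ = 0) ↔ _
    simp only [Set.mem_ofPred_eq]
    rw [Lp.ext_iff]
    have h1 := coeFn_mulL2 _ memLp_indicator_Iio (Lp.fourierTransformₗᵢ ℝ ℂ f)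
    have h0 := Lp.coeFn_zero ℂ 2 (volume : Measure ℝ)
    constructor
    · intro hf
      filter_upwards [hf, h1, h0] with x hx hx1 hx0
      rw [hx1, hx0]
      by_cases hn : x < 0
      · simp [hx hn]
      · simp [hn]
    · intro hf
      filter_upwards [hf, h1, h0] with x hx hx1 hx0 hn
      rw [hx1, hx0] at hx
      simpa [hn] using hx
  rw [h]
  exact isClosed_eq ((mulL2 _ memLp_indicator_Iio).continuous.comp
    (Lp.fourierTransformₗᵢ ℝ ℂ).continuous) continuous_const

instance : CompleteSpace H2 := isClosed_H2.completeSpace_coe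

/-- The Toeplitz operator `T_U : H² → H²`, `f ↦ P₊ (U f)`, with symbol `U ∈ L^∞(ℝ)`, where `P₊` is
the orthogonal projection of `L²(ℝ)` onto `H²`. -/
def toeplitz (U : ℝ → ℂ) (hU : MemLp U ∞ volume) : H2 →L[ℂ] H2 :=
  H2.orthogonalProjectionOnto ∘L mulL2 U hU ∘L H2.subtypeL

/-- The boundary function on `ℝ` of a function on the upper half-plane. -/
def boundary (F : ℂ → ℂ) (x : ℝ) : ℂ :=
  limUnder (𝓝[>] (0 : ℝ)) fun y : ℝ => F (x + y * I)

/-- Inner functions in the upper half-plane: bounded analytic functions whose boundary values exist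
and are unimodular almost everywhere. Only the values of `toFun` in the upper half-plane matter. -/
structure InnerFunction where
  toFun : ℂ → ℂ
  analytic : DifferentiableOn ℂ toFun {z | 0 < z.im}
  bounded : ∃ C : ℝ, ∀ z : ℂ, 0 < z.im → ‖toFun z‖ ≤ C
  unimodular : ∀ᵐ x : ℝ, ∃ c : ℂ, ‖c‖ = 1 ∧
    Tendsto (fun y : ℝ => toFun (x + y * I)) (𝓝[>] 0) (𝓝 c)

namespace InnerFunction

/-- The boundary function of an inner function. -/
def bd (θ : InnerFunction) : ℝ → ℂ := boundary θ.toFun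

theorem norm_bd (θ : InnerFunction) : ∀ᵐ x : ℝ, ‖θ.bd x‖ = 1 := by
  filter_upwards [θ.unimodular] with x hx
  obtain ⟨c, hc, hlim⟩ := hx
  rw [bd, boundary, hlim.limUnder_eq, hc]

theorem memLp_bd (θ : InnerFunction) : MemLp θ.bd ∞ volume := by
  refine memLp_top_of_bound ?_ 1 (θ.norm_bd.mono fun x hx => hx.le)
  have hu : Tendsto (fun n : ℕ => 1 / ((n : ℝ) + 1)) atTop (𝓝[>] 0) :=
    tendsto_nhdsWithin_iff.2 ⟨tendsto_one_div_add_atTop_nhds_zero_nat,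
      Eventually.of_forall fun n => Set.mem_Ioi.2 Nat.one_div_pos_of_nat⟩
  refine aestronglyMeasurable_of_tendsto_ae atTop
    (f := fun (n : ℕ) (x : ℝ) => θ.toFun (x + ((1 / ((n : ℝ) + 1) : ℝ) : ℂ) * I)) ?_ ?_
  · intro n
    refine Continuous.aestronglyMeasurable ?_
    refine θ.analytic.continuousOn.comp_continuous (by fun_prop) fun x => ?_
    have : (0 : ℝ) < 1 / ((n : ℝ) + 1) := Nat.one_div_pos_of_nat
    simpa only [Set.mem_ofPred_eq, add_im, ofReal_im, re_ofReal_mul, im_ofReal_mul, I_im, mul_one,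
      zero_add] using this
  · filter_upwards [θ.unimodular] with x hx
    obtain ⟨c, -, hlim⟩ := hx
    rw [bd, boundary, hlim.limUnder_eq]
    exact hlim.comp hu

theorem memLp_conj_bd_mul (θ L : InnerFunction) :
    MemLp (fun x => conj (θ.bd x) * L.bd x) ∞ volume := by
  refine memLp_top_of_bound ?_ 1 ?_
  · exact (continuous_conj.comp_aestronglyMeasurable θ.memLp_bd.1).mul L.memLp_bd.1
  · filter_upwards [θ.norm_bd, L.norm_bd] with x h1 h2
    simp [h1, h2]

end InnerFunction

/-- The kernel `N[θ̄ L]` of the Toeplitz operator with symbol `θ̄ L`. -/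
def toeplitzKernel (θ L : InnerFunction) : Submodule ℂ H2 :=
  (toeplitz (fun x => conj (θ.bd x) * L.bd x) (θ.memLp_conj_bd_mul L)).ker

/-- The dominance set `𝒟(θ)`: all inner functions `L` with `N[θ̄ L] ≠ 0`. -/
def dominanceSet (θ : InnerFunction) : Set InnerFunction :=
  {L | toeplitzKernel θ L ≠ ⊥}

/-- Toeplitz equivalence of inner functions: equality of the dominance sets. -/
def ToeplitzEquivalent (I J : InnerFunction) : Prop :=
  dominanceSet I = dominanceSet J

/-- The model space `K_θ = H² ⊖ θ H²`. -/
def modelSpace (θ : InnerFunction) : Submodule ℂ L2 :=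
  H2 ⊓ (H2.map (mulL2 θ.bd θ.memLp_bd : L2 →ₗ[ℂ] L2))ᗮ

/-- `α` is an argument of `θ` on `ℝ`: a measurable real function such that `θ / exp (i α)` is
positive almost everywhere. -/
def IsArgument (θ : InnerFunction) (α : ℝ → ℝ) : Prop :=
  Measurable α ∧ ∀ᵐ x : ℝ, ∃ r : ℝ, 0 < r ∧ θ.bd x / exp (I * α x) = r

/-- Summability with respect to the Poisson measure `dx / (1 + x²)`. -/
def PoissonSummable (u : ℝ → ℝ) : Prop :=
  Integrable (fun x : ℝ => u x / (1 + x ^ 2)) volume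

/-- The Schwarz integral of a Poisson-summable function `u`. -/
def schwarz (u : ℝ → ℝ) (z : ℂ) : ℂ :=
  1 / (Real.pi * I) * ∫ t : ℝ, (1 / ((t : ℂ) - z) - (t : ℂ) / (1 + (t : ℂ) ^ 2)) * (u t : ℂ)

/-- The Poisson extension of `u` to the upper half-plane. -/
def poissonExt (u : ℝ → ℝ) (z : ℂ) : ℝ := (schwarz u z).re

/-- The harmonic conjugate `ũ` of the Poisson extension of `u`, normalized by `ũ(i) = 0`. -/
def harmonicConj (u : ℝ → ℝ) (z : ℂ) : ℝ := (schwarz u z).im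

/-- The function `exp (φ̃ - i φ)` in the upper half-plane. -/
def expConj (φ : ℝ → ℝ) (z : ℂ) : ℂ :=
  exp ((harmonicConj φ z : ℂ) - I * (poissonExt φ z : ℂ))

/-- Outer functions in the upper half-plane: `F = c exp (Schwarz integral of u)` with `|c| = 1` and
`u` Poisson-summable (so that `u = log |F|` almost everywhere on `ℝ`). -/
def IsOuter (F : ℂ → ℂ) : Prop :=
  ∃ u : ℝ → ℝ, PoissonSummable u ∧ ∃ c : ℂ, ‖c‖ = 1 ∧
    ∀ z : ℂ, 0 < z.im → F z = c * exp (schwarz u z)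

/-- Multiplication by `h` is a bounded invertible operator of `K_I` onto `K_J`: there is a linear
homeomorphism of `K_I` onto `K_J` which maps every `f` to `h f`. -/
def IsBoundedInvertibleMultiplier (h : ℂ → ℂ) (I J : InnerFunction) : Prop :=
  ∃ T : modelSpace I ≃L[ℂ] modelSpace J, ∀ f : modelSpace I,
    ((T f : L2) : ℝ → ℂ) =ᵐ[volume] fun x => boundary h x * (f : L2) x

end ToeplitzOrder

end

/-!
The line with the probability measure `dt / (π (1 + t²))` serves as the unit circle, and the map
`f ↦ (t + i) f` turns `H²` of the half-plane into the class of square summable functions whose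
Poisson extension is analytic (`HardyPair`, `mem_H2_iff`). In these terms the model space `K_θ` and
the kernels `N[θ̄ L]` are both of the form `{p : p and ζ̄ U p̄ are in the class}` with
`ζ = (t - i) / (t + i)`, where `U = θ` and `U = θ L̄` respectively (`CoHardy`). In particular
`p ∈ N[θ̄ L]` implies `L p ∈ K_θ`.

If multiplication by an outer function `h` maps `K_I` onto `K_J`, and `p ≠ 0` is in `N[Ī L]`, then
`h L p ∈ K_J`. By Smirnov's theorem (`HardyPair.mul_outer`) the outer function can also be applied
to `p` itself, and `h p` is a nonzero element of `N[J̄ L]`. With `1 / h` in place of `h` this gives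
`𝒟(I) = 𝒟(J)`; see `dominanceSet_eq_of_multiplier`.

Conversely, let `𝒟(I) = 𝒟(J)`. If one of the functions is constant, then so is the other, both
model spaces are trivial and there is nothing to do. Otherwise the function `g = 1 - conj I(i) I`,
a reproducing kernel, lies in `N[Ī θ]` for a certain inner `θ` (`exists_inner_modelKer`). So
`θ ∈ 𝒟(J)`, and moving the inner factors of an element of `N[J̄ θ]` to the symbol gives an inner `M`
and an outer `o` with `ζ̄ J θ̄ M̄ ō = o`. Since also `θ M ∈ 𝒟(I)`, a product of Hardy functions
containing `M` is a constant, and so is `M`. It follows that `h = o / g` satisfies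
`h̄ / h = c I J̄` with a constant `c`. The product of `h` and its counterpart for `(J, I)` is
a constant too, by the same rigidity, so `h` and `1 / h` are both in the Hardy class, and `h` is
outer (`exists_outer_of_dominanceSet_eq`).

That `h` multiplies `K_I` into `K_J` amounts to square summability of `h p` for `p` in the class
(`CoHardy.outerBd_mul`). Let `k` be the reproducing kernel of `K_J` at `i`, a function bounded from
above and below, and replace `h p` by `h p₁ = h p + ξ k` with `ξ` generic, so that `1 / (h p₁)` is
in weak `L²`: almost every point has finite density with respect to the distribution of `h p / k`
in the plane (`exists_shift_small`). Let `o` be the outer part of `p₁` and `M` the product of its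
inner factor and that of `ζ̄ I p̄₁`. Then `M ∈ 𝒟(I) = 𝒟(J)`, which yields Hardy functions `f`, `f'`
for which `Q = f / (h o)` and `Q' = f' / (h o)` satisfy `c̄ Q = conj Q'` on the line. This would
make `Q` constant if `Q` were summable. It is only a product of an `L²` function and a weak
`L²` function, so that its distribution function is `o(1/s)`. That is exactly enough
(`outer_mul_eq_conj`): multiply `Q` by the outer function of modulus `min 1 (T / |Q|)`, whose
imaginary part on the line is estimated in `L²` by the contraction property of the harmonic
conjugate. As `Q` is a nonzero constant, `h p₁` has the size of `f ∈ L²`. Boundedness of the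
multiplication is the closed graph theorem. Finally `u = log |h|` is square summable, hence so is
its conjugate `ũ`, and `φ = κ - ũ` with a constant `κ` is half of a difference of arguments of
`I` and `J` for which `exp (φ̃ - i φ)` is a constant multiple of `h` (`exists_conjugate`).
-/

noncomputable section

namespace ToeplitzOrder

/-! ### The Fourier description of `H²` and Cauchy kernels -/

/-- On `L¹ ∩ L²` the inverse Fourier–Plancherel transform is given by the Fourier integral. -/
theorem coeFn_fourierInv_toLp {f : ℝ → ℂ} (h1 : Integrable f) (h2 : MemLp f 2 volume) :
    ((𝓕⁻ (h2.toLp f) : L2) : ℝ → ℂ) =ᵐ[volume] 𝓕⁻ f := by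
  have hcont : Continuous (𝓕⁻ f : ℝ → ℂ) :=
    VectorFourier.fourierIntegral_continuous Real.continuous_fourierChar
      (L := -innerₗ ℝ) (by simp only [LinearMap.neg_apply, innerₗ_apply_apply]; fun_prop) h1
  refine ae_eq_of_integral_contDiff_smul_eq
    ((Lp.memLp _).locallyIntegrable (by norm_num)) hcont.locallyIntegrable fun g hg hc => ?_
  have hg₁ : HasCompactSupport (Complex.ofRealCLM ∘ g) := hc.comp_left rfl
  have hg₂ : ContDiff ℝ ((⊤ : ℕ∞) : WithTop ℕ∞) (Complex.ofRealCLM ∘ g) := by fun_prop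
  let φ := hg₁.toSchwartzMap hg₂
  have e1 := congrArg (fun T => T φ) (Lp.fourierInv_toTemperedDistribution_eq (h2.toLp f))
  simp only [TemperedDistribution.fourierInv_apply, Lp.toTemperedDistribution_apply] at e1
  have e2 : ∫ x, (𝓕⁻ (φ : ℝ → ℂ)) x • f x = ∫ x, φ x • (𝓕⁻ f : ℝ → ℂ) x :=
    (VectorFourier.integral_fourierIntegral_smul_eq_flip (L := -innerₗ ℝ) (f := φ) (g := f)
      Real.continuous_fourierChar (by simp only [LinearMap.neg_apply, innerₗ_apply_apply]; fun_prop)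
      φ.integrable h1).trans (by
        congr 1; ext x; congr 1
        change VectorFourier.fourierIntegral _ _ (-innerₗ ℝ).flip f x =
          VectorFourier.fourierIntegral _ _ (-innerₗ ℝ) f x
        congr 1
        ext
        simp)
  have e3 : ∫ x, (𝓕⁻ φ) x • (h2.toLp f : ℝ → ℂ) x = ∫ x, (𝓕⁻ (φ : ℝ → ℂ)) x • f x := by
    refine integral_congr_ae ?_
    filter_upwards [h2.coeFn_toLp] with x hx
    rw [hx, SchwartzMap.fourierInv_coe]
  calc ∫ x, g x • (𝓕⁻ (h2.toLp f) : L2) x = ∫ x, φ x • (𝓕⁻ (h2.toLp f) : L2) x := by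
        congr 1
    _ = ∫ x, φ x • (𝓕⁻ f : ℝ → ℂ) x := by rw [← e1, e3, e2]
    _ = ∫ x, g x • (𝓕⁻ f : ℝ → ℂ) x := by congr 1

/-- The exponential `ξ ↦ exp (aξ)` on the negative half-line. -/
def expNeg (a : ℂ) : ℝ → ℂ := Set.indicator (Set.Iio 0) fun ξ : ℝ => exp (a * ξ)

theorem norm_expNeg (a : ℂ) (ξ : ℝ) :
    ‖expNeg a ξ‖ = Set.indicator (Set.Iio 0) (fun ξ : ℝ => Real.exp (a.re * ξ)) ξ := by
  by_cases h : ξ < 0 <;> simp [expNeg, h, Complex.norm_exp]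

theorem aestronglyMeasurable_expNeg (a : ℂ) : AEStronglyMeasurable (expNeg a) volume :=
  (Continuous.aestronglyMeasurable (by fun_prop)).indicator measurableSet_Iio

theorem integrable_expNeg {a : ℂ} (ha : 0 < a.re) : Integrable (expNeg a) := by
  refine (integrable_norm_iff (aestronglyMeasurable_expNeg a)).1 ?_
  simp only [norm_expNeg]
  rw [integrable_indicator_iff measurableSet_Iio]
  exact (integrableOn_exp_mul_Iic ha 0).mono_set Set.Iio_subset_Iic_self

theorem memLp_expNeg {a : ℂ} (ha : 0 < a.re) : MemLp (expNeg a) 2 volume := by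
  refine (memLp_two_iff_integrable_sq_norm (aestronglyMeasurable_expNeg a)).2 ?_
  have h := integrable_expNeg (a := 2 * a) (by simpa using ha)
  refine h.norm.congr (Eventually.of_forall fun ξ => ?_)
  simp only [norm_expNeg]
  by_cases hx : ξ < 0
  · simp only [Set.mem_Iio, hx, Set.indicator_of_mem, ← Real.exp_nat_mul]
    congr 1; simp; ring
  · simp [hx]

theorem fourierInv_expNeg {a : ℂ} (ha : 0 < a.re) (t : ℝ) :
    (𝓕⁻ (expNeg a) : ℝ → ℂ) t = 1 / (a + 2 * Real.pi * I * t) := by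
  rw [Real.fourierInv_eq']
  have h : ∀ ξ : ℝ, exp (↑(2 * Real.pi * inner ℝ ξ t) * I) • expNeg a ξ =
      Set.indicator (Set.Iio 0) (fun ξ : ℝ => exp ((a + 2 * Real.pi * I * t) * ξ)) ξ := by
    intro ξ
    by_cases hx : ξ < 0
    · simp only [expNeg, Set.mem_Iio, hx, Set.indicator_of_mem, smul_eq_mul, ← Complex.exp_add]
      congr 1; simp; ring
    · simp [expNeg, hx]
  simp_rw [h]
  rw [integral_indicator measurableSet_Iio, ← integral_Iic_eq_integral_Iio,
    integral_exp_mul_complex_Iic (by simpa using ha)]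
  simp

/-- The Cauchy kernel `1 / (t - z)` as a function on the line. -/
def cauchyKer (z : ℂ) (t : ℝ) : ℂ := 1 / ((t : ℂ) - z)

theorem two_pi_I_mul_fourierInv_expNeg {z : ℂ} (hz : 0 < z.im) (t : ℝ) :
    2 * Real.pi * I * (𝓕⁻ (expNeg (-2 * Real.pi * I * z)) : ℝ → ℂ) t = cauchyKer z t := by
  have hne : (t : ℂ) - z ≠ 0 := fun h => by
    have := congrArg Complex.im h
    simp at this; linarith
  rw [fourierInv_expNeg (by simp; positivity), cauchyKer]
  have : -2 * Real.pi * I * z + 2 * Real.pi * I * t = (2 * Real.pi * I) * ((t : ℂ) - z) := by ring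
  rw [this]
  have h2 : (2 * Real.pi * I : ℂ) ≠ 0 := by simp [Real.pi_ne_zero]
  field_simp

theorem cauchyKer_aeeq {z : ℂ} (hz : 0 < z.im)
    (h2 : MemLp (expNeg (-2 * Real.pi * I * z)) 2 volume) :
    ((2 * Real.pi * I : ℂ) • (𝓕⁻ (h2.toLp _) : L2) : L2) =ᵐ[volume] cauchyKer z := by
  have h1 := integrable_expNeg (a := -2 * Real.pi * I * z) (by simp; positivity)
  filter_upwards [Lp.coeFn_smul (2 * Real.pi * I : ℂ) (𝓕⁻ (h2.toLp _) : L2),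
    coeFn_fourierInv_toLp h1 h2] with t h3 h4
  rw [h3, Pi.smul_apply, h4, smul_eq_mul, two_pi_I_mul_fourierInv_expNeg hz]

theorem memLp_cauchyKer {z : ℂ} (hz : 0 < z.im) : MemLp (cauchyKer z) 2 volume :=
  (memLp_congr_ae (cauchyKer_aeeq hz (memLp_expNeg (by simp; positivity)))).1 (Lp.memLp _)

theorem conj_cauchyKer (z : ℂ) (t : ℝ) : conj (cauchyKer z t) = cauchyKer (conj z) t := by
  simp [cauchyKer]

theorem integral_mul_cauchyKer_conj {z : ℂ} (hz : 0 < z.im) (f : L2) :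
    ∫ t, cauchyKer (conj z) t * f t =
      conj (2 * Real.pi * I : ℂ) *
        ∫ ξ, conj (expNeg (-2 * Real.pi * I * z) ξ) * (𝓕 f : L2) ξ := by
  have h2 := memLp_expNeg (a := -2 * Real.pi * I * z) (by simp; positivity)
  have h := Lp.inner_fourier_eq (𝓕⁻ (h2.toLp _) : L2) f
  rw [FourierTransform.fourier_fourierInv_eq] at h
  have h3 : ∫ t, cauchyKer (conj z) t * f t =
      inner ℂ ((2 * Real.pi * I : ℂ) • (𝓕⁻ (h2.toLp _) : L2)) f := by
    rw [L2.inner_def]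
    refine integral_congr_ae ?_
    filter_upwards [cauchyKer_aeeq hz h2] with t ht
    rw [ht, ← conj_cauchyKer]
    simp [mul_comm]
  rw [h3, inner_smul_left, ← h, L2.inner_def]
  congr 1
  refine integral_congr_ae ?_
  filter_upwards [h2.coeFn_toLp] with t ht
  rw [ht]
  simp [mul_comm]

/-- A function is in `H²` exactly if its Cauchy integral vanishes in the lower half-plane: up to
constants the Cauchy kernels are the inverse Fourier transforms of the exponentials `exp (aξ)` on
the negative half-line, which span a dense subspace of `L²(-∞, 0)`. -/
theorem mem_H2_iff_cauchyKer (f : L2) :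
    f ∈ H2 ↔ ∀ z : ℂ, 0 < z.im → ∫ t, cauchyKer (conj z) t * f t = 0 := by
  have key : ∀ z : ℂ, 0 < z.im → (∫ t, cauchyKer (conj z) t * f t = 0 ↔
      ∫ ξ, conj (expNeg (-2 * Real.pi * I * z) ξ) * (𝓕 f : L2) ξ = 0) := by
    intro z hz
    rw [integral_mul_cauchyKer_conj hz, mul_eq_zero, or_iff_right]
    simp [Real.pi_ne_zero]
  constructor
  · intro hf z hz
    rw [key z hz]
    refine integral_eq_zero_of_ae ?_
    have hf' : ∀ᵐ ξ : ℝ, ξ < 0 → (𝓕 f : L2) ξ = 0 := hf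
    filter_upwards [hf'] with ξ hξ
    by_cases h : ξ < 0
    · simp [hξ h]
    · simp [expNeg, h]
  · intro hf
    -- the kernels with poles on the line `Im z = -1 / (2π)` give the Fourier transform of
    -- `exp ξ 𝓕 f` on the negative half-line, which is summable
    have ha : (0 : ℝ) < (1 : ℂ).re := by simp
    set g : ℝ → ℂ := fun ξ => expNeg 1 ξ * (𝓕 f : L2) ξ with hg
    have hg1 : Integrable g := (memLp_expNeg ha).integrable_mul (Lp.memLp _)
    have hg2 : MemLp g 2 volume := by
      refine (Lp.memLp (𝓕 f : L2)).of_le hg1.aestronglyMeasurable (Eventually.of_forall fun ξ => ?_)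
      rw [hg, norm_mul, norm_expNeg]
      refine mul_le_of_le_one_left (norm_nonneg _) ?_
      by_cases h : ξ < 0
      · simp [h, h.le]
      · simp [h]
    have h0 : (𝓕⁻ g : ℝ → ℂ) = 0 := by
      ext s
      rw [Real.fourierInv_eq']
      have hz : 0 < ((I + (s:ℂ) * (2 * Real.pi)) / (2 * Real.pi) : ℂ).im := by
        have : (2 * (Real.pi : ℂ)) = ((2 * Real.pi : ℝ) : ℂ) := by push_cast; ring
        rw [this, Complex.div_ofReal_im]
        simp; positivity
      have h := (key _ hz).1 (hf _ hz)
      rw [Pi.zero_apply, ← h]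
      congr 1; ext ξ
      simp only [hg, expNeg, smul_eq_mul]
      by_cases hx : ξ < 0
      · simp only [Set.mem_Iio, hx, Set.indicator_of_mem, ← mul_assoc, ← Complex.exp_add,
          ← Complex.exp_conj]
        congr 2
        have hpi : (Real.pi : ℂ) ≠ 0 := by simp [Real.pi_ne_zero]
        simp only [map_mul, map_neg, conj_I, map_div₀, map_add, conj_ofReal, map_ofNat]
        field_simp
        ring_nf
        simp
        ring
      · simp [hx]
    have h3 : (𝓕⁻ (hg2.toLp g) : L2) = 0 := by
      rw [Lp.eq_zero_iff_ae_eq_zero]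
      filter_upwards [coeFn_fourierInv_toLp hg1 hg2] with x hx
      rw [hx, h0]
    have h4 : hg2.toLp g = 0 := by
      exact (Lp.fourierTransformₗᵢ ℝ ℂ).symm.map_eq_zero_iff.1 h3
    rw [Lp.eq_zero_iff_ae_eq_zero] at h4
    change ∀ᵐ ξ : ℝ, ξ < 0 → (𝓕 f : L2) ξ = 0
    filter_upwards [h4, hg2.coeFn_toLp] with ξ h5 h6 hξ
    rw [h5] at h6
    simpa [hg, expNeg, hξ] using h6.symm

/-! ### The Poisson measure and the kernels of the upper half-plane -/

/-- The open upper half-plane. -/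
def UHP : Set ℂ := {z | 0 < z.im}

theorem isOpen_UHP : IsOpen UHP := isOpen_lt continuous_const continuous_im

theorem convex_UHP : Convex ℝ UHP := convex_halfSpace_im_gt 0

theorem I_mem_UHP : I ∈ UHP := by simp [UHP]

theorem im_pos_of_mem {z : ℂ} (hz : z ∈ UHP) : 0 < z.im := hz

theorem ofReal_add_mul_I_mem {x y : ℝ} (hy : 0 < y) : (x : ℂ) + y * I ∈ UHP := by
  simpa [UHP] using hy

/-- Harmonic measure of the upper half-plane at `i`, the probability measure
`dt / (π (1 + t²))`. All function spaces below are taken with respect to it, so that the line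
with this measure plays the role of the unit circle with normalized length. -/
def poissonMeasure : Measure ℝ :=
  volume.withDensity fun t => ENNReal.ofReal (1 / (Real.pi * (1 + t ^ 2)))

local notation "ϖ" => poissonMeasure

theorem poissonDensity_pos (t : ℝ) : 0 < 1 / (Real.pi * (1 + t ^ 2)) := by positivity

instance : IsProbabilityMeasure ϖ := by
  constructor
  rw [poissonMeasure, withDensity_apply _ MeasurableSet.univ, Measure.restrict_univ]
  rw [← ProbabilityTheory.lintegral_cauchyPDF_eq_one 0 one_ne_zero]
  refine lintegral_congr fun t => ?_
  rw [ProbabilityTheory.cauchyPDF_def, ProbabilityTheory.cauchyPDFReal_def]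
  congr 1
  simp
  ring

theorem ae_poissonMeasure : ae ϖ = ae (volume : Measure ℝ) := by
  refine le_antisymm ?_ ?_
  · exact (withDensity_absolutelyContinuous _ _).ae_le
  · refine Measure.AbsolutelyContinuous.ae_le ?_
    refine withDensity_absolutelyContinuous' (by fun_prop) (Eventually.of_forall fun t => ?_)
    simpa using poissonDensity_pos t

theorem aestronglyMeasurable_poisson {E : Type*} [TopologicalSpace E] {f : ℝ → E} :
    AEStronglyMeasurable f ϖ ↔ AEStronglyMeasurable f volume := by
  constructor <;> rintro ⟨g, hg, h⟩ <;> refine ⟨g, hg, ?_⟩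
  · rwa [EventuallyEq, ae_poissonMeasure] at h
  · rwa [EventuallyEq, ae_poissonMeasure]

theorem integrable_poisson {f : ℝ → ℂ} :
    Integrable f ϖ ↔ Integrable (fun t : ℝ => f t / (Real.pi * (1 + (t : ℂ) ^ 2))) volume := by
  rw [poissonMeasure, integrable_withDensity_iff_integrable_smul₀' (by fun_prop) (by simp)]
  refine integrable_congr (Eventually.of_forall fun t => ?_)
  simp only [ENNReal.toReal_ofReal (poissonDensity_pos t).le, real_smul]
  push_cast
  ring

theorem integral_poisson (f : ℝ → ℂ) :
    ∫ t, f t ∂ϖ = ∫ t : ℝ, f t / (Real.pi * (1 + (t : ℂ) ^ 2)) := by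
  rw [poissonMeasure, integral_withDensity_eq_integral_toReal_smul₀ (by fun_prop) (by simp)]
  refine integral_congr_ae (Eventually.of_forall fun t => ?_)
  simp only [ENNReal.toReal_ofReal (poissonDensity_pos t).le, real_smul]
  push_cast
  ring

theorem integrable_poisson_real {f : ℝ → ℝ} :
    Integrable f ϖ ↔ Integrable (fun t : ℝ => f t / (Real.pi * (1 + t ^ 2))) volume := by
  rw [poissonMeasure, integrable_withDensity_iff_integrable_smul₀' (by fun_prop) (by simp)]
  refine integrable_congr (Eventually.of_forall fun t => ?_)
  simp only [ENNReal.toReal_ofReal (poissonDensity_pos t).le, smul_eq_mul]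
  ring

theorem poissonSummable_iff {u : ℝ → ℝ} : PoissonSummable u ↔ Integrable u ϖ := by
  rw [integrable_poisson_real, PoissonSummable]
  have h : (fun t : ℝ => u t / (Real.pi * (1 + t ^ 2))) =
      fun t => Real.pi⁻¹ * (u t / (1 + t ^ 2)) := by
    ext t; field_simp
  rw [h]
  exact (integrable_const_mul_iff (by simp [Real.pi_ne_zero]) _).symm

/-- The Cauchy kernel `(t - i) / (t - z)`, normalized so as to be bounded on the line. -/
def cker (z : ℂ) (t : ℝ) : ℂ := ((t : ℂ) - I) / ((t : ℂ) - z)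

/-- The Poisson kernel of the upper half-plane relative to harmonic measure at `i`. -/
def rho (z : ℂ) (t : ℝ) : ℝ := z.im * (1 + t ^ 2) / normSq ((t : ℂ) - z)

/-- The Blaschke factor at `i`, which maps the line to the unit circle. -/
def zeta (t : ℝ) : ℂ := ((t : ℂ) - I) / ((t : ℂ) + I)

theorem ofReal_sub_ne_zero {z : ℂ} (hz : z.im ≠ 0) (t : ℝ) : (t : ℂ) - z ≠ 0 := fun h => by
  have := congrArg Complex.im h
  simp at this; exact hz this

theorem ofReal_add_I_ne_zero (t : ℝ) : (t : ℂ) + I ≠ 0 := by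
  simpa using ofReal_sub_ne_zero (z := -I) (by simp) t

theorem ofReal_sub_I_ne_zero (t : ℝ) : (t : ℂ) - I ≠ 0 := ofReal_sub_ne_zero (by simp) t

theorem one_add_sq_eq (t : ℝ) : (1 + (t : ℂ) ^ 2) = ((t : ℂ) + I) * ((t : ℂ) - I) := by
  ring_nf; simp [add_comm]

theorem one_add_sq_ne_zero (t : ℝ) : (1 + (t : ℂ) ^ 2) ≠ 0 := by
  rw [one_add_sq_eq]
  exact mul_ne_zero (ofReal_add_I_ne_zero t) (ofReal_sub_I_ne_zero t)

theorem conj_ofReal_add_I (t : ℝ) : conj ((t : ℂ) + I) = (t : ℂ) - I := by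
  simp [sub_eq_add_neg]

theorem conj_ofReal_sub_I (t : ℝ) : conj ((t : ℂ) - I) = (t : ℂ) + I := by
  simp

theorem norm_zeta (t : ℝ) : ‖zeta t‖ = 1 := by
  rw [zeta, norm_div, ← conj_ofReal_add_I, Complex.norm_conj]
  exact div_self (norm_ne_zero_iff.2 (ofReal_add_I_ne_zero t))

theorem abs_im_le_norm_ofReal_sub (z : ℂ) (t : ℝ) : |z.im| ≤ ‖(t : ℂ) - z‖ := by
  simpa using Complex.abs_im_le_norm ((t : ℂ) - z)

theorem continuous_cker {z : ℂ} (hz : z.im ≠ 0) : Continuous (cker z) := by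
  unfold cker
  exact Continuous.div (by fun_prop) (by fun_prop) (ofReal_sub_ne_zero hz)

theorem norm_cker_le {z : ℂ} (hz : z.im ≠ 0) (t : ℝ) : ‖cker z t‖ ≤ 1 + ‖z - I‖ / |z.im| := by
  have h : cker z t = 1 + (z - I) / ((t : ℂ) - z) := by
    have := ofReal_sub_ne_zero hz t
    rw [cker]; field_simp; ring
  rw [h]
  refine (norm_add_le _ _).trans ?_
  rw [norm_one, norm_div]
  gcongr
  exact abs_im_le_norm_ofReal_sub z t

theorem continuous_zeta : Continuous zeta := by
  unfold zeta
  exact Continuous.div (by fun_prop) (by fun_prop) ofReal_add_I_ne_zero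

theorem normSq_ofReal_sub_pos {z : ℂ} (hz : z.im ≠ 0) (t : ℝ) : 0 < normSq ((t : ℂ) - z) :=
  normSq_pos.2 (ofReal_sub_ne_zero hz t)

theorem continuous_rho {z : ℂ} (hz : z.im ≠ 0) : Continuous (rho z) := by
  unfold rho
  exact Continuous.div (by fun_prop) (by fun_prop) fun t => (normSq_ofReal_sub_pos hz t).ne'

theorem rho_pos {z : ℂ} (hz : z ∈ UHP) (t : ℝ) : 0 < rho z t := by
  have h := normSq_ofReal_sub_pos (im_pos_of_mem hz).ne' t
  have := im_pos_of_mem hz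
  unfold rho; positivity

theorem rho_I (t : ℝ) : rho I t = 1 := by
  have h := one_add_sq_ne_zero t
  have h2 : (0 : ℝ) < 1 + t ^ 2 := by positivity
  simp only [rho, normSq_apply]
  simp only [I_im, sub_re, ofReal_re, I_re, sub_im, ofReal_im]
  field_simp
  ring

theorem rho_eq_cker {z : ℂ} (hz : z.im ≠ 0) (t : ℝ) :
    (rho z t : ℂ) = (z + I) / (2 * I) * cker z t - (conj z + I) / (2 * I) * cker (conj z) t := by
  have h1 := ofReal_sub_ne_zero hz t
  have h2 := ofReal_sub_ne_zero (z := conj z) (by simpa using hz) t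
  have h3 : (normSq ((t : ℂ) - z) : ℂ) = ((t : ℂ) - z) * ((t : ℂ) - conj z) := by
    rw [← mul_conj]; simp
  have h4 : (z.im : ℂ) = (z - conj z) / (2 * I) := by
    rw [im_eq_sub_conj]
  have hI := I_ne_zero
  simp only [rho, cker]
  push_cast
  rw [h3, h4, one_add_sq_eq]
  field_simp
  ring

theorem rho_eq_re_cker {z : ℂ} (hz : z.im ≠ 0) (t : ℝ) :
    rho z t = (-I * (z + I) * cker z t - 1).re := by
  have h2 : (conj (-I * (z + I) * cker z t - 1) + (-I * (z + I) * cker z t - 1)) / 2 =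
      (rho z t : ℂ) := by
    rw [rho_eq_cker hz]
    have h1 := ofReal_sub_ne_zero hz t
    have h2 := ofReal_sub_ne_zero (z := conj z) (by simpa using hz) t
    have hI := I_ne_zero
    simp only [cker, map_sub, map_mul, map_neg, conj_I, map_add, map_div₀, conj_ofReal, map_one]
    field_simp
    ring_nf
    simp
    ring
  have h3 : (((-I * (z + I) * cker z t - 1).re : ℝ) : ℂ) = (rho z t : ℂ) := by
    rw [← h2, re_eq_add_conj, add_comm]
  exact_mod_cast h3.symm

theorem rho_le {z : ℂ} (hz : z ∈ UHP) (t : ℝ) :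
    rho z t ≤ ‖z + I‖ * (1 + ‖z - I‖ / |z.im|) + 1 := by
  have hz' := (im_pos_of_mem hz).ne'
  rw [rho_eq_re_cker hz']
  refine (re_le_norm _).trans ((norm_sub_le _ _).trans ?_)
  rw [norm_mul, norm_mul, norm_neg, norm_I, one_mul, norm_one]
  gcongr
  exact norm_cker_le hz' t

theorem integrable_cker_mul {z : ℂ} (hz : z.im ≠ 0) {f : ℝ → ℂ} (hf : Integrable f ϖ) :
    Integrable (fun t => cker z t * f t) ϖ :=
  hf.bdd_mul (continuous_cker hz).aestronglyMeasurable
    (Eventually.of_forall (norm_cker_le hz))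

theorem norm_rho_le {z : ℂ} (hz : z ∈ UHP) (t : ℝ) :
    ‖(rho z t : ℂ)‖ ≤ ‖z + I‖ * (1 + ‖z - I‖ / |z.im|) + 1 := by
  rw [norm_real, Real.norm_of_nonneg (rho_pos hz t).le]
  exact rho_le hz t

theorem continuous_rho_complex {z : ℂ} (hz : z ∈ UHP) : Continuous fun t => (rho z t : ℂ) :=
  continuous_ofReal.comp (continuous_rho (im_pos_of_mem hz).ne')

theorem integrable_rho_mul {z : ℂ} (hz : z ∈ UHP) {f : ℝ → ℂ} (hf : Integrable f ϖ) :
    Integrable (fun t => (rho z t : ℂ) * f t) ϖ :=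
  hf.bdd_mul (continuous_rho_complex hz).aestronglyMeasurable
    (Eventually.of_forall (norm_rho_le hz))

theorem integrable_rho_mul_real {z : ℂ} (hz : z ∈ UHP) {f : ℝ → ℝ} (hf : Integrable f ϖ) :
    Integrable (fun t => rho z t * f t) ϖ :=
  hf.bdd_mul (continuous_rho (im_pos_of_mem hz).ne').aestronglyMeasurable
    (Eventually.of_forall fun t => by simpa using norm_rho_le hz t)

/-- The Cauchy integral of `f` with respect to the Poisson measure. -/
def cint (f : ℝ → ℂ) (z : ℂ) : ℂ := ∫ t, cker z t * f t ∂ϖ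

/-- The Poisson extension of a complex-valued function. -/
def pext (f : ℝ → ℂ) (z : ℂ) : ℂ := ∫ t, (rho z t : ℂ) * f t ∂ϖ

theorem pext_I (f : ℝ → ℂ) : pext f I = ∫ t, f t ∂ϖ := by
  simp [pext, rho_I]

/-- The Poisson kernel is a combination of the Cauchy kernels with poles at `z` and `z̄`. -/
theorem pext_eq_cint {z : ℂ} (hz : z ∈ UHP) {f : ℝ → ℂ} (hf : Integrable f ϖ) :
    pext f z = (z + I) / (2 * I) * cint f z - (conj z + I) / (2 * I) * cint f (conj z) := by
  have hz' := (im_pos_of_mem hz).ne'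
  rw [pext, cint, cint, ← integral_const_mul, ← integral_const_mul, ← integral_sub]
  · congr 1; ext t
    rw [rho_eq_cker hz']; ring
  · exact (integrable_cker_mul hz' hf).const_mul _
  · exact (integrable_cker_mul (by simpa using hz') hf).const_mul _

theorem pext_congr {f g : ℝ → ℂ} (h : f =ᵐ[volume] g) (z : ℂ) : pext f z = pext g z := by
  refine integral_congr_ae ?_
  rw [EventuallyEq, ae_poissonMeasure]
  filter_upwards [h] with t ht
  rw [ht]

theorem pext_add {f g : ℝ → ℂ} {z : ℂ} (hz : z ∈ UHP) (hf : Integrable f ϖ) (hg : Integrable g ϖ) :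
    pext (fun t => f t + g t) z = pext f z + pext g z := by
  simp only [pext, mul_add]
  exact integral_add (integrable_rho_mul hz hf) (integrable_rho_mul hz hg)

theorem pext_sub {f g : ℝ → ℂ} {z : ℂ} (hz : z ∈ UHP) (hf : Integrable f ϖ) (hg : Integrable g ϖ) :
    pext (fun t => f t - g t) z = pext f z - pext g z := by
  simp only [pext, mul_sub]
  exact integral_sub (integrable_rho_mul hz hf) (integrable_rho_mul hz hg)

theorem pext_const_mul (c : ℂ) (f : ℝ → ℂ) (z : ℂ) :
    pext (fun t => c * f t) z = c * pext f z := by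
  simp only [pext, mul_left_comm]
  exact integral_const_mul _ _

theorem pext_conj (f : ℝ → ℂ) (z : ℂ) : pext (fun t => conj (f t)) z = conj (pext f z) := by
  simp only [pext]
  rw [← integral_conj]
  simp

theorem pext_ofReal (u : ℝ → ℝ) (z : ℂ) :
    pext (fun t => (u t : ℂ)) z = ((∫ t, rho z t * u t ∂ϖ : ℝ) : ℂ) := by
  rw [pext, ← integral_complex_ofReal]
  simp

theorem conj_cker (z : ℂ) (t : ℝ) :
    conj (cker z t) = ((t : ℂ) + I) / ((t : ℂ) - conj z) := by
  simp [cker]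

theorem differentiableAt_cint {f : ℝ → ℂ} (hf : Integrable f ϖ) {z : ℂ} (hz : z.im ≠ 0) :
    DifferentiableAt ℂ (cint f) z := by
  have hδ : 0 < |z.im| / 2 := by positivity
  have him : ∀ w ∈ Metric.ball z (|z.im| / 2), |z.im| / 2 ≤ |w.im| := by
    intro w hw
    have h1 : |w.im - z.im| ≤ ‖w - z‖ := by simpa using Complex.abs_im_le_norm (w - z)
    rw [mem_ball_iff_norm] at hw
    have h2 := abs_sub_abs_le_abs_sub z.im w.im
    rw [abs_sub_comm] at h2
    linarith
  have hne : ∀ w ∈ Metric.ball z (|z.im| / 2), w.im ≠ 0 := fun w hw => by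
    have := him w hw
    exact abs_pos.1 (by linarith)
  refine (hasDerivAt_integral_of_dominated_loc_of_deriv_le (F := fun w t => cker w t * f t)
    (F' := fun w t => cker w t / ((t : ℂ) - w) * f t)
    (bound := fun t => (1 + (‖z - I‖ + |z.im| / 2) / (|z.im| / 2)) / (|z.im| / 2) * ‖f t‖)
    (Metric.ball_mem_nhds z hδ) ?_ (integrable_cker_mul hz hf) ?_ ?_
    (hf.norm.const_mul _) ?_).2.differentiableAt
  · filter_upwards [Metric.ball_mem_nhds z hδ] with w hw
    exact (integrable_cker_mul (hne w hw) hf).aestronglyMeasurable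
  · refine AEStronglyMeasurable.mul (Continuous.aestronglyMeasurable ?_) hf.aestronglyMeasurable
    exact (continuous_cker hz).div (by fun_prop) (ofReal_sub_ne_zero hz)
  · refine Eventually.of_forall fun t w hw => ?_
    rw [norm_mul, norm_div]
    gcongr
    · refine (norm_cker_le (hne w hw) t).trans ?_
      gcongr
      · rw [mem_ball_iff_norm] at hw
        calc ‖w - I‖ = ‖(z - I) + (w - z)‖ := by congr 1; ring
          _ ≤ ‖z - I‖ + ‖w - z‖ := norm_add_le _ _
          _ ≤ _ := by linarith
      · exact him w hw
    · exact (him w hw).trans (abs_im_le_norm_ofReal_sub w t)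
  · refine Eventually.of_forall fun t w hw => ?_
    have h0 := ofReal_sub_ne_zero (hne w hw) t
    have h1 : HasDerivAt (fun w : ℂ => (t : ℂ) - w) (-1) w := by
      simpa using (hasDerivAt_id w).const_sub (t : ℂ)
    have h2 := ((hasDerivAt_const w ((t : ℂ) - I)).div h1 h0).mul_const (f t)
    convert! h2 using 1
    simp only [cker]
    field_simp
    ring

theorem differentiableOn_cint {f : ℝ → ℂ} (hf : Integrable f ϖ) :
    DifferentiableOn ℂ (cint f) UHP := fun _ hz =>
  (differentiableAt_cint hf (im_pos_of_mem hz).ne').differentiableWithinAt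

theorem schwarz_eq_cint {u : ℝ → ℝ} (hu : Integrable u ϖ) {z : ℂ} (hz : z.im ≠ 0) :
    schwarz u z = -I * (z + I) * cint (fun t => (u t : ℂ)) z - ∫ t, (u t : ℂ) ∂ϖ := by
  rw [cint, ← integral_const_mul, ← integral_sub, integral_poisson, schwarz, ← integral_const_mul]
  · congr 1; ext t
    have h1 := ofReal_sub_ne_zero hz t
    have h2 := one_add_sq_ne_zero t
    have hI := I_ne_zero
    have hpi : (Real.pi : ℂ) ≠ 0 := by simp [Real.pi_ne_zero]
    simp only [cker]
    field_simp
    ring_nf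
    simp only [I_sq, I_pow_three, I_pow_four]
    ring
  · exact (integrable_cker_mul hz hu.ofReal).const_mul _
  · exact hu.ofReal

theorem differentiableOn_schwarz {u : ℝ → ℝ} (hu : Integrable u ϖ) :
    DifferentiableOn ℂ (schwarz u) UHP := by
  have h : DifferentiableOn ℂ
      (fun z => -I * (z + I) * cint (fun t => (u t : ℂ)) z - ∫ t, (u t : ℂ) ∂ϖ) UHP :=
    ((by fun_prop : DifferentiableOn ℂ (fun z : ℂ => -I * (z + I)) UHP).mul
      (differentiableOn_cint hu.ofReal)).sub_const _
  exact h.congr fun z hz => schwarz_eq_cint hu (im_pos_of_mem hz).ne'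

theorem schwarz_eq_integral {u : ℝ → ℝ} (hu : Integrable u ϖ) {z : ℂ} (hz : z.im ≠ 0) :
    schwarz u z = ∫ t, (-I * (z + I) * cker z t - 1) * (u t : ℂ) ∂ϖ := by
  rw [schwarz_eq_cint hu hz, cint, ← integral_const_mul, ← integral_sub]
  · congr 1; ext t; ring
  · exact (integrable_cker_mul hz hu.ofReal).const_mul _
  · exact hu.ofReal

theorem re_schwarz {u : ℝ → ℝ} (hu : Integrable u ϖ) {z : ℂ} (hz : z ∈ UHP) :
    (schwarz u z).re = ∫ t, rho z t * u t ∂ϖ := by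
  have hz' := (im_pos_of_mem hz).ne'
  rw [schwarz_eq_integral hu hz']
  have hi : Integrable (fun t => (-I * (z + I) * cker z t - 1) * (u t : ℂ)) ϖ := by
    have := ((integrable_cker_mul hz' hu.ofReal).const_mul (-I * (z + I))).sub hu.ofReal
    refine this.congr (Eventually.of_forall fun t => ?_)
    simp; ring
  rw [← RCLike.re_eq_complex_re, ← integral_re hi]
  congr 1; ext t
  rw [RCLike.re_eq_complex_re, re_mul_ofReal, rho_eq_re_cker hz']

theorem schwarz_I {u : ℝ → ℝ} (hu : Integrable u ϖ) :
    schwarz u I = ((∫ t, u t ∂ϖ : ℝ) : ℂ) := by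
  rw [schwarz_eq_integral hu (by simp), ← integral_complex_ofReal]
  congr 1; ext t
  have : cker I t = 1 := div_self (ofReal_sub_I_ne_zero t)
  rw [this]
  ring_nf
  simp
  ring

theorem schwarz_congr {u v : ℝ → ℝ} (h : u =ᵐ[volume] v) (z : ℂ) : schwarz u z = schwarz v z := by
  rw [schwarz, schwarz]
  congr 1
  refine integral_congr_ae ?_
  filter_upwards [h] with t ht
  rw [ht]

theorem schwarz_add {u v : ℝ → ℝ} (hu : Integrable u ϖ) (hv : Integrable v ϖ) {z : ℂ}
    (hz : z ∈ UHP) : schwarz (fun t => u t + v t) z = schwarz u z + schwarz v z := by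
  have hz' := (im_pos_of_mem hz).ne'
  have hi : ∀ {u : ℝ → ℝ}, Integrable u ϖ →
      Integrable (fun t => (-I * (z + I) * cker z t - 1) * (u t : ℂ)) ϖ := by
    intro u hu
    have := ((integrable_cker_mul hz' hu.ofReal).const_mul (-I * (z + I))).sub hu.ofReal
    refine this.congr (Eventually.of_forall fun t => ?_)
    simp; ring
  rw [schwarz_eq_integral (u := fun t => u t + v t) (hu.add hv) hz', schwarz_eq_integral hu hz',
    schwarz_eq_integral hv hz',
    ← integral_add (hi hu) (hi hv)]
  congr 1; ext t
  push_cast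
  ring

theorem schwarz_const_mul (c : ℝ) (u : ℝ → ℝ) (z : ℂ) :
    schwarz (fun t => c * u t) z = c * schwarz u z := by
  simp only [schwarz]
  rw [mul_left_comm (c : ℂ), ← integral_const_mul (c : ℂ)]
  congr 1
  refine integral_congr_ae (Eventually.of_forall fun t => ?_)
  push_cast
  ring

theorem schwarz_neg (u : ℝ → ℝ) (z : ℂ) : schwarz (fun t => -u t) z = -schwarz u z := by
  simpa using schwarz_const_mul (-1) u z

/-! ### Rigidity of analytic functions on the half-plane -/

theorem eq_const_of_norm_le {F : ℂ → ℂ} (hF : DifferentiableOn ℂ F UHP) {c : ℂ} (hc : c ∈ UHP)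
    (h : ∀ z ∈ UHP, ‖F z‖ ≤ ‖F c‖) {z : ℂ} (hz : z ∈ UHP) : F z = F c :=
  Complex.eqOn_of_isPreconnected_of_isMaxOn_norm convex_UHP.isPreconnected isOpen_UHP hF hc h hz

theorem eq_const_of_re_eq_zero {F : ℂ → ℂ} (hF : DifferentiableOn ℂ F UHP)
    (h : ∀ z ∈ UHP, (F z).re = 0) {z : ℂ} (hz : z ∈ UHP) : F z = F I := by
  have hE : DifferentiableOn ℂ (fun z => exp (F z)) UHP := hF.cexp
  have hn : ∀ z ∈ UHP, ‖exp (F z)‖ = 1 := fun z hz => by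
    rw [Complex.norm_exp, h z hz, Real.exp_zero]
  have hc : ∀ z ∈ UHP, exp (F z) = exp (F I) := fun z hz =>
    eq_const_of_norm_le hE I_mem_UHP (fun w hw => by rw [hn w hw, hn I I_mem_UHP]) hz
  refine isOpen_UHP.is_const_of_deriv_eq_zero convex_UHP.isPreconnected hF (fun w hw => ?_) hz
    I_mem_UHP
  have h1 : HasDerivAt F (deriv F w) w := (hF.differentiableAt (isOpen_UHP.mem_nhds hw)).hasDerivAt
  have h2 : HasDerivAt (fun z => exp (F z)) 0 w :=
    (hasDerivAt_const w (exp (F I))).congr_of_eventuallyEq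
      (eventually_of_mem (isOpen_UHP.mem_nhds hw) hc)
  have h3 := h1.cexp.unique h2
  exact (mul_eq_zero.1 h3).resolve_left (exp_ne_zero _)

/-- A function that is both analytic and anti-analytic is constant. -/
theorem eq_const_of_eq_conj {F G : ℂ → ℂ} (hF : DifferentiableOn ℂ F UHP)
    (hG : DifferentiableOn ℂ G UHP) (h : ∀ z ∈ UHP, F z = conj (G z)) {z : ℂ} (hz : z ∈ UHP) :
    F z = F I := by
  have h1 := eq_const_of_re_eq_zero (F := fun z => F z - G z) (hF.sub hG)
    (fun z hz => by simp [h z hz]) hz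
  have h2 := eq_const_of_re_eq_zero (F := fun z => I * (F z + G z)) ((hF.add hG).const_mul I)
    (fun z hz => by simp [h z hz]) hz
  have h3 := mul_left_cancel₀ I_ne_zero h2
  linear_combination (h1 + h3) / 2

/-! ### Radial limits of Poisson integrals -/

theorem integral_rho {z : ℂ} (hz : z ∈ UHP) : ∫ t, (rho z t : ℂ) ∂ϖ = 1 := by
  have hz' := im_pos_of_mem hz
  have hγ : z.im.toNNReal ≠ 0 := (Real.toNNReal_pos.2 hz').ne'
  have h := ProbabilityTheory.integral_cauchyPDFReal_eq_one z.re hγ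
  have h' := congrArg ((↑) : ℝ → ℂ) h
  rw [← integral_complex_ofReal, ofReal_one] at h'
  rw [integral_poisson]
  refine Eq.trans ?_ h'
  congr 1; ext t
  rw [ProbabilityTheory.cauchyPDFReal_def, Real.coe_toNNReal _ hz'.le]
  have h1 : (0 : ℝ) < (t - z.re) ^ 2 + z.im ^ 2 := by positivity
  have h2 : (0 : ℝ) < 1 + t ^ 2 := by positivity
  have h3 : rho z t / (Real.pi * (1 + t ^ 2)) =
      Real.pi⁻¹ * z.im * ((t - z.re) ^ 2 + z.im ^ 2)⁻¹ := by
    have h4 : normSq ((t : ℂ) - z) = (t - z.re) ^ 2 + z.im ^ 2 := by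
      simp [normSq_apply]; ring
    rw [rho, h4]
    field_simp
  have h5 := congrArg ((↑) : ℝ → ℂ) h3
  push_cast at h5 ⊢
  exact h5

theorem pext_const {z : ℂ} (hz : z ∈ UHP) (c : ℂ) : pext (fun _ => c) z = c := by
  rw [pext, integral_mul_const, integral_rho hz, one_mul]

theorem integral_rho_real {z : ℂ} (hz : z ∈ UHP) : ∫ t, rho z t ∂ϖ = 1 := by
  have h := pext_ofReal (fun _ => 1) z
  have h2 := pext_const hz 1
  simp only [mul_one, ofReal_one] at h
  rw [h2] at h
  exact_mod_cast h.symm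

theorem locallyIntegrable_of_poisson {f : ℝ → ℂ} (hf : Integrable f ϖ) :
    LocallyIntegrable f volume := by
  rw [integrable_poisson] at hf
  have h := hf.locallyIntegrable.continuous_mul
    (g := fun t : ℝ => (Real.pi * (1 + (t : ℂ) ^ 2) : ℂ)) (by fun_prop)
  refine h.congr (Eventually.of_forall fun t => ?_)
  have h2 := one_add_sq_ne_zero t
  have hpi : (Real.pi : ℂ) ≠ 0 := by simp [Real.pi_ne_zero]
  simp only
  field_simp

/-- The Poisson density is dominated by a dyadic sum of normalized indicators of balls. -/
theorem poissonDensity_le_tsum {y : ℝ} (hy : 0 < y) (s : ℝ) :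
    ENNReal.ofReal (y / (s ^ 2 + y ^ 2)) ≤
      ∑' k : ℕ, Set.indicator {s : ℝ | |s| ≤ 2 ^ k * y}
        (fun _ => ENNReal.ofReal (4 * (1 / 4) ^ k / y)) s := by
  have hex : ∃ k : ℕ, |s| ≤ 2 ^ k * y := by
    obtain ⟨k, hk⟩ := pow_unbounded_of_one_lt (|s| / y) (one_lt_two)
    exact ⟨k, by rw [div_lt_iff₀ hy] at hk; exact hk.le⟩
  classical
  have hk := Nat.find_spec hex
  set k := Nat.find hex with hkdef
  refine le_trans ?_ (ENNReal.le_tsum k)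
  rw [Set.indicator_of_mem (show s ∈ {s : ℝ | |s| ≤ 2 ^ k * y} from hk)]
  apply ENNReal.ofReal_le_ofReal
  rcases Nat.eq_zero_or_pos k with h0 | hpos
  · rw [h0, pow_zero, mul_one, div_le_div_iff₀ (by nlinarith [sq_nonneg s, sq_pos_of_pos hy]) hy]
    nlinarith [sq_nonneg s]
  · obtain ⟨j, hj⟩ : ∃ j, k = j + 1 := ⟨k - 1, by omega⟩
    have hlt : 2 ^ j * y < |s| := not_le.1 (Nat.find_min hex (by omega))
    have hsq : (2 ^ j * y) ^ 2 < s ^ 2 := by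
      rw [← sq_abs s]; gcongr
    rw [hj, pow_succ (1 / 4 : ℝ) j,
      div_le_div_iff₀ (by nlinarith [sq_nonneg s, sq_pos_of_pos hy]) hy]
    have h4 : ((1 : ℝ) / 4) ^ j * (2 ^ j) ^ 2 = 1 := by
      rw [← pow_mul, mul_comm j 2, pow_mul, ← mul_pow]; norm_num
    have h5 : y ^ 2 ≤ ((1 : ℝ) / 4) ^ j * s ^ 2 := by
      calc y ^ 2 = (1 / 4) ^ j * (2 ^ j * y) ^ 2 := by rw [mul_pow, ← mul_assoc, h4, one_mul]
        _ ≤ _ := by gcongr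
    have h6 : 0 ≤ ((1 : ℝ) / 4) ^ j * y ^ 2 := by positivity
    nlinarith

/-- The part of the Poisson integral near `x` is controlled by the averages of `g` over balls
around `x`. -/
theorem lintegral_poisson_near_le {g : ℝ → ℝ≥0∞} {x δ ε : ℝ}
    (hA : ∀ r : ℝ, 0 < r → ∫⁻ t in Metric.closedBall x r ∩ Metric.ball x δ, g t ≤
      ENNReal.ofReal (ε * r)) (hε : 0 ≤ ε) {y : ℝ} (hy : 0 < y) (hg : AEMeasurable g volume) :
    ∫⁻ t in Metric.ball x δ, ENNReal.ofReal (y / ((t - x) ^ 2 + y ^ 2)) * g t ≤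
      ENNReal.ofReal (8 * ε) := by
  have hm : ∀ k : ℕ, MeasurableSet {s : ℝ | |s| ≤ 2 ^ k * y} := fun k =>
    measurableSet_le (by fun_prop) (by fun_prop)
  calc ∫⁻ t in Metric.ball x δ, ENNReal.ofReal (y / ((t - x) ^ 2 + y ^ 2)) * g t
      ≤ ∫⁻ t in Metric.ball x δ, ∑' k : ℕ, Set.indicator (Metric.closedBall x (2 ^ k * y))
        (fun t => ENNReal.ofReal (4 * (1 / 4) ^ k / y) * g t) t := by
        refine lintegral_mono fun t => ?_
        dsimp only
        refine (mul_le_mul_left (poissonDensity_le_tsum hy (t - x)) (g t)).trans_eq ?_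
        rw [← ENNReal.tsum_mul_right]
        congr 1; ext k
        by_cases h : |t - x| ≤ 2 ^ k * y
        · rw [Set.indicator_of_mem (show (t - x) ∈ {s : ℝ | |s| ≤ 2 ^ k * y} from h),
            Set.indicator_of_mem (by simpa [Real.dist_eq] using h)]
        · rw [Set.indicator_of_notMem (show (t - x) ∉ {s : ℝ | |s| ≤ 2 ^ k * y} from h),
            Set.indicator_of_notMem (by simpa [Real.dist_eq] using h), zero_mul]
    _ = ∑' k : ℕ, ∫⁻ t in Metric.ball x δ, Set.indicator (Metric.closedBall x (2 ^ k * y))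
        (fun t => ENNReal.ofReal (4 * (1 / 4) ^ k / y) * g t) t := by
        refine lintegral_tsum fun k => ?_
        exact ((hg.const_mul _).indicator measurableSet_closedBall).restrict
    _ ≤ ∑' k : ℕ, ENNReal.ofReal (4 * ε * (1 / 2) ^ k) := by
        refine ENNReal.tsum_le_tsum fun k => ?_
        rw [lintegral_indicator measurableSet_closedBall, Measure.restrict_restrict
          measurableSet_closedBall, lintegral_const_mul'' _ hg.restrict]
        refine (mul_le_mul_right (hA (2 ^ k * y) (by positivity)) _).trans_eq ?_
        rw [← ENNReal.ofReal_mul (by positivity)]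
        congr 1
        have h4 : ((1 : ℝ) / 4) ^ k * 2 ^ k = (1 / 2) ^ k := by rw [← mul_pow]; norm_num
        rw [← h4]; field_simp
    _ = ENNReal.ofReal (8 * ε) := by
        rw [← ENNReal.ofReal_tsum_of_nonneg (fun k => by positivity)
          (summable_geometric_two.mul_left _), tsum_mul_left, tsum_geometric_two]
        congr 1; ring

theorem rho_div_eq {x y : ℝ} (t : ℝ) :
    rho (x + y * I) t / (Real.pi * (1 + t ^ 2)) = Real.pi⁻¹ * (y / ((t - x) ^ 2 + y ^ 2)) := by
  have h2 : (0 : ℝ) < 1 + t ^ 2 := by positivity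
  have h4 : normSq ((t : ℂ) - (x + y * I)) = (t - x) ^ 2 + y ^ 2 := by
    simp [normSq_apply]; ring
  rw [rho, h4]
  simp
  field_simp

/-- Lebesgue's theorem for Poisson integrals: the Poisson extension of a summable function has
the function itself as radial limit almost everywhere. -/
theorem tendsto_pext {f : ℝ → ℂ} (hf : Integrable f ϖ) :
    ∀ᵐ x : ℝ, Tendsto (fun y : ℝ => pext f (x + y * I)) (𝓝[>] 0) (𝓝 (f x)) := by
  have hloc := locallyIntegrable_of_poisson hf
  filter_upwards [(Besicovitch.vitaliFamily (volume : Measure ℝ)).ae_tendsto_average_norm_sub hloc]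
    with x hx
  have hx' := hx.comp (Besicovitch.tendsto_filterAt (volume : Measure ℝ) x)
  have hg : Integrable (fun t => ‖f t - f x‖) ϖ := (hf.sub (integrable_const _)).norm
  set Cg := ∫ t, ‖f t - f x‖ ∂ϖ with hCg
  have hCg0 : 0 ≤ Cg := integral_nonneg fun t => norm_nonneg _
  rw [Metric.tendsto_nhds]
  intro ε hε
  -- a radius within which all the averages of `‖f - f x‖` are small
  obtain ⟨δ, hδ, hav⟩ : ∃ δ > 0, ∀ r : ℝ, 0 < r → r ≤ δ →
      ∫ t in Metric.closedBall x r, ‖f t - f x‖ ≤ (ε / 16) * r := by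
    have h1 := (hx'.eventually (gt_mem_nhds (show (0 : ℝ) < ε / 32 by positivity)))
    obtain ⟨η, hη, h3⟩ := Metric.eventually_nhds_iff.1 (eventually_nhdsWithin_iff.1 h1)
    refine ⟨η / 2, by positivity, fun r hr hrη => ?_⟩
    have h4 := h3 (y := r) (by rw [Real.dist_eq, sub_zero, abs_of_pos hr]; linarith) hr
    simp only [Function.comp] at h4
    rw [setAverage_eq, smul_eq_mul] at h4
    simp only [Measure.real, Real.volume_closedBall] at h4
    rw [ENNReal.toReal_ofReal (by positivity), inv_mul_lt_iff₀ (by positivity)] at h4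
    linarith
  have hA : ∀ r : ℝ, 0 < r → ∫⁻ t in Metric.closedBall x r ∩ Metric.ball x δ, ‖f t - f x‖ₑ ≤
      ENNReal.ofReal ((ε / 16) * r) := by
    intro r hr
    have hmin : 0 < min r δ := lt_min hr hδ
    calc ∫⁻ t in Metric.closedBall x r ∩ Metric.ball x δ, ‖f t - f x‖ₑ
        ≤ ∫⁻ t in Metric.closedBall x (min r δ), ‖f t - f x‖ₑ := by
          refine lintegral_mono_set fun t ht => ?_
          exact le_min ht.1 (Metric.mem_ball.1 ht.2).le
      _ = ENNReal.ofReal (∫ t in Metric.closedBall x (min r δ), ‖f t - f x‖) := by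
          rw [ofReal_integral_norm_eq_lintegral_enorm]
          exact ((hloc.integrableOn_isCompact (isCompact_closedBall x _)).sub
            (by exact integrableOn_const (isCompact_closedBall x _).measure_lt_top.ne))
      _ ≤ ENNReal.ofReal ((ε / 16) * r) := by
          apply ENNReal.ofReal_le_ofReal
          refine (hav _ hmin (min_le_right _ _)).trans ?_
          gcongr
          exact min_le_left _ _
  -- outside the ball of radius `δ` the kernel is at most `C y`
  set C := 2 + (1 + 2 * x ^ 2) / δ ^ 2 with hC
  have hCpos : 0 < C := by positivity
  have hsmall : ∀ᶠ y : ℝ in 𝓝[>] 0, y * (C * Cg) < ε / 2 := by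
    have : Tendsto (fun y : ℝ => y * (C * Cg)) (𝓝[>] 0) (𝓝 (0 * (C * Cg))) :=
      ((continuous_mul_const _).tendsto 0).mono_left nhdsWithin_le_nhds
    rw [zero_mul] at this
    exact this.eventually (gt_mem_nhds (by positivity))
  filter_upwards [hsmall, self_mem_nhdsWithin] with y hys hy
  have hy : 0 < y := hy
  have hz := ofReal_add_mul_I_mem (x := x) hy
  rw [dist_eq_norm]
  have e1 : pext f (x + y * I) - f x = pext (fun t => f t - f x) (x + y * I) := by
    rw [pext_sub hz hf (integrable_const _), pext_const hz]
  have hint : Integrable (fun t => (rho (x + y * I) t : ℂ) * (f t - f x)) ϖ :=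
    integrable_rho_mul hz (hf.sub (integrable_const _))
  have e2 : ‖pext (fun t => f t - f x) (x + y * I)‖ ≤
      ∫ t, rho (x + y * I) t * ‖f t - f x‖ ∂ϖ := by
    refine (norm_integral_le_integral_norm _).trans_eq ?_
    congr 1; ext t
    rw [norm_mul, norm_real, Real.norm_of_nonneg (rho_pos hz t).le]
  have hint' : Integrable (fun t => rho (x + y * I) t * ‖f t - f x‖) ϖ :=
    integrable_rho_mul_real hz hg
  have e3 := integral_add_compl (μ := ϖ) (measurableSet_ball (x := x) (ε := δ)) hint'
  have far : ∫ t in (Metric.ball x δ)ᶜ, rho (x + y * I) t * ‖f t - f x‖ ∂ϖ ≤ y * (C * Cg) := by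
    calc ∫ t in (Metric.ball x δ)ᶜ, rho (x + y * I) t * ‖f t - f x‖ ∂ϖ
        ≤ ∫ t in (Metric.ball x δ)ᶜ, y * C * ‖f t - f x‖ ∂ϖ := by
          refine setIntegral_mono_on hint'.integrableOn (hg.const_mul _).integrableOn
            (measurableSet_ball.compl) fun t ht => ?_
          gcongr
          have ht' : δ ≤ |t - x| := by simpa [Real.dist_eq] using ht
          have h1 : δ ^ 2 ≤ (t - x) ^ 2 := by rw [← sq_abs (t - x)]; gcongr
          have h4 : normSq ((t : ℂ) - (x + y * I)) = (t - x) ^ 2 + y ^ 2 := by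
            simp [normSq_apply]; ring
          have h5 : (0 : ℝ) < (t - x) ^ 2 + y ^ 2 := by positivity
          rw [rho, h4, div_le_iff₀ h5]
          simp only [add_im, ofReal_im, mul_im, ofReal_re, I_im, mul_one, I_re, mul_zero, add_zero,
            zero_add]
          rw [mul_assoc]
          gcongr
          have h6 : (1 + 2 * x ^ 2) ≤ (1 + 2 * x ^ 2) / δ ^ 2 * (t - x) ^ 2 := by
            rw [div_mul_eq_mul_div, le_div_iff₀ (by positivity)]
            gcongr
          have h7 : 0 ≤ C * y ^ 2 := by positivity
          have h8 : C * (t - x) ^ 2 = 2 * (t - x) ^ 2 + (1 + 2 * x ^ 2) / δ ^ 2 * (t - x) ^ 2 := by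
            rw [hC]; ring
          nlinarith [sq_nonneg (t - 2 * x)]
      _ ≤ ∫ t, y * C * ‖f t - f x‖ ∂ϖ :=
          setIntegral_le_integral (hg.const_mul _) (Eventually.of_forall fun t => by positivity)
      _ = y * (C * Cg) := by rw [integral_const_mul, mul_assoc]
  have near : ∫ t in Metric.ball x δ, rho (x + y * I) t * ‖f t - f x‖ ∂ϖ ≤ ε / 2 := by
    have hae := aestronglyMeasurable_poisson.1 hf.aestronglyMeasurable
    have hm : AEMeasurable (fun t => ‖f t - f x‖ₑ) volume :=
      (hae.sub aestronglyMeasurable_const).enorm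
    have h1 := lintegral_poisson_near_le (ε := ε / 16) hA (by positivity) hy hm
    rw [integral_eq_lintegral_of_nonneg_ae (Eventually.of_forall fun t =>
      mul_nonneg (rho_pos hz t).le (norm_nonneg _)) hint'.integrableOn.aestronglyMeasurable]
    refine ENNReal.toReal_le_of_le_ofReal (by positivity) ?_
    have hm2 : AEMeasurable (fun t => ENNReal.ofReal (rho (x + y * I) t * ‖f t - f x‖)) volume := by
      refine AEMeasurable.ennreal_ofReal (AEMeasurable.mul ?_ ?_)
      · exact (continuous_rho (im_pos_of_mem hz).ne').aemeasurable
      · exact (hae.sub aestronglyMeasurable_const).norm.aemeasurable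
    rw [poissonMeasure, restrict_withDensity measurableSet_ball,
      lintegral_withDensity_eq_lintegral_mul₀ (by fun_prop) hm2.restrict]
    refine (lintegral_mono fun t => ?_).trans (h1.trans (ENNReal.ofReal_le_ofReal (by linarith)))
    simp only [Pi.mul_apply]
    rw [← ENNReal.ofReal_mul (poissonDensity_pos t).le, ← mul_assoc, one_div_mul_eq_div,
      rho_div_eq, ENNReal.ofReal_mul (by positivity), ofReal_norm]
    gcongr
    refine mul_le_of_le_one_left (by positivity) ?_
    exact inv_le_one_of_one_le₀ (by linarith [Real.pi_gt_three])
  rw [e1]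
  linarith

/-! ### The Hardy class of the Poisson measure -/

/-- `F` is an analytic function on the upper half-plane which is the Poisson extension of
`f ∈ L²(dt / (π (1 + t²)))`. The functions `f` that occur are the boundary functions of the
conformal transplant of `H²` of the unit disc; a function `g` is in the Hardy space of the
half-plane exactly if `(t + i) g` is such an `f`. -/
structure HardyPair (F : ℂ → ℂ) (f : ℝ → ℂ) : Prop where
  memLp : MemLp f 2 ϖ
  analytic : DifferentiableOn ℂ F UHP
  eq_pext : ∀ z ∈ UHP, F z = pext f z

theorem integrable_of_memLp {f : ℝ → ℂ} (hf : MemLp f 2 ϖ) : Integrable f ϖ :=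
  hf.integrable (by norm_num)

theorem integrable_conj {f : ℝ → ℂ} {μ : Measure ℝ} (hf : Integrable f μ) :
    Integrable (fun t => conj (f t)) μ :=
  hf.mono (continuous_conj.comp_aestronglyMeasurable hf.1) (Eventually.of_forall fun t => by simp)

theorem memLp_conj {f : ℝ → ℂ} {μ : Measure ℝ} {p : ℝ≥0∞} (hf : MemLp f p μ) :
    MemLp (fun t => conj (f t)) p μ :=
  (hf.star : MemLp (star f) p μ)

namespace HardyPair

theorem integrable {F : ℂ → ℂ} {f : ℝ → ℂ} (h : HardyPair F f) : Integrable f ϖ :=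
  integrable_of_memLp h.memLp

/-- Radial boundary values. -/
theorem radial {F : ℂ → ℂ} {f : ℝ → ℂ} (h : HardyPair F f) :
    ∀ᵐ x : ℝ, Tendsto (fun y : ℝ => F (x + y * I)) (𝓝[>] 0) (𝓝 (f x)) := by
  filter_upwards [tendsto_pext h.integrable] with x hx
  refine hx.congr' ?_
  filter_upwards [self_mem_nhdsWithin] with y hy
  exact (h.eq_pext _ (ofReal_add_mul_I_mem hy)).symm

/-- The analytic Poisson extensions are those of the functions orthogonal to the conjugate Cauchy
kernels. The point is that `(z̄ + i) cint f z̄` is anti-analytic; analyticity of the extension makes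
it analytic too, hence constant, and it vanishes at `i`. -/
theorem cint_conj {F : ℂ → ℂ} {f : ℝ → ℂ} (h : HardyPair F f) {z : ℂ} (hz : z ∈ UHP) :
    cint f (conj z) = 0 := by
  have hf := h.integrable
  have hfc : Integrable (fun t => conj (f t)) ϖ := integrable_conj hf
  -- the conjugate of `(z̄ + i) cint f z̄` as an analytic function
  set G : ℂ → ℂ := fun z => (z - I) * ∫ t, ((t : ℂ) + I) / ((t : ℂ) - z) * conj (f t) ∂ϖ with hG
  have hGc : ∀ z, conj (G z) = (conj z + I) * cint f (conj z) := by
    intro z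
    simp only [hG, map_mul, map_sub, conj_I, sub_neg_eq_add, cint, ← integral_conj]
    congr 2; ext t
    simp [cker, sub_eq_add_neg]
  have hGd : DifferentiableOn ℂ G UHP := by
    have e : ∀ z ∈ UHP, G z = (z - I) * cint (fun t => conj (zeta t) * conj (f t)) z := by
      intro z hz
      simp only [hG, cint]
      congr 2; ext t
      have h1 := ofReal_sub_ne_zero (im_pos_of_mem hz).ne' t
      have h2 := ofReal_sub_I_ne_zero t
      simp only [zeta, cker, map_div₀, conj_ofReal_add_I, conj_ofReal_sub_I]
      field_simp
    have hi : Integrable (fun t => conj (zeta t) * conj (f t)) ϖ :=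
      hfc.bdd_mul (c := 1) (continuous_conj.comp continuous_zeta).aestronglyMeasurable
        (Eventually.of_forall fun t => by simp [norm_zeta])
    exact ((differentiableOn_id.sub_const I).mul (differentiableOn_cint hi)).congr e
  have hF1 : DifferentiableOn ℂ (fun z => (z + I) * cint f z - 2 * I * F z) UHP :=
    ((differentiableOn_id.add_const I).mul (differentiableOn_cint hf)).sub
      (h.analytic.const_mul _)
  have key : ∀ z ∈ UHP, (z + I) * cint f z - 2 * I * F z = (conj z + I) * cint f (conj z) := by
    intro z hz
    have hI := I_ne_zero
    rw [h.eq_pext z hz, pext_eq_cint hz hf]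
    field_simp
    ring
  have hzero : ∀ z ∈ UHP, (conj z + I) * cint f (conj z) = 0 := by
    intro z hz
    have h1 := eq_const_of_eq_conj hF1 hGd (fun z hz => by rw [key z hz, hGc]) hz
    rw [key z hz, key I I_mem_UHP] at h1
    simpa using h1
  have hne : ∀ z ∈ UHP, z ≠ I → cint f (conj z) = 0 := by
    intro z hz hzI
    refine (mul_eq_zero.1 (hzero z hz)).resolve_left fun h0 => hzI ?_
    have := congrArg conj h0
    simp only [map_add, conj_conj, conj_I, map_zero] at this
    linear_combination this
  by_cases hzI : z = I
  · have hc : ContinuousAt (fun y : ℝ => cint f (conj ((y : ℂ) * I))) 1 := by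
      refine ContinuousAt.comp (f := fun y : ℝ => conj ((y : ℂ) * I))
        (differentiableAt_cint hf (by simp)).continuousAt ?_
      exact (continuous_conj.comp (by fun_prop)).continuousAt
    have h2 : Tendsto (fun y : ℝ => cint f (conj ((y : ℂ) * I))) (𝓝[>] 1) (𝓝 0) := by
      refine tendsto_const_nhds.congr' ?_
      filter_upwards [self_mem_nhdsWithin] with y hy
      have hy : (1 : ℝ) < y := hy
      refine (hne _ (by simp [UHP]; linarith) fun h0 => ?_).symm
      have := congrArg Complex.im h0
      simp at this; linarith
    have h3 := tendsto_nhds_unique (hc.tendsto.mono_left nhdsWithin_le_nhds) h2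
    rw [hzI]
    simpa using h3
  · exact hne z hz hzI

/-- Cauchy's formula. -/
theorem eq_cint {F : ℂ → ℂ} {f : ℝ → ℂ} (h : HardyPair F f) {z : ℂ} (hz : z ∈ UHP) :
    F z = (z + I) / (2 * I) * cint f z := by
  rw [h.eq_pext z hz, pext_eq_cint hz h.integrable, h.cint_conj hz, mul_zero, sub_zero]

theorem of_cint {f : ℝ → ℂ} (hf : MemLp f 2 ϖ) (h : ∀ z ∈ UHP, cint f (conj z) = 0) :
    HardyPair (pext f) f where
  memLp := hf
  analytic := by
    have hi := integrable_of_memLp hf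
    have hd : DifferentiableOn ℂ (fun z => (z + I) / (2 * I) * cint f z) UHP :=
      (by fun_prop : DifferentiableOn ℂ (fun z : ℂ => (z + I) / (2 * I)) UHP).mul
        (differentiableOn_cint hi)
    refine hd.congr fun z hz => ?_
    rw [pext_eq_cint hz hi, h z hz, mul_zero, sub_zero]
  eq_pext := fun _ _ => rfl

theorem congr {F G : ℂ → ℂ} {f g : ℝ → ℂ} (h : HardyPair F f) (hF : ∀ z ∈ UHP, G z = F z)
    (hf : g =ᵐ[volume] f) : HardyPair G g where
  memLp := (memLp_congr_ae (by rwa [EventuallyEq, ae_poissonMeasure])).2 h.memLp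
  analytic := h.analytic.congr hF
  eq_pext := fun z hz => by rw [hF z hz, h.eq_pext z hz, pext_congr hf]

theorem add {F G : ℂ → ℂ} {f g : ℝ → ℂ} (hF : HardyPair F f) (hG : HardyPair G g) :
    HardyPair (fun z => F z + G z) (fun t => f t + g t) where
  memLp := hF.memLp.add hG.memLp
  analytic := hF.analytic.add hG.analytic
  eq_pext := fun z hz => by
    rw [hF.eq_pext z hz, hG.eq_pext z hz, pext_add hz hF.integrable hG.integrable]

theorem const_mul {F : ℂ → ℂ} {f : ℝ → ℂ} (hF : HardyPair F f) (c : ℂ) :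
    HardyPair (fun z => c * F z) (fun t => c * f t) where
  memLp := hF.memLp.const_mul c
  analytic := hF.analytic.const_mul c
  eq_pext := fun z hz => by rw [hF.eq_pext z hz, pext_const_mul]

theorem const (c : ℂ) : HardyPair (fun _ => c) (fun _ => c) where
  memLp := memLp_const c
  analytic := differentiableOn_const c
  eq_pext := fun _ hz => (pext_const hz c).symm

/-- An analytic function with the same radial limits is the same function. -/
theorem eq_of_ae_eq {F G : ℂ → ℂ} {f g : ℝ → ℂ} (hF : HardyPair F f) (hG : HardyPair G g)
    (h : f =ᵐ[volume] g) {z : ℂ} (hz : z ∈ UHP) : F z = G z := by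
  rw [hF.eq_pext z hz, hG.eq_pext z hz, pext_congr h]

theorem ae_eq_of_eq {F G : ℂ → ℂ} {f g : ℝ → ℂ} (hF : HardyPair F f) (hG : HardyPair G g)
    (h : ∀ z ∈ UHP, F z = G z) : f =ᵐ[volume] g := by
  filter_upwards [hF.radial, hG.radial] with x h1 h2
  refine tendsto_nhds_unique h1 (h2.congr' ?_)
  filter_upwards [self_mem_nhdsWithin] with y hy
  exact (h _ (ofReal_add_mul_I_mem hy)).symm

/-- A bound for the boundary function is a bound for the extension. -/
theorem norm_le {F : ℂ → ℂ} {f : ℝ → ℂ} (hF : HardyPair F f) {C : ℝ}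
    (hC : ∀ᵐ t : ℝ, ‖f t‖ ≤ C) {z : ℂ} (hz : z ∈ UHP) : ‖F z‖ ≤ C := by
  rw [hF.eq_pext z hz, pext]
  have hC0 : Integrable (fun t => rho z t * C) ϖ :=
    integrable_rho_mul_real hz (integrable_const C)
  calc _ ≤ ∫ t, rho z t * C ∂ϖ := by
        refine norm_integral_le_of_norm_le hC0 ?_
        rw [ae_poissonMeasure]
        filter_upwards [hC] with t ht
        rw [norm_mul, norm_real, Real.norm_of_nonneg (rho_pos hz t).le]
        exact mul_le_mul_of_nonneg_left ht (rho_pos hz t).le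
    _ = C := by rw [integral_mul_const, integral_rho_real hz, one_mul]

end HardyPair

theorem inner_toLp {f g : ℝ → ℂ} (hf : MemLp f 2 ϖ) (hg : MemLp g 2 ϖ) :
    inner ℂ (hf.toLp f) (hg.toLp g) = ∫ t, conj (f t) * g t ∂ϖ := by
  rw [L2.inner_def]
  refine integral_congr_ae ?_
  filter_upwards [hf.coeFn_toLp, hg.coeFn_toLp] with t h1 h2
  rw [h1, h2]
  simp [mul_comm]

/-- Weak sequential compactness of balls in Hilbert space, along an ultrafilter. -/
theorem exists_weak_cluster {E : Type*} [NormedAddCommGroup E] [InnerProductSpace ℂ E]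
    [CompleteSpace E] (x : ℕ → E) {C : ℝ} (hC : ∀ n, ‖x n‖ ≤ C) :
    ∃ x₀ : E, ∃ U : Ultrafilter ℕ, (U : Filter ℕ) ≤ atTop ∧
      ∀ y, Tendsto (fun n => inner ℂ (x n) y) U (𝓝 (inner ℂ x₀ y)) := by
  let U : Ultrafilter ℕ := Ultrafilter.of atTop
  let d : ℕ → WeakDual ℂ E := fun n =>
    StrongDual.toWeakDual (InnerProductSpace.toDual ℂ E (x n))
  have hmem : ∀ n, d n ∈ WeakDual.toStrongDual ⁻¹' Metric.closedBall (0 : StrongDual ℂ E) C := by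
    intro n
    simp only [d, Set.mem_preimage, mem_closedBall_zero_iff]
    exact ((InnerProductSpace.toDual ℂ E).norm_map (x n)).trans_le (hC n)
  obtain ⟨l, -, hl⟩ := (WeakDual.isCompact_closedBall (0 : StrongDual ℂ E) C).ultrafilter_le_nhds
    (U.map d) (by
      rw [le_principal_iff]
      exact Ultrafilter.mem_map.2 (Filter.univ_mem' hmem))
  refine ⟨(InnerProductSpace.toDual ℂ E).symm (WeakDual.toStrongDual l), U,
    Ultrafilter.of_le _, fun y => ?_⟩
  have h1 : Tendsto (fun n => d n y) U (𝓝 (l y)) :=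
    ((WeakDual.eval_continuous y).tendsto l).comp hl
  rw [InnerProductSpace.toDual_symm_apply]
  exact h1

theorem exists_weak_limit {b : ℕ → ℝ → ℂ} (hb : ∀ n, MemLp (b n) 2 ϖ) {C : ℝ}
    (hC : ∀ n, (eLpNorm (b n) 2 ϖ).toReal ≤ C) :
    ∃ g : ℝ → ℂ, MemLp g 2 ϖ ∧ ∃ U : Ultrafilter ℕ, (U : Filter ℕ) ≤ atTop ∧
      ∀ k : ℝ → ℂ, MemLp k 2 ϖ →
        Tendsto (fun n => ∫ t, k t * b n t ∂ϖ) U (𝓝 (∫ t, k t * g t ∂ϖ)) := by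
  obtain ⟨x₀, U, hU, h⟩ := exists_weak_cluster (fun n => (hb n).toLp (b n)) (C := C)
    (fun n => by rw [Lp.norm_toLp]; exact hC n)
  refine ⟨x₀, Lp.memLp _, U, hU, fun k hk => ?_⟩
  have h1 := (continuous_conj.tendsto _).comp (h ((hk.star : MemLp (star k) 2 ϖ).toLp _))
  have h2 : ∀ g (hg : MemLp g 2 ϖ), conj (inner ℂ (hg.toLp g)
      ((hk.star : MemLp (star k) 2 ϖ).toLp _)) = ∫ t, k t * g t ∂ϖ := by
    intro g hg
    rw [inner_toLp, ← integral_conj]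
    congr 1; ext t
    simp [mul_comm]
  have h3 := h2 _ (Lp.memLp x₀)
  rw [Lp.toLp_coeFn] at h3
  rw [← h3]
  refine h1.congr fun n => ?_
  rw [← h2 _ (hb n)]
  rfl

theorem memLp_rho {z : ℂ} (hz : z ∈ UHP) : MemLp (fun t => (rho z t : ℂ)) 2 ϖ :=
  MemLp.of_bound (continuous_rho_complex hz).aestronglyMeasurable _
    (Eventually.of_forall (norm_rho_le hz))

theorem memLp_cker {z : ℂ} (hz : z.im ≠ 0) : MemLp (cker z) 2 ϖ :=
  MemLp.of_bound (continuous_cker hz).aestronglyMeasurable _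
    (Eventually.of_forall (norm_cker_le hz))

/-! ### Bounded analytic functions -/

/-- The Poisson formula for a bounded function analytic across the real line. -/
theorem pext_of_analytic_bounded {g : ℂ → ℂ} {ε C : ℝ} (hε : 0 < ε)
    (hg : DifferentiableOn ℂ g {w | -ε < w.im}) (hC : ∀ w, -ε < w.im → ‖g w‖ ≤ C) {z : ℂ}
    (hz : z ∈ UHP) : pext (fun t => g t) z = g z := by
  have hz' := im_pos_of_mem hz
  have hzim := hz'.ne'
  have hzε : -ε < z.im := by linarith
  have hopen : IsOpen {w : ℂ | -ε < w.im} := isOpen_lt continuous_const continuous_im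
  have hgc : Continuous fun t : ℝ => g t := by
    refine hg.continuousOn.comp_continuous continuous_ofReal fun t => ?_
    simpa using hε
  have hgi : Integrable (fun t : ℝ => g t) ϖ :=
    (integrable_const C).mono' hgc.aestronglyMeasurable
      (Eventually.of_forall fun t => hC _ (by simpa using hε))
  -- Cauchy's theorem is applied to this function, which is `(g - g z)` times the Poisson kernel on
  -- the line and decays like `|w|⁻²`, over the rectangles with corners `-R` and `R + R i`
  set φ : ℂ → ℂ := fun w => dslope g z w / (w - conj z) with hφ
  have hφd : DifferentiableOn ℂ φ {w | -min ε z.im < w.im} := by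
    refine DifferentiableOn.div ?_ (by fun_prop) fun w hw h0 => ?_
    · refine ((Complex.differentiableOn_dslope (hopen.mem_nhds hzε)).2 hg).mono fun w hw => ?_
      have h2 : -min ε z.im < w.im := hw
      exact lt_of_le_of_lt (neg_le_neg (min_le_left _ _)) h2
    · have h1 : w = conj z := sub_eq_zero.1 h0
      have h2 : -min ε z.im < w.im := hw
      rw [h1, conj_im] at h2
      linarith [min_le_right ε z.im]
  have hφt : ∀ t : ℝ, φ t = (g t - g z) * ((Real.pi / z.im : ℂ) *
      ((rho z t : ℂ) / (Real.pi * (1 + (t : ℂ) ^ 2)))) := by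
    intro t
    have h1 := ofReal_sub_ne_zero hzim t
    have h2 := ofReal_sub_ne_zero (z := conj z) (by simpa using hzim) t
    have h3 : (normSq ((t : ℂ) - z) : ℂ) = ((t : ℂ) - z) * ((t : ℂ) - conj z) := by
      rw [← mul_conj]; simp
    have h4 := one_add_sq_ne_zero t
    have hpi : (Real.pi : ℂ) ≠ 0 := by simp [Real.pi_ne_zero]
    have hzc : (z.im : ℂ) ≠ 0 := by exact_mod_cast hzim
    simp only [hφ, rho]
    rw [dslope_of_ne _ (sub_ne_zero.1 h1), slope_def_field]
    push_cast
    rw [h3]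
    field_simp
  have hφi : Integrable fun t : ℝ => φ t := by
    have h1 := integrable_rho_mul hz (hgi.sub (integrable_const (g z)))
    rw [integrable_poisson] at h1
    refine (h1.const_mul (Real.pi / z.im : ℂ)).congr (Eventually.of_forall fun t => ?_)
    simp only [hφt, Pi.sub_apply]
    ring
  have hC0 : 0 ≤ C := (norm_nonneg _).trans (hC z hzε)
  have hbound : ∀ R : ℝ, 2 * ‖z‖ < R → 0 < R → ∀ w : ℂ, 0 ≤ w.im → R ≤ ‖w‖ →
      ‖φ w‖ ≤ 8 * C / R ^ 2 := by
    intro R hR hR0 w hw hwR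
    have h1 : R / 2 ≤ ‖w - z‖ := by linarith [norm_sub_norm_le w z]
    have h2 : R / 2 ≤ ‖w - conj z‖ := by
      have := norm_sub_norm_le w (conj z)
      rw [Complex.norm_conj] at this
      linarith
    have hne : w ≠ z := fun h => by rw [h, sub_self, norm_zero] at h1; linarith
    simp only [hφ]
    rw [dslope_of_ne _ hne, slope_def_field, norm_div, norm_div, div_div]
    have h3 : ‖g w - g z‖ ≤ 2 * C := by
      refine (norm_sub_le _ _).trans ?_
      linarith [hC w (by linarith), hC z hzε]
    calc ‖g w - g z‖ / (‖w - z‖ * ‖w - conj z‖) ≤ 2 * C / (R / 2 * (R / 2)) := by gcongr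
      _ = 8 * C / R ^ 2 := by field_simp; ring
  have hrect : ∀ R : ℝ, 2 * ‖z‖ < R → 0 < R → ‖∫ t in (-R)..R, φ t‖ ≤ 48 * C / R := by
    intro R hR hR0
    have h := integral_boundary_rect_eq_zero_of_differentiableOn φ (-R : ℝ) ((R : ℝ) + R * I)
      (hφd.mono fun w hw => by
        have := hw.2
        simp only [Set.mem_preimage, ofReal_im, add_im, mul_im, ofReal_re, I_im, mul_one, I_re,
          mul_zero, add_zero, zero_add, Set.uIcc_of_le hR0.le, Set.mem_Icc] at this
        have hm : 0 < min ε z.im := lt_min hε hz'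
        show -min ε z.im < w.im
        linarith [this.1])
    simp only [ofReal_re, ofReal_im, add_re, mul_re, I_re, mul_zero, I_im, zero_mul, sub_zero,
      add_zero, add_im, mul_im, mul_one, zero_add, ofReal_zero, smul_eq_mul] at h
    have hs : ∀ (a b : ℝ) (ψ : ℝ → ℂ), |b - a| ≤ 2 * R → (∀ s ∈ Set.uIoc a b, 0 ≤ (ψ s).im ∧
        R ≤ ‖ψ s‖) → ‖∫ s in a..b, φ (ψ s)‖ ≤ 8 * C / R ^ 2 * (2 * R) := by
      intro a b ψ hab hψ
      refine (intervalIntegral.norm_integral_le_of_norm_le_const fun s hs =>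
        hbound R hR hR0 _ (hψ s hs).1 (hψ s hs).2).trans ?_
      gcongr
    have h1 := hs (-R) R (fun x => x + R * I) (by rw [abs_of_pos] <;> linarith) (fun s _ => by
      refine ⟨by simpa using hR0.le, ?_⟩
      have := Complex.abs_im_le_norm ((s : ℂ) + R * I)
      simpa [abs_of_pos hR0] using this)
    have h2 := hs 0 R (fun y => R + y * I) (by rw [abs_of_pos] <;> linarith) (fun s hs => by
      rw [Set.uIoc_of_le hR0.le] at hs
      refine ⟨by simpa using hs.1.le, ?_⟩
      have := Complex.abs_re_le_norm ((R : ℂ) + s * I)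
      simpa [abs_of_pos hR0] using this)
    have h3 := hs 0 R (fun y => (-R : ℝ) + y * I) (by rw [abs_of_pos] <;> linarith) (fun s hs => by
      rw [Set.uIoc_of_le hR0.le] at hs
      refine ⟨by simpa using hs.1.le, ?_⟩
      have := Complex.abs_re_le_norm (((-R : ℝ) : ℂ) + s * I)
      simpa [abs_of_pos hR0] using this)
    have e : ∫ t in (-R)..R, φ t = (∫ x : ℝ in (-R)..R, φ (x + R * I)) -
        I * (∫ y : ℝ in (0 : ℝ)..R, φ (R + y * I)) +
        I * (∫ y : ℝ in (0 : ℝ)..R, φ ((-R : ℝ) + y * I)) := by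
      linear_combination h
    rw [e]
    refine (norm_add_le _ _).trans ((add_le_add_left (norm_sub_le _ _) _).trans ?_)
    rw [norm_mul, norm_mul, norm_I, one_mul, one_mul]
    have e2 : 8 * C / R ^ 2 * (2 * R) = 16 * C / R := by field_simp; ring
    rw [e2] at h1 h2 h3
    have : 16 * C / R + 16 * C / R + 16 * C / R = 48 * C / R := by ring
    linarith
  have hzero : ∫ t : ℝ, φ t = 0 := by
    have h1 := intervalIntegral_tendsto_integral hφi tendsto_neg_atTop_atBot tendsto_id
    have h2 : Tendsto (fun R : ℝ => ∫ t in (-R)..R, φ t) atTop (𝓝 0) := by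
      rw [tendsto_zero_iff_norm_tendsto_zero]
      refine squeeze_zero' (Eventually.of_forall fun R => norm_nonneg _) ?_
        (tendsto_const_nhds (x := 48 * C) |>.div_atTop tendsto_id)
      filter_upwards [eventually_gt_atTop (2 * ‖z‖), eventually_gt_atTop 0] with R hR hR0
      exact hrect R hR hR0
    exact tendsto_nhds_unique h1 h2
  have hfin : pext (fun t : ℝ => g t - g z) z = 0 := by
    rw [pext, integral_poisson]
    have hpz : (Real.pi / z.im : ℂ) ≠ 0 := by
      have hzc : (z.im : ℂ) ≠ 0 := by exact_mod_cast hzim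
      simp [Real.pi_ne_zero, hzc]
    have : ∫ t : ℝ, φ t = (Real.pi / z.im : ℂ) *
        ∫ t : ℝ, (rho z t : ℂ) * (g t - g z) / (Real.pi * (1 + (t : ℂ) ^ 2)) := by
      rw [← integral_const_mul]
      congr 1; ext t
      rw [hφt]; ring
    rw [hzero] at this
    exact (mul_eq_zero.1 this.symm).resolve_left hpz
  rw [pext_sub hz hgi (integrable_const _), pext_const hz, sub_eq_zero] at hfin
  exact hfin

/-- Fatou's theorem: a bounded analytic function is the Poisson extension of a function on the
line. The boundary function is found as a weak limit of the traces on horizontal lines. -/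
theorem exists_hardyPair_of_bounded {B : ℂ → ℂ} (hB : DifferentiableOn ℂ B UHP) {C : ℝ}
    (hC : ∀ z ∈ UHP, ‖B z‖ ≤ C) : ∃ b : ℝ → ℂ, HardyPair B b := by
  have hC0 : 0 ≤ C := (norm_nonneg _).trans (hC I I_mem_UHP)
  let ε : ℕ → ℝ := fun n => 1 / ((n : ℝ) + 1)
  have hε : ∀ n, 0 < ε n := fun n => Nat.one_div_pos_of_nat
  have hmem : ∀ n (w : ℂ), -ε n < w.im → w + ε n * I ∈ UHP := by
    intro n w hw
    have : 0 < w.im + ε n := by linarith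
    simpa [UHP] using this
  let b : ℕ → ℝ → ℂ := fun n t => B (t + ε n * I)
  have hbc : ∀ n, Continuous (b n) := fun n =>
    hB.continuousOn.comp_continuous (by fun_prop) fun t => hmem n t (by simpa using hε n)
  have hbC : ∀ n t, ‖b n t‖ ≤ C := fun n t => hC _ (hmem n t (by simpa using hε n))
  have hbm : ∀ n, MemLp (b n) 2 ϖ := fun n =>
    MemLp.of_bound (hbc n).aestronglyMeasurable C (Eventually.of_forall (hbC n))
  obtain ⟨g, hg, U, hU, hlim⟩ := exists_weak_limit hbm (C := C) (fun n => by
    refine ENNReal.toReal_le_of_le_ofReal hC0 ?_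
    refine (eLpNorm_le_of_ae_bound (Eventually.of_forall (hbC n))).trans ?_
    simp)
  refine ⟨g, hg, hB, fun z hz => ?_⟩
  have h1 := hlim _ (memLp_rho hz)
  have h2 : ∀ n, ∫ t, (rho z t : ℂ) * b n t ∂ϖ = B (z + ε n * I) := by
    intro n
    have hd : DifferentiableOn ℂ (fun w => B (w + ε n * I)) {w | -ε n < w.im} :=
      hB.comp (by fun_prop) fun w hw => hmem n w hw
    exact pext_of_analytic_bounded (hε n) hd (fun w hw => hC _ (hmem n w hw)) hz
  simp_rw [h2] at h1
  have h3 : Tendsto (fun n => B (z + ε n * I)) atTop (𝓝 (B z)) := by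
    have hc : ContinuousAt B z := (hB.differentiableAt (isOpen_UHP.mem_nhds hz)).continuousAt
    have h4 : Tendsto (fun n => z + ε n * I) atTop (𝓝 z) := by
      have h5 : Tendsto (fun n => (ε n : ℂ)) atTop (𝓝 ((0 : ℝ) : ℂ)) :=
        (continuous_ofReal.tendsto 0).comp tendsto_one_div_add_atTop_nhds_zero_nat
      simpa using (h5.mul_const I).const_add z
    exact hc.tendsto.comp h4
  exact (tendsto_nhds_unique h1 (h3.mono_left hU)).symm

theorem hardyPair_of_bounded {B : ℂ → ℂ} (hB : DifferentiableOn ℂ B UHP) {C : ℝ}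
    (hC : ∀ z ∈ UHP, ‖B z‖ ≤ C) {b : ℝ → ℂ}
    (hb : ∀ᵐ x : ℝ, Tendsto (fun y : ℝ => B (x + y * I)) (𝓝[>] 0) (𝓝 (b x))) :
    HardyPair B b := by
  obtain ⟨b', hb'⟩ := exists_hardyPair_of_bounded hB hC
  refine hb'.congr (fun _ _ => rfl) ?_
  filter_upwards [hb, hb'.radial] with x h1 h2
  exact tendsto_nhds_unique h1 h2

/-! ### Products of Hardy functions -/

/-- The reproducing kernel of the Hardy class at `w`, up to a constant. -/
theorem hardyPair_kernel {w : ℂ} (hw : w ∈ UHP) :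
    HardyPair (fun z => (z + I) / (z - conj w)) (fun t => conj (cker w t)) := by
  have hw' := im_pos_of_mem hw
  have hne : ∀ z : ℂ, 0 ≤ z.im → w.im ≤ ‖z - conj w‖ := by
    intro z hz
    have h1 := Complex.abs_im_le_norm (z - conj w)
    simp only [sub_im, conj_im, sub_neg_eq_add] at h1
    rw [abs_of_nonneg (by linarith)] at h1
    linarith
  have hne' : ∀ z : ℂ, 0 ≤ z.im → z - conj w ≠ 0 := fun z hz h => by
    have := hne z hz
    rw [h, norm_zero] at this; linarith
  refine hardyPair_of_bounded (C := 1 + ‖conj w + I‖ / w.im) ?_ ?_ ?_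
  · exact DifferentiableOn.div (by fun_prop) (by fun_prop) fun z hz => hne' z (le_of_lt hz)
  · intro z hz
    have h1 := hne' z (le_of_lt hz)
    have : (z + I) / (z - conj w) = 1 + (conj w + I) / (z - conj w) := by
      field_simp; ring
    rw [this]
    refine (norm_add_le _ _).trans ?_
    rw [norm_one, norm_div]
    gcongr
    exact hne z (le_of_lt hz)
  · refine Eventually.of_forall fun x => ?_
    rw [conj_cker]
    have hx := hne' x (by simp)
    have h1 : ContinuousAt (fun y : ℝ => ((x : ℂ) + y * I + I) / (x + y * I - conj w)) 0 := by
      refine ContinuousAt.div (by fun_prop) (by fun_prop) ?_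
      simpa using hx
    have h2 := h1.tendsto.mono_left (nhdsWithin_le_nhds (s := Set.Ioi 0))
    simpa using h2

theorem cint_mul_kernel {p : ℝ → ℂ} (hp : Integrable p ϖ) {z w : ℂ} (hz : z.im ≠ 0)
    (hw : w ∈ UHP) (hne : z ≠ conj w) :
    cint (fun t => p t * conj (cker w t)) z =
      ((z + I) * cint p z - (conj w + I) * cint p (conj w)) / (z - conj w) := by
  have hw' : (conj w).im ≠ 0 := by simpa using (im_pos_of_mem hw).ne'
  have h0 : z - conj w ≠ 0 := sub_ne_zero.2 hne
  rw [cint, cint, cint, ← integral_const_mul, ← integral_const_mul, ← integral_sub,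
    ← integral_div]
  · congr 1; ext t
    have h1 := ofReal_sub_ne_zero hz t
    have h2 := ofReal_sub_ne_zero hw' t
    rw [conj_cker]
    simp only [cker]
    field_simp
    ring
  · exact (integrable_cker_mul hz hp).const_mul _
  · exact (integrable_cker_mul hw' hp).const_mul _

/-- Multiplicativity of the Poisson extension when one factor is a reproducing kernel. The point
`z = w` would need a limit and is left out. -/
theorem HardyPair.pext_mul_kernel {P : ℂ → ℂ} {p : ℝ → ℂ} (hP : HardyPair P p) {z w : ℂ}
    (hz : z ∈ UHP) (hw : w ∈ UHP) (hne : z ≠ w) :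
    pext (fun t => p t * conj (cker w t)) z = P z * ((z + I) / (z - conj w)) := by
  have hz' := (im_pos_of_mem hz).ne'
  have hw' := im_pos_of_mem hw
  have hzc : (conj z).im ≠ 0 := by simpa using hz'
  have hne1 : z ≠ conj w := fun h => by
    have := congrArg Complex.im h
    have h2 := im_pos_of_mem hz
    simp at this; linarith
  have hne2 : conj z ≠ conj w := fun h => hne (by simpa using congrArg conj h)
  have hi : Integrable (fun t => p t * conj (cker w t)) ϖ :=
    hP.memLp.integrable_mul ((memLp_cker hw'.ne').star : MemLp (star (cker w)) 2 ϖ)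
  have h0 : z - conj w ≠ 0 := sub_ne_zero.2 hne1
  have hI := I_ne_zero
  rw [pext_eq_cint hz hi, cint_mul_kernel hP.integrable hz' hw hne1,
    cint_mul_kernel hP.integrable hzc hw hne2, hP.cint_conj hz, hP.cint_conj hw, hP.eq_cint hz]
  field_simp
  ring

/-- The Hardy class as a closed subspace of `L²` of the Poisson measure. -/
def hardySub : Submodule ℂ (Lp ℂ 2 ϖ) where
  carrier := {f | HardyPair (pext f) f}
  zero_mem' := by
    refine (HardyPair.const 0).congr (fun z hz => ?_) ?_
    · rw [← pext_const hz 0]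
      refine pext_congr ?_ z
      rw [EventuallyEq, ← ae_poissonMeasure]
      exact Lp.coeFn_zero ..
    · rw [EventuallyEq, ← ae_poissonMeasure]
      exact Lp.coeFn_zero ..
  add_mem' := by
    intro f g hf hg
    have h : ((f + g : Lp ℂ 2 ϖ) : ℝ → ℂ) =ᵐ[volume] fun t => f t + g t := by
      rw [EventuallyEq, ← ae_poissonMeasure]
      exact Lp.coeFn_add f g
    refine (hf.add hg).congr (fun z hz => ?_) h
    rw [pext_congr h, pext_add hz hf.integrable hg.integrable]
  smul_mem' := by
    intro c f hf
    have h : ((c • f : Lp ℂ 2 ϖ) : ℝ → ℂ) =ᵐ[volume] fun t => c * f t := by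
      rw [EventuallyEq, ← ae_poissonMeasure]
      exact Lp.coeFn_smul c f
    refine (hf.const_mul c).congr (fun z hz => ?_) h
    rw [pext_congr h, pext_const_mul]

theorem mem_hardySub_iff (f : Lp ℂ 2 ϖ) :
    f ∈ hardySub ↔ ∀ z ∈ UHP, cint f (conj z) = 0 :=
  ⟨fun h _ hz => h.cint_conj hz, fun h => HardyPair.of_cint (Lp.memLp f) h⟩

theorem cint_eq_inner {z : ℂ} (hz : z.im ≠ 0) (f : Lp ℂ 2 ϖ) :
    cint f z = inner ℂ (((memLp_cker hz).star : MemLp (star (cker z)) 2 ϖ).toLp _) f := by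
  conv_rhs => rw [← Lp.toLp_coeFn f (Lp.memLp f)]
  rw [inner_toLp, cint]
  congr 1; ext t
  simp

theorem isClosed_hardySub : IsClosed (hardySub : Set (Lp ℂ 2 ϖ)) := by
  have h : (hardySub : Set (Lp ℂ 2 ϖ)) = ⋂ z ∈ UHP,
      {f : Lp ℂ 2 ϖ | cint f (conj z) = 0} := by
    ext f
    simp only [SetLike.mem_coe, mem_hardySub_iff, Set.mem_iInter, Set.mem_ofPred_eq]
  rw [h]
  refine isClosed_biInter fun z hz => ?_
  have hz' : (conj z).im ≠ 0 := by simpa using (im_pos_of_mem hz).ne'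
  simp_rw [cint_eq_inner hz']
  exact isClosed_eq (by fun_prop) continuous_const

instance : CompleteSpace hardySub := isClosed_hardySub.completeSpace_coe

theorem HardyPair.toLp_mem {F : ℂ → ℂ} {f : ℝ → ℂ} (h : HardyPair F f) :
    h.memLp.toLp f ∈ hardySub := by
  have h1 : (h.memLp.toLp f : ℝ → ℂ) =ᵐ[volume] f := by
    rw [EventuallyEq, ← ae_poissonMeasure]
    exact h.memLp.coeFn_toLp
  exact h.congr (fun z hz => by rw [pext_congr h1, h.eq_pext z hz]) h1

/-- The reproducing kernels at the points other than `z₀` span a dense subspace of the Hardy class,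
so a function orthogonal to them is orthogonal to the whole class. -/
theorem mem_hardySub_orthogonal {r : Lp ℂ 2 ϖ} {z₀ : ℂ}
    (h : ∀ w ∈ UHP, w ≠ z₀ → ∫ t, conj (r t) * conj (cker w t) ∂ϖ = 0) : r ∈ hardySubᗮ := by
  obtain ⟨r₁, hr₁, r₂, hr₂, hr⟩ := hardySub.exists_add_mem_mem_orthogonal r
  have hz : ∀ w ∈ UHP, w ≠ z₀ → pext r₁ w = 0 := by
    intro w hw hne
    have hw' := (im_pos_of_mem hw).ne'
    have hk := hardyPair_kernel hw
    have h1 : inner ℂ r (hk.memLp.toLp _) = 0 := by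
      conv_lhs => rw [← Lp.toLp_coeFn r (Lp.memLp r)]
      rw [inner_toLp]; exact h w hw hne
    have h2 : inner ℂ r₂ (hk.memLp.toLp _) = 0 :=
      Submodule.inner_left_of_mem_orthogonal hk.toLp_mem hr₂
    have h3 : inner ℂ (hk.memLp.toLp _) r₁ = 0 := by
      rw [← inner_conj_symm, ← map_zero (starRingEnd ℂ)]
      congr 1
      rw [hr, inner_add_left, h2, add_zero] at h1
      exact h1
    have h4 : cint r₁ w = 0 := by rw [cint_eq_inner hw']; exact h3
    have h5 : HardyPair (pext r₁) r₁ := hr₁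
    rw [h5.eq_cint hw, h4, mul_zero]
  have h0 : r₁ = 0 := by
    rw [Lp.eq_zero_iff_ae_eq_zero, EventuallyEq, ae_poissonMeasure]
    have h5 : HardyPair (pext r₁) r₁ := hr₁
    have hx0 : ∀ᵐ x : ℝ, x ≠ z₀.re := by simp [ae_iff]
    filter_upwards [h5.radial, hx0] with x hx hxz
    refine tendsto_nhds_unique hx (tendsto_const_nhds.congr' ?_)
    filter_upwards [self_mem_nhdsWithin] with y hy
    refine (hz _ (ofReal_add_mul_I_mem hy) fun h0 => hxz ?_).symm
    simpa using congrArg Complex.re h0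
  rw [hr, h0, zero_add]
  exact hr₂

/-- The Poisson extension is multiplicative on the Hardy class. -/
theorem HardyPair.pext_mul {P Q : ℂ → ℂ} {p q : ℝ → ℂ} (hP : HardyPair P p) (hQ : HardyPair Q q)
    {z : ℂ} (hz : z ∈ UHP) : pext (fun t => p t * q t) z = P z * Q z := by
  have hr : MemLp (fun t => conj ((rho z t : ℂ) * (p t - P z))) 2 ϖ := by
    have h1 : MemLp (fun t => (rho z t : ℂ) * (p t - P z)) 2 ϖ := by
      refine (((hP.memLp.sub (memLp_const (P z)))).norm.const_mul
        (‖z + I‖ * (1 + ‖z - I‖ / |z.im|) + 1)).of_le ?_ ?_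
      · exact (continuous_rho_complex hz).aestronglyMeasurable.mul
          (hP.memLp.sub (memLp_const (P z))).aestronglyMeasurable
      · refine Eventually.of_forall fun t => ?_
        rw [norm_mul, norm_mul, norm_norm]
        gcongr
        · exact (norm_rho_le hz t).trans (Real.le_norm_self _)
        · rfl
    exact (h1.star : MemLp (star _) 2 ϖ)
  have hker : hr.toLp _ ∈ hardySubᗮ := by
    refine mem_hardySub_orthogonal (z₀ := z) fun w hw hne => ?_
    have h1 : ∫ t, conj (hr.toLp _ t) * conj (cker w t) ∂ϖ =
        ∫ t, ((rho z t : ℂ) * (p t * conj (cker w t)) -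
          P z * ((rho z t : ℂ) * conj (cker w t))) ∂ϖ := by
      refine integral_congr_ae ?_
      filter_upwards [hr.coeFn_toLp] with t ht
      rw [ht, conj_conj]; ring
    have hk := hardyPair_kernel hw
    rw [h1, integral_sub, integral_const_mul]
    · have h2 := hP.pext_mul_kernel hz hw hne.symm
      have h3 := hk.eq_pext z hz
      simp only [pext] at h2 h3
      rw [h2, ← h3, sub_self]
    · exact integrable_rho_mul hz (hP.memLp.integrable_mul hk.memLp)
    · exact (integrable_rho_mul hz hk.integrable).const_mul _
  have h1 := Submodule.inner_left_of_mem_orthogonal hQ.toLp_mem hker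
  rw [inner_toLp] at h1
  have h2 : ∫ t, conj (conj ((rho z t : ℂ) * (p t - P z))) * q t ∂ϖ =
      pext (fun t => p t * q t) z - P z * pext q z := by
    rw [pext, pext, ← integral_const_mul, ← integral_sub]
    · congr 1; ext t
      rw [conj_conj]; ring
    · exact integrable_rho_mul hz (hP.memLp.integrable_mul hQ.memLp)
    · exact (integrable_rho_mul hz hQ.integrable).const_mul _
  rw [h2, ← hQ.eq_pext z hz, sub_eq_zero] at h1
  exact h1

theorem HardyPair.mul {P Q : ℂ → ℂ} {p q : ℝ → ℂ} (hP : HardyPair P p) (hQ : HardyPair Q q)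
    (h : MemLp (fun t => p t * q t) 2 ϖ) :
    HardyPair (fun z => P z * Q z) (fun t => p t * q t) where
  memLp := h
  analytic := hP.analytic.mul hQ.analytic
  eq_pext := fun _ hz => (hP.pext_mul hQ hz).symm

/-! ### Outer functions -/

theorem boundary_ae_eq {F : ℂ → ℂ} {f : ℝ → ℂ}
    (h : ∀ᵐ x : ℝ, Tendsto (fun y : ℝ => F (x + y * I)) (𝓝[>] 0) (𝓝 (f x))) :
    boundary F =ᵐ[volume] f := by
  filter_upwards [h] with x hx
  exact hx.limUnder_eq

/-- The outer function `exp (S v)` with boundary modulus `exp v`. -/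
def outer (v : ℝ → ℝ) (z : ℂ) : ℂ := exp (schwarz v z)

/-- The boundary function of an outer function. -/
def outerBd (v : ℝ → ℝ) : ℝ → ℂ := boundary (outer v)

theorem norm_outer {v : ℝ → ℝ} (hv : Integrable v ϖ) {z : ℂ} (hz : z ∈ UHP) :
    ‖outer v z‖ = Real.exp (∫ t, rho z t * v t ∂ϖ) := by
  rw [outer, Complex.norm_exp, re_schwarz hv hz]

theorem differentiableOn_outer {v : ℝ → ℝ} (hv : Integrable v ϖ) :
    DifferentiableOn ℂ (outer v) UHP := (differentiableOn_schwarz hv).cexp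

theorem outer_add {u v : ℝ → ℝ} (hu : Integrable u ϖ) (hv : Integrable v ϖ) {z : ℂ}
    (hz : z ∈ UHP) : outer (fun t => u t + v t) z = outer u z * outer v z := by
  rw [outer, schwarz_add hu hv hz, exp_add]; rfl

theorem outer_neg (u : ℝ → ℝ) (z : ℂ) : outer (fun t => -u t) z = (outer u z)⁻¹ := by
  rw [outer, schwarz_neg, exp_neg]; rfl

theorem outer_congr {u v : ℝ → ℝ} (h : u =ᵐ[volume] v) : outer u = outer v := by
  ext z; rw [outer, outer, schwarz_congr h]

theorem norm_outer_le {v : ℝ → ℝ} (hv : Integrable v ϖ) {C : ℝ} (hC : ∀ᵐ t : ℝ, v t ≤ C) {z : ℂ}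
    (hz : z ∈ UHP) : ‖outer v z‖ ≤ Real.exp C := by
  rw [norm_outer hv hz, Real.exp_le_exp]
  calc ∫ t, rho z t * v t ∂ϖ ≤ ∫ t, rho z t * C ∂ϖ := by
        refine integral_mono_ae (integrable_rho_mul_real hz hv)
          (integrable_rho_mul_real hz (integrable_const C)) ?_
        rw [EventuallyLE, ae_poissonMeasure]
        filter_upwards [hC] with t ht
        exact mul_le_mul_of_nonneg_left ht (rho_pos hz t).le
    _ = C := by rw [integral_mul_const, integral_rho_real hz, one_mul]

theorem tendsto_norm_outer {v : ℝ → ℝ} (hv : Integrable v ϖ) :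
    ∀ᵐ x : ℝ, Tendsto (fun y : ℝ => ‖outer v (x + y * I)‖) (𝓝[>] 0) (𝓝 (Real.exp (v x))) := by
  filter_upwards [tendsto_pext hv.ofReal] with x hx
  have h1 := (continuous_re.tendsto _).comp hx
  refine ((Real.continuous_exp.tendsto _).comp h1).congr' ?_
  filter_upwards [self_mem_nhdsWithin] with y hy
  have hz := ofReal_add_mul_I_mem (x := x) hy
  rw [norm_outer hv hz]
  simp only [Function.comp]
  have := pext_ofReal v (x + y * I)
  simp only [coe_algebraMap] at *
  rw [this, ofReal_re]

/-- Outer functions have radial limits: they are quotients of bounded outer functions. -/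
theorem outerBd_spec {v : ℝ → ℝ} (hv : Integrable v ϖ) :
    (∀ᵐ x : ℝ, Tendsto (fun y : ℝ => outer v (x + y * I)) (𝓝[>] 0) (𝓝 (outerBd v x))) ∧
      (∀ᵐ x : ℝ, ‖outerBd v x‖ = Real.exp (v x)) ∧ AEStronglyMeasurable (outerBd v) volume := by
  have hneg : ∀ u : ℝ → ℝ, Integrable u ϖ → (∀ t, u t ≤ 0) → ∃ b, HardyPair (outer u) b := by
    intro u hu h0
    refine exists_hardyPair_of_bounded (differentiableOn_outer hu) (C := Real.exp 0) fun z hz =>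
      norm_outer_le hu (Eventually.of_forall h0) hz
  have h1i : Integrable (fun t => min (v t) 0) ϖ := hv.inf (integrable_const 0)
  have h2i : Integrable (fun t => -max (v t) 0) ϖ := (hv.sup (integrable_const 0)).neg
  obtain ⟨b₁, hb₁⟩ := hneg _ h1i fun t => min_le_right _ _
  obtain ⟨b₂, hb₂⟩ := hneg _ h2i fun t => neg_nonpos.2 (le_max_right _ _)
  have hquot : ∀ z ∈ UHP, outer v z =
      outer (fun t => min (v t) 0) z / outer (fun t => -max (v t) 0) z := by
    intro z hz
    rw [outer_neg, div_inv_eq_mul, ← outer_add (v := fun t => max (v t) 0) h1i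
      (hv.sup (integrable_const 0)) hz]
    congr 1; ext t
    rw [min_add_max, add_zero]
  have hlim : ∀ᵐ x : ℝ, Tendsto (fun y : ℝ => outer v (x + y * I)) (𝓝[>] 0)
      (𝓝 (b₁ x / b₂ x)) := by
    filter_upwards [hb₁.radial, hb₂.radial, tendsto_norm_outer h2i] with x hx1 hx2 hx3
    have hne : b₂ x ≠ 0 := by
      rw [← norm_ne_zero_iff, tendsto_nhds_unique hx2.norm hx3]
      exact (Real.exp_pos _).ne'
    refine (hx1.div hx2 hne).congr' ?_
    filter_upwards [self_mem_nhdsWithin] with y hy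
    exact (hquot _ (ofReal_add_mul_I_mem hy)).symm
  have hae := boundary_ae_eq hlim
  have h1 : ∀ᵐ x : ℝ, Tendsto (fun y : ℝ => outer v (x + y * I)) (𝓝[>] 0) (𝓝 (outerBd v x)) := by
    filter_upwards [hlim, hae] with x h1 h2
    rw [outerBd, h2]; exact h1
  refine ⟨h1, ?_, ?_⟩
  · filter_upwards [h1, tendsto_norm_outer hv] with x h2 h3
    exact tendsto_nhds_unique h2.norm h3
  · refine AEStronglyMeasurable.congr ?_ hae.symm
    exact (aestronglyMeasurable_poisson.1 hb₁.memLp.1).div₀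
      (aestronglyMeasurable_poisson.1 hb₂.memLp.1)

theorem outerBd_add {u v : ℝ → ℝ} (hu : Integrable u ϖ) (hv : Integrable v ϖ) :
    outerBd (fun t => u t + v t) =ᵐ[volume] fun t => outerBd u t * outerBd v t := by
  refine boundary_ae_eq ?_
  filter_upwards [(outerBd_spec hu).1, (outerBd_spec hv).1] with x h1 h2
  refine (h1.mul h2).congr' ?_
  filter_upwards [self_mem_nhdsWithin] with y hy
  exact (outer_add hu hv (ofReal_add_mul_I_mem hy)).symm

theorem outerBd_ne_zero {v : ℝ → ℝ} (hv : Integrable v ϖ) : ∀ᵐ x : ℝ, outerBd v x ≠ 0 := by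
  filter_upwards [(outerBd_spec hv).2.1] with x hx
  rw [← norm_ne_zero_iff, hx]
  exact (Real.exp_pos _).ne'

theorem outerBd_neg {v : ℝ → ℝ} (hv : Integrable v ϖ) :
    outerBd (fun t => -v t) =ᵐ[volume] fun t => (outerBd v t)⁻¹ := by
  refine boundary_ae_eq ?_
  filter_upwards [(outerBd_spec hv).1, outerBd_ne_zero hv] with x h1 h2
  refine (h1.inv₀ h2).congr fun y => ?_
  rw [outer_neg]

theorem hardyPair_outer {v : ℝ → ℝ} (hv : Integrable v ϖ) {C : ℝ} (hC : ∀ᵐ t : ℝ, v t ≤ C) :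
    HardyPair (outer v) (outerBd v) :=
  hardyPair_of_bounded (differentiableOn_outer hv) (fun _ hz => norm_outer_le hv hC hz)
    (outerBd_spec hv).1

theorem integrable_schwarz_kernel {v : ℝ → ℝ} (hv : Integrable v ϖ) {z : ℂ} (hz : z.im ≠ 0) :
    Integrable (fun t => (-I * (z + I) * cker z t - 1) * (v t : ℂ)) ϖ := by
  have := ((integrable_cker_mul hz hv.ofReal).const_mul (-I * (z + I))).sub hv.ofReal
  refine this.congr (Eventually.of_forall fun t => ?_)
  simp; ring

theorem tendsto_schwarz {u : ℕ → ℝ → ℝ} {v b : ℝ → ℝ} (hu : ∀ n, Integrable (u n) ϖ)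
    (hv : Integrable v ϖ) (hb : Integrable b ϖ) (hub : ∀ n, ∀ᵐ t : ℝ, |u n t| ≤ b t)
    (hlim : ∀ᵐ t : ℝ, Tendsto (fun n => u n t) atTop (𝓝 (v t))) {z : ℂ} (hz : z ∈ UHP) :
    Tendsto (fun n => schwarz (u n) z) atTop (𝓝 (schwarz v z)) := by
  have hz' := (im_pos_of_mem hz).ne'
  rw [schwarz_eq_integral hv hz']
  simp_rw [schwarz_eq_integral (hu _) hz']
  refine tendsto_integral_of_dominated_convergence
    (fun t => (‖-I * (z + I)‖ * (1 + ‖z - I‖ / |z.im|) + 1) * b t)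
    (fun n => (integrable_schwarz_kernel (hu n) hz').1) (hb.const_mul _) ?_ ?_
  · intro n
    rw [ae_poissonMeasure]
    filter_upwards [hub n] with t ht
    rw [norm_mul, norm_real, Real.norm_eq_abs]
    gcongr
    refine (norm_sub_le _ _).trans ?_
    rw [norm_mul, norm_one]
    gcongr
    exact norm_cker_le hz' t
  · rw [ae_poissonMeasure]
    filter_upwards [hlim] with t ht
    exact ((continuous_ofReal.tendsto _).comp ht).const_mul _

/-- Smirnov's theorem: if an outer multiple of a Hardy function has square summable boundary
values, then it is a Hardy function. The outer function is approximated by the bounded outer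
functions with truncated modulus. -/
theorem HardyPair.mul_outer {F : ℂ → ℂ} {f : ℝ → ℂ} (hF : HardyPair F f) {v : ℝ → ℝ}
    (hv : Integrable v ϖ) (h : MemLp (fun t => outerBd v t * f t) 2 ϖ) :
    HardyPair (fun z => outer v z * F z) (fun t => outerBd v t * f t) := by
  set u : ℕ → ℝ → ℝ := fun n t => min (v t) n with hu
  have hui : ∀ n, Integrable (u n) ϖ := fun n => hv.inf (integrable_const _)
  have hle : ∀ n, ∀ᵐ t : ℝ, ‖outerBd (u n) t * f t‖ ≤ ‖outerBd v t * f t‖ := by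
    intro n
    filter_upwards [(outerBd_spec hv).2.1, (outerBd_spec (hui n)).2.1] with t h1 h2
    rw [norm_mul, norm_mul, h1, h2]
    gcongr
    exact min_le_left _ _
  have hmem : ∀ n, MemLp (fun t => outerBd (u n) t * f t) 2 ϖ := fun n => by
    refine h.of_le ?_ (by rw [ae_poissonMeasure]; exact hle n)
    exact (aestronglyMeasurable_poisson.2 (outerBd_spec (hui n)).2.2).mul hF.memLp.1
  have hpair : ∀ n, HardyPair (fun z => outer (u n) z * F z) (fun t => outerBd (u n) t * f t) :=
    fun n => (hardyPair_outer (hui n) (Eventually.of_forall fun t => min_le_right _ _)).mul hF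
      (hmem n)
  obtain ⟨g, hg, U, hU, hlim⟩ := exists_weak_limit hmem
    (C := (eLpNorm (fun t => outerBd v t * f t) 2 ϖ).toReal) fun n =>
      ENNReal.toReal_mono h.2.ne (eLpNorm_mono_ae (by rw [ae_poissonMeasure]; exact hle n))
  have hg' : HardyPair (fun z => outer v z * F z) g := by
    refine ⟨hg, (differentiableOn_outer hv).mul hF.analytic, fun z hz => ?_⟩
    have h1 := hlim _ (memLp_rho hz)
    have h2 : Tendsto (fun n => outer (u n) z * F z) atTop (𝓝 (outer v z * F z)) := by
      refine Tendsto.mul_const _ ((continuous_exp.tendsto _).comp ?_)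
      refine tendsto_schwarz hui hv hv.abs (fun n => Eventually.of_forall fun t => ?_)
        (Eventually.of_forall fun t => ?_) hz
      · have hn : (0 : ℝ) ≤ n := n.cast_nonneg
        simp only [hu]
        rcases le_total (v t) n with h | h
        · rw [min_eq_left h]
        · rw [min_eq_right h, abs_of_nonneg hn]; exact h.trans (le_abs_self _)
      · refine tendsto_const_nhds.congr' ?_
        filter_upwards [eventually_ge_atTop ⌈v t⌉₊] with n hn
        exact (min_eq_left ((Nat.le_ceil _).trans (by exact_mod_cast hn))).symm
    refine tendsto_nhds_unique (h2.mono_left hU) (h1.congr fun n => ?_)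
    exact ((hpair n).eq_pext z hz).symm
  refine hg'.congr (fun _ _ => rfl) ?_
  filter_upwards [hg'.radial, hF.radial, (outerBd_spec hv).1] with x h1 h2 h3
  exact tendsto_nhds_unique (h3.mul h2) h1

/-! ### Inner-outer factorization -/

/-- Harnack's inequality for the Poisson kernel. -/
theorem rho_ge {z : ℂ} (hz : z ∈ UHP) (t : ℝ) : z.im / (2 * (1 + normSq z)) ≤ rho z t := by
  have h1 := normSq_ofReal_sub_pos (im_pos_of_mem hz).ne' t
  have h2 := normSq_nonneg z
  rw [rho, div_le_div_iff₀ (by positivity) h1, mul_assoc]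
  refine mul_le_mul_of_nonneg_left ?_ (im_pos_of_mem hz).le
  simp only [normSq_apply, sub_re, sub_im, ofReal_re, ofReal_im] at *
  nlinarith [sq_nonneg (t + z.re), sq_nonneg (t * z.re), sq_nonneg (t * z.im), sq_nonneg z.im]

/-- Subharmonicity of `log |F|`, in terms of a summable majorant of the boundary values. -/
theorem norm_le_exp_integral {F : ℂ → ℂ} {f : ℝ → ℂ} (hF : HardyPair F f) {v : ℝ → ℝ}
    (hv : Integrable v ϖ) (hle : ∀ᵐ t : ℝ, ‖f t‖ ≤ Real.exp (v t)) {z : ℂ} (hz : z ∈ UHP) :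
    ‖F z‖ ≤ Real.exp (∫ t, rho z t * v t ∂ϖ) := by
  have h1 : ∀ᵐ t : ℝ, ‖outerBd (fun t => -v t) t * f t‖ ≤ 1 := by
    filter_upwards [(outerBd_spec hv.neg).2.1, hle] with t h2 h3
    simp only [Pi.neg_apply] at h2
    rw [norm_mul]
    change ‖outerBd (-v) t‖ * _ ≤ 1
    rw [h2, Real.exp_neg, inv_mul_le_iff₀ (Real.exp_pos _), mul_one]
    exact h3
  have h2 : MemLp (fun t => outerBd (fun t => -v t) t * f t) 2 ϖ := by
    refine MemLp.of_bound ?_ 1 (by rw [ae_poissonMeasure]; exact h1)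
    exact (aestronglyMeasurable_poisson.2 (outerBd_spec hv.neg).2.2).mul hF.memLp.1
  have h3 := (hF.mul_outer hv.neg h2).norm_le h1 hz
  change ‖outer (fun t => -v t) z * F z‖ ≤ 1 at h3
  rw [norm_mul, outer_neg, norm_inv, norm_outer hv hz, inv_mul_le_iff₀ (Real.exp_pos _),
    mul_one] at h3
  exact h3

/-- Jensen's inequality: a nonzero Hardy function has summable logarithm. -/
theorem HardyPair.integrable_log {F : ℂ → ℂ} {f : ℝ → ℂ} (hF : HardyPair F f) {z₀ : ℂ}
    (hz₀ : z₀ ∈ UHP) (hne : F z₀ ≠ 0) :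
    (∀ᵐ t : ℝ, f t ≠ 0) ∧ Integrable (fun t => Real.log ‖f t‖) ϖ := by
  have hfm := hF.memLp.1
  -- the logarithm truncated from below
  set v : ℕ → ℝ → ℝ := fun n t => Real.log (max ‖f t‖ (Real.exp (-n))) with hv
  have hpos : ∀ (n : ℕ) (t : ℝ), 0 < max ‖f t‖ (Real.exp (-(n : ℝ))) := fun n t =>
    lt_max_of_lt_right (Real.exp_pos _)
  have hlow : ∀ (n : ℕ) (t : ℝ), -(n : ℝ) ≤ v n t := fun n t => by
    rw [hv, Real.le_log_iff_exp_le (hpos n t)]; exact le_max_right _ _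
  have hup : ∀ n t, v n t ≤ ‖f t‖ := fun n t => by
    rw [hv, Real.log_le_iff_le_exp (hpos n t)]
    refine max_le ?_ ?_
    · linarith [Real.add_one_le_exp ‖f t‖]
    · rw [Real.exp_le_exp]
      have : (0 : ℝ) ≤ n := n.cast_nonneg
      linarith [norm_nonneg (f t)]
  have hvm : ∀ n, AEStronglyMeasurable (v n) ϖ := fun n =>
    (Real.measurable_log.comp_aemeasurable
      ((hfm.norm.aemeasurable).max aemeasurable_const)).aestronglyMeasurable
  have hvi : ∀ n, Integrable (v n) ϖ := fun n => by
    refine (hF.integrable.norm.add (integrable_const (n : ℝ))).mono' (hvm n)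
      (Eventually.of_forall fun t => ?_)
    have : (0 : ℝ) ≤ n := n.cast_nonneg
    have h1 := hlow n t
    have h2 := hup n t
    have h3 := norm_nonneg (f t)
    simp only [Pi.add_apply, Real.norm_eq_abs]
    rw [abs_le]
    constructor <;> linarith
  have hnle : ∀ n t, ‖f t‖ ≤ Real.exp (v n t) := fun n t => by
    rw [hv, Real.exp_log (hpos n t)]; exact le_max_left _ _
  have hlb : ∀ n, Real.log ‖F z₀‖ ≤ ∫ t, rho z₀ t * v n t ∂ϖ := fun n => by
    rw [Real.log_le_iff_le_exp (norm_pos_iff.2 hne)]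
    exact norm_le_exp_integral hF (hvi n) (Eventually.of_forall (hnle n)) hz₀
  set c := z₀.im / (2 * (1 + normSq z₀)) with hc
  have hcpos : 0 < c := by
    have := im_pos_of_mem hz₀
    have := normSq_nonneg z₀
    positivity
  set K := (∫ t, rho z₀ t * ‖f t‖ ∂ϖ - Real.log ‖F z₀‖) / c with hK
  have hbd : ∀ n, ∫ t, (‖f t‖ - v n t) ∂ϖ ≤ K := fun n => by
    rw [hK, le_div_iff₀ hcpos, mul_comm, ← integral_const_mul]
    have hi := hF.integrable.norm.sub (hvi n)
    calc ∫ t, c * (‖f t‖ - v n t) ∂ϖ ≤ ∫ t, rho z₀ t * (‖f t‖ - v n t) ∂ϖ := by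
          refine integral_mono (hi.const_mul c) (integrable_rho_mul_real hz₀ hi) fun t => ?_
          exact mul_le_mul_of_nonneg_right (rho_ge hz₀ t) (sub_nonneg.2 (hup n t))
      _ = ∫ t, rho z₀ t * ‖f t‖ ∂ϖ - ∫ t, rho z₀ t * v n t ∂ϖ := by
          rw [← integral_sub (integrable_rho_mul_real hz₀ hF.integrable.norm)
            (integrable_rho_mul_real hz₀ (hvi n))]
          congr 1; ext t; ring
      _ ≤ _ := by linarith [hlb n]
  have hfatou : ∫⁻ t, liminf (fun n => ENNReal.ofReal (‖f t‖ - v n t)) atTop ∂ϖ ≤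
      ENNReal.ofReal K := by
    refine (lintegral_liminf_le' fun n => ?_).trans ?_
    · exact ((hfm.norm.sub (hvm n)).aemeasurable).ennreal_ofReal
    · refine liminf_le_of_le (by isBoundedDefault) fun b hb => ?_
      obtain ⟨n, hn⟩ := hb.exists
      refine hn.trans ?_
      rw [← ofReal_integral_eq_lintegral_ofReal (f := fun t => ‖f t‖ - v n t)
        (hF.integrable.norm.sub (hvi n))
        (Eventually.of_forall fun t => sub_nonneg.2 (hup n t))]
      exact ENNReal.ofReal_le_ofReal (hbd n)
  have hlimmeas : AEMeasurable
      (fun t => liminf (fun n => ENNReal.ofReal (‖f t‖ - v n t)) atTop) ϖ := by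
    simp_rw [liminf_eq_iSup_iInf_of_nat]
    exact .iSup fun n => .biInf _ (Set.to_countable _) fun m _ =>
      ((hfm.norm.sub (hvm m)).aemeasurable).ennreal_ofReal
  have hfin := ae_lt_top' hlimmeas (hfatou.trans_lt ENNReal.ofReal_lt_top).ne
  have hne0 : ∀ᵐ t ∂ϖ, f t ≠ 0 := by
    filter_upwards [hfin] with t ht h0
    refine ht.ne ?_
    have h1 : Tendsto (fun n : ℕ => ENNReal.ofReal (‖f t‖ - v n t)) atTop (𝓝 ⊤) := by
      have h2 : ∀ n : ℕ, ‖f t‖ - v n t = n := fun n => by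
        simp only [hv, h0, norm_zero]
        rw [max_eq_right (Real.exp_pos _).le, Real.log_exp]; ring
      simp_rw [h2]
      exact ENNReal.tendsto_ofReal_nhds_top.2 tendsto_natCast_atTop_atTop
    exact h1.liminf_eq
  refine ⟨by rwa [ae_poissonMeasure] at hne0, ?_⟩
  have hlog : ∀ᵐ t ∂ϖ, liminf (fun n => ENNReal.ofReal (‖f t‖ - v n t)) atTop =
      ENNReal.ofReal (‖f t‖ - Real.log ‖f t‖) := by
    filter_upwards [hne0] with t ht
    refine Tendsto.liminf_eq (tendsto_const_nhds.congr' ?_)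
    filter_upwards [eventually_ge_atTop ⌈-Real.log ‖f t‖⌉₊] with n hn
    have h1 : -Real.log ‖f t‖ ≤ n := (Nat.le_ceil _).trans (by exact_mod_cast hn)
    have h2 : Real.exp (-(n : ℝ)) ≤ ‖f t‖ := by
      rw [← Real.le_log_iff_exp_le (norm_pos_iff.2 ht)]; linarith
    simp only [hv]
    rw [max_eq_left h2]
  have hlm : AEStronglyMeasurable (fun t => Real.log ‖f t‖) ϖ :=
    (Real.measurable_log.comp_aemeasurable hfm.norm.aemeasurable).aestronglyMeasurable
  have hdiff : Integrable (fun t => ‖f t‖ - Real.log ‖f t‖) ϖ := by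
    refine ⟨hfm.norm.sub hlm, ?_⟩
    rw [hasFiniteIntegral_iff_ofReal]
    · rw [← lintegral_congr_ae hlog]
      exact hfatou.trans_lt ENNReal.ofReal_lt_top
    · filter_upwards [hne0] with t ht
      simp only [Pi.zero_apply]
      linarith [Real.log_le_sub_one_of_pos (norm_pos_iff.2 ht)]
  refine (hF.integrable.norm.sub hdiff).congr (Eventually.of_forall fun t => ?_)
  simp

theorem InnerFunction.tendsto_bd (θ : InnerFunction) :
    ∀ᵐ x : ℝ, Tendsto (fun y : ℝ => θ.toFun (x + y * I)) (𝓝[>] 0) (𝓝 (θ.bd x)) := by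
  filter_upwards [θ.unimodular] with x hx
  obtain ⟨c, -, hlim⟩ := hx
  rw [InnerFunction.bd, boundary, hlim.limUnder_eq]
  exact hlim

theorem InnerFunction.hardyPair (θ : InnerFunction) : HardyPair θ.toFun θ.bd := by
  obtain ⟨C, hC⟩ := θ.bounded
  exact hardyPair_of_bounded θ.analytic hC θ.tendsto_bd

theorem InnerFunction.norm_le_one (θ : InnerFunction) {z : ℂ} (hz : z ∈ UHP) : ‖θ.toFun z‖ ≤ 1 :=
  θ.hardyPair.norm_le (θ.norm_bd.mono fun _ h => h.le) hz

/-- A Hardy function with unimodular boundary values, as an inner function. -/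
def HardyPair.toInner {F : ℂ → ℂ} {f : ℝ → ℂ} (hF : HardyPair F f)
    (h : ∀ᵐ t : ℝ, ‖f t‖ = 1) : InnerFunction where
  toFun := F
  analytic := hF.analytic
  bounded := ⟨1, fun _ hz => hF.norm_le (h.mono fun _ h => h.le) hz⟩
  unimodular := by
    filter_upwards [h, hF.radial] with x h1 h2
    exact ⟨f x, h1, h2⟩

theorem HardyPair.toInner_bd {F : ℂ → ℂ} {f : ℝ → ℂ} (hF : HardyPair F f)
    (h : ∀ᵐ t : ℝ, ‖f t‖ = 1) : (hF.toInner h).bd =ᵐ[volume] f :=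
  boundary_ae_eq hF.radial

/-- Inner-outer factorization. -/
theorem HardyPair.exists_factorization {F : ℂ → ℂ} {f : ℝ → ℂ} (hF : HardyPair F f) {z₀ : ℂ}
    (hz₀ : z₀ ∈ UHP) (hne : F z₀ ≠ 0) :
    ∃ M : InnerFunction, f =ᵐ[volume] fun t => M.bd t * outerBd (fun t => Real.log ‖f t‖) t := by
  obtain ⟨hf0, hlog⟩ := hF.integrable_log hz₀ hne
  have hno : ∀ᵐ t : ℝ, ‖outerBd (fun t => -Real.log ‖f t‖) t * f t‖ = 1 := by
    filter_upwards [(outerBd_spec hlog).2.1, hf0, outerBd_neg hlog] with t h1 h2 h3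
    rw [h3, norm_mul, norm_inv, h1, Real.exp_log (norm_pos_iff.2 h2)]
    exact inv_mul_cancel₀ (norm_ne_zero_iff.2 h2)
  have hmem : MemLp (fun t => outerBd (fun t => -Real.log ‖f t‖) t * f t) 2 ϖ := by
    refine MemLp.of_bound ?_ 1 (by rw [ae_poissonMeasure]; exact hno.mono fun _ h => h.le)
    exact (aestronglyMeasurable_poisson.2 (outerBd_spec hlog.neg).2.2).mul hF.memLp.1
  have hM := hF.mul_outer hlog.neg hmem
  refine ⟨hM.toInner hno, ?_⟩
  filter_upwards [hM.toInner_bd hno, outerBd_neg hlog, outerBd_ne_zero hlog] with t h1 h2 h3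
  rw [h1]
  change f t = outerBd (fun t => -Real.log ‖f t‖) t * f t * _
  rw [h2]
  field_simp

/-! ### Harmonic conjugates in `L²` -/

theorem memLp_ofReal {v : ℝ → ℝ} {μ : Measure ℝ} (hv : MemLp v 2 μ) :
    MemLp (fun t => (v t : ℂ)) 2 μ := hv.ofReal

/-- For square summable `v` the Schwarz integral belongs to the Hardy class, and conjugation is a
contraction in `L²`. -/
theorem exists_hardyPair_schwarz {v : ℝ → ℝ} (hv : MemLp v 2 ϖ) :
    ∃ s : ℝ → ℂ, HardyPair (schwarz v) s ∧ (∀ᵐ t : ℝ, (s t).re = v t) ∧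
      ∫ t, (s t).im ^ 2 ∂ϖ ≤ ∫ t, v t ^ 2 ∂ϖ := by
  have hvi : Integrable v ϖ := hv.integrable (by norm_num)
  have hvc := memLp_ofReal hv
  obtain ⟨p, hp, r, hr, hsum⟩ := hardySub.exists_add_mem_mem_orthogonal (hvc.toLp _)
  have hp' : HardyPair (pext p) p := hp
  -- the component orthogonal to the Hardy class is a conjugate Hardy function
  have hri := integrable_of_memLp (Lp.memLp r)
  have hrc : ∀ z ∈ UHP, cint r z = 0 := by
    intro z hz
    have hk := hardyPair_kernel hz
    rw [cint_eq_inner (im_pos_of_mem hz).ne']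
    exact Submodule.inner_right_of_mem_orthogonal hk.toLp_mem hr
  have hrm := memLp_conj (Lp.memLp r)
  have hr' : HardyPair (pext fun t => conj (r t)) (fun t => conj (r t)) := by
    refine ⟨hrm, ?_, fun _ _ => rfl⟩
    -- the extension of `conj r` is the conjugate of the anti-analytic extension of `r`
    have hci : Integrable (fun t => conj (zeta t) * conj (r t)) ϖ :=
      (integrable_of_memLp hrm).bdd_mul (c := 1)
        (continuous_conj.comp continuous_zeta).aestronglyMeasurable
        (Eventually.of_forall fun t => by simp [norm_zeta])
    have hd : DifferentiableOn ℂ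
        (fun z => (z - I) / (2 * I) * cint (fun t => conj (zeta t) * conj (r t)) z) UHP :=
      (by fun_prop : DifferentiableOn ℂ (fun z : ℂ => (z - I) / (2 * I)) UHP).mul
        (differentiableOn_cint hci)
    refine hd.congr fun z hz => ?_
    rw [pext_conj, pext_eq_cint hz hri, hrc z hz, mul_zero, zero_sub, map_neg, map_mul, cint,
      ← integral_conj, cint, map_div₀, map_mul]
    simp only [map_add, conj_conj, conj_I, map_mul, map_ofNat]
    have e : ∀ t : ℝ, conj (cker (conj z) t) * conj (r t) =
        cker z t * (conj (zeta t) * conj (r t)) := by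
      intro t
      have h1 := ofReal_sub_ne_zero (im_pos_of_mem hz).ne' t
      have h2 := ofReal_sub_I_ne_zero t
      simp only [zeta, cker, map_div₀, conj_ofReal_add_I, map_sub, conj_ofReal, conj_conj]
      field_simp
    simp_rw [e]
    have hI := I_ne_zero
    field_simp
    ring
  have hX := hp'.add hr'
  have hae : ∀ᵐ t : ℝ, (v t : ℂ) = p t + r t := by
    rw [← ae_poissonMeasure]
    filter_upwards [hvc.coeFn_toLp, Lp.coeFn_add p r] with t h1 h2
    rw [hsum] at h1
    rw [← h1, h2]; rfl
  have hre : ∀ᵐ t : ℝ, (p t + conj (r t)).re = v t := by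
    filter_upwards [hae] with t h1
    have := congrArg Complex.re h1
    simpa using this.symm
  -- the real parts of `S v` and of the Hardy function `p + conj r` agree
  have hdiff : ∀ z ∈ UHP, schwarz v z - (pext p z + pext (fun t => conj (r t)) z) =
      schwarz v I - (pext p I + pext (fun t => conj (r t)) I) := by
    intro z hz
    refine eq_const_of_re_eq_zero
      (F := fun z => schwarz v z - (pext p z + pext (fun t => conj (r t)) z))
      ((differentiableOn_schwarz hvi).sub hX.analytic) (fun w hw => ?_) hz
    have h1 := hX.eq_pext w hw
    rw [sub_re, re_schwarz hvi hw, h1, pext, ← RCLike.re_eq_complex_re, ← integral_re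
      (integrable_rho_mul hw hX.integrable), sub_eq_zero]
    refine integral_congr_ae ?_
    rw [EventuallyEq, ae_poissonMeasure]
    filter_upwards [hre] with t ht
    rw [RCLike.re_eq_complex_re, re_ofReal_mul, ht]
  set κ := schwarz v I - (pext p I + pext (fun t => conj (r t)) I) with hκ
  have hκre : κ.re = 0 := by
    have h1 := hX.eq_pext I I_mem_UHP
    rw [hκ, sub_re, re_schwarz hvi I_mem_UHP, h1, pext, ← RCLike.re_eq_complex_re, ← integral_re
      (integrable_rho_mul I_mem_UHP hX.integrable), sub_eq_zero]
    refine integral_congr_ae ?_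
    rw [EventuallyEq, ae_poissonMeasure]
    filter_upwards [hre] with t ht
    rw [RCLike.re_eq_complex_re, re_ofReal_mul, ht]
  have hS : HardyPair (schwarz v) (fun t => (p t + conj (r t)) + κ) := by
    refine (hX.add (HardyPair.const κ)).congr (fun z hz => ?_) (ae_eq_refl _)
    rw [← hdiff z hz]; ring
  have hsre : ∀ᵐ t : ℝ, ((p t + conj (r t)) + κ).re = v t := by
    filter_upwards [hre] with t ht
    rw [add_re, ht, hκre, add_zero]
  obtain ⟨s, hS, hsre⟩ : ∃ s : ℝ → ℂ, HardyPair (schwarz v) s ∧ ∀ᵐ t : ℝ, (s t).re = v t :=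
    ⟨_, hS, hsre⟩
  refine ⟨s, hS, hsre, ?_⟩
  -- `∫ s² = S v (i)²` is the square of a real number
  have hsq := hS.pext_mul hS I_mem_UHP
  rw [pext_I, schwarz_I hvi] at hsq
  have h1 := congrArg Complex.re hsq
  have hsi : Integrable (fun t => s t * s t) ϖ := hS.memLp.integrable_mul hS.memLp
  rw [← RCLike.re_eq_complex_re, ← integral_re hsi, RCLike.re_eq_complex_re, ← ofReal_mul,
    ofReal_re] at h1
  have himi : Integrable (fun t => (s t).im ^ 2) ϖ := by
    refine (((memLp_two_iff_integrable_sq_norm hS.memLp.1).1 hS.memLp)).mono' ?_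
      (Eventually.of_forall fun t => ?_)
    · exact (continuous_im.comp_aestronglyMeasurable hS.memLp.1).pow 2
    · rw [Real.norm_of_nonneg (sq_nonneg _), ← sq_abs (s t).im]
      gcongr
      exact abs_im_le_norm _
  have hv2 : Integrable (fun t => v t ^ 2) ϖ := hv.integrable_sq
  have h2 : ∫ t, (s t * s t).re ∂ϖ = ∫ t, v t ^ 2 ∂ϖ - ∫ t, (s t).im ^ 2 ∂ϖ := by
    rw [← integral_sub hv2 himi]
    refine integral_congr_ae ?_
    rw [EventuallyEq, ae_poissonMeasure]
    filter_upwards [hsre] with t ht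
    rw [mul_re, ht]; ring
  rw [h2] at h1
  nlinarith [mul_self_nonneg (∫ t, v t ∂ϖ)]

/-! ### Distribution functions -/

/-- The distribution function of `q` is `o(1/s)`. -/
def SmallTail (q : ℝ → ℂ) : Prop :=
  ∀ δ : ℝ, 0 < δ → ∃ s₀ : ℝ, 0 < s₀ ∧ ∀ s : ℝ, s₀ ≤ s → ϖ {t | s < ‖q t‖} ≤ ENNReal.ofReal (δ / s)

/-- The product of a square summable function and a function in weak `L²` is `o(1/s)` in
distribution. -/
theorem smallTail_mul {a b : ℝ → ℂ} (ha : MemLp a 2 ϖ) {K : ℝ}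
    (hb : ∀ s : ℝ, 0 < s → ϖ {t | s < ‖b t‖} ≤ ENNReal.ofReal (K / s ^ 2)) :
    SmallTail fun t => a t * b t := by
  intro δ hδ
  set K' := max K 1 with hK'
  have hK1 : 0 < K' := lt_of_lt_of_le one_pos (le_max_right _ _)
  -- where `|a b| > s`, either `|a| > ε √s`, which has measure `o(1/s)`, or `|b| > √s / ε`, and `ε`
  -- is such that the latter has measure at most `δ / (2 s)`
  set ε := √(δ / (2 * K')) with hε
  have hε0 : 0 < ε := Real.sqrt_pos.2 (by positivity)
  have hε2 : ε ^ 2 = δ / (2 * K') := Real.sq_sqrt (by positivity)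
  have ham : AEMeasurable (fun t => ENNReal.ofReal (‖a t‖ ^ 2)) ϖ :=
    (ha.1.norm.aemeasurable.pow_const 2).ennreal_ofReal
  have hafin : ∫⁻ t, ENNReal.ofReal (‖a t‖ ^ 2) ∂ϖ ≠ ⊤ := by
    have h1 := (memLp_two_iff_integrable_sq_norm ha.1).1 ha
    rw [← ofReal_integral_eq_lintegral_ofReal h1 (Eventually.of_forall fun t => by positivity)]
    exact ENNReal.ofReal_ne_top
  have hcheb : ∀ R : ℝ, 0 < R → ϖ {t | R < ‖a t‖} ≤
      (∫⁻ t in {t | R < ‖a t‖}, ENNReal.ofReal (‖a t‖ ^ 2) ∂ϖ) / ENNReal.ofReal (R ^ 2) := by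
    intro R hR
    rw [ENNReal.le_div_iff_mul_le (Or.inl (by simpa using hR.ne')) (Or.inl ENNReal.ofReal_ne_top)]
    rw [mul_comm, ← setLIntegral_const]
    refine setLIntegral_mono_ae ham.restrict (Eventually.of_forall fun t ht => ?_)
    exact ENNReal.ofReal_le_ofReal (pow_le_pow_left₀ hR.le (le_of_lt ht) 2)
  have hset0 : Tendsto (fun R : ℝ => ϖ {t | R < ‖a t‖}) atTop (𝓝 0) := by
    have h1 : Tendsto (fun R : ℝ => (∫⁻ t, ENNReal.ofReal (‖a t‖ ^ 2) ∂ϖ) / ENNReal.ofReal (R ^ 2))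
        atTop (𝓝 0) := by
      have h2 : Tendsto (fun R : ℝ => ENNReal.ofReal (R ^ 2)) atTop (𝓝 ⊤) :=
        ENNReal.tendsto_ofReal_nhds_top.2 (tendsto_pow_atTop two_ne_zero)
      have := ENNReal.Tendsto.const_div h2 (Or.inr hafin)
      simpa using this
    refine tendsto_of_tendsto_of_tendsto_of_le_of_le' tendsto_const_nhds h1
      (Eventually.of_forall fun _ => zero_le) ?_
    filter_upwards [eventually_gt_atTop 0] with R hR
    exact (hcheb R hR).trans (ENNReal.div_le_div_right (setLIntegral_le_lintegral _ _) _)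
  have hint0 := tendsto_setLIntegral_zero hafin hset0
  have hpos : 0 < ENNReal.ofReal (δ * ε ^ 2 / 2) := ENNReal.ofReal_pos.2 (by positivity)
  obtain ⟨R₀, hR₀⟩ := ((hint0.eventually (gt_mem_nhds hpos)).and
    (eventually_gt_atTop 0)).exists_forall_of_atTop
  have hR₀pos : 0 < R₀ := (hR₀ R₀ le_rfl).2
  refine ⟨(R₀ / ε) ^ 2, by positivity, fun s hs => ?_⟩
  have hs0 : 0 < s := lt_of_lt_of_le (by positivity) hs
  have hRs : R₀ ≤ ε * √s := by
    have := Real.le_sqrt_of_sq_le hs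
    rwa [div_le_iff₀ hε0, mul_comm] at this
  have hsub : {t | s < ‖a t * b t‖} ⊆ {t | ε * √s < ‖a t‖} ∪ {t | √s / ε < ‖b t‖} := by
    intro t ht
    by_contra hcon
    simp only [Set.mem_union, Set.mem_ofPred_eq, not_or, not_lt] at hcon
    have h1 : ‖a t * b t‖ ≤ (ε * √s) * (√s / ε) := by
      rw [norm_mul]
      exact mul_le_mul hcon.1 hcon.2 (norm_nonneg _) (by positivity)
    have h2 : (ε * √s) * (√s / ε) = s := by
      field_simp
      exact Real.sq_sqrt hs0.le
    rw [h2] at h1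
    exact absurd ht (not_lt.2 h1)
  refine (measure_mono hsub).trans ((measure_union_le _ _).trans ?_)
  have hA : ϖ {t | ε * √s < ‖a t‖} ≤ ENNReal.ofReal (δ / 2 / s) := by
    refine (hcheb _ (by positivity)).trans ?_
    refine (ENNReal.div_le_div_right (hR₀ _ hRs).1.le _).trans ?_
    rw [← ENNReal.ofReal_div_of_pos (by positivity)]
    refine ENNReal.ofReal_le_ofReal (le_of_eq ?_)
    rw [mul_pow, Real.sq_sqrt hs0.le]
    field_simp
  have hB : ϖ {t | √s / ε < ‖b t‖} ≤ ENNReal.ofReal (δ / 2 / s) := by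
    refine (hb _ (by positivity)).trans (ENNReal.ofReal_le_ofReal ?_)
    rw [div_pow, Real.sq_sqrt hs0.le, hε2]
    have : K ≤ K' := le_max_left _ _
    calc K / (s / (δ / (2 * K'))) ≤ K' / (s / (δ / (2 * K'))) := by gcongr
      _ = δ / 2 / s := by field_simp
  refine (add_le_add hA hB).trans ?_
  rw [← ENNReal.ofReal_add (by positivity) (by positivity)]
  refine ENNReal.ofReal_le_ofReal (le_of_eq ?_)
  ring

theorem lintegral_sq_eq_lintegral_meas_lt {f : ℝ → ℝ} {μ : Measure ℝ} (hf0 : ∀ t, 0 ≤ f t)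
    (hf : AEMeasurable f μ) : ∫⁻ t, ENNReal.ofReal (f t ^ 2) ∂μ =
      ∫⁻ s in Set.Ioi (0 : ℝ), μ {t | s < f t} * ENNReal.ofReal (2 * s) := by
  rw [← lintegral_comp_eq_lintegral_meas_lt_mul μ (Eventually.of_forall hf0) hf
    (fun t _ => (by fun_prop : Continuous fun s : ℝ => 2 * s).intervalIntegrable _ _)]
  · congr 1; ext t
    rw [intervalIntegral.integral_const_mul, integral_id]
    congr 1; ring
  · exact (ae_restrict_mem measurableSet_Ioi).mono fun s hs => by
      have : (0 : ℝ) < s := hs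
      positivity

/-- The logarithmic excess of `‖q‖` over the level `T`. -/
def excess (q : ℝ → ℂ) (T : ℝ) (t : ℝ) : ℝ := max 0 (Real.log (‖q t‖ / T))

theorem excess_nonneg (q : ℝ → ℂ) (T : ℝ) (t : ℝ) : 0 ≤ excess q T t := le_max_left _ _

theorem exp_neg_excess_mul {q : ℝ → ℂ} {T : ℝ} (hT : 0 < T) (t : ℝ) :
    Real.exp (-excess q T t) * ‖q t‖ = min ‖q t‖ T := by
  rcases le_or_gt ‖q t‖ T with h | h
  · have h1 : Real.log (‖q t‖ / T) ≤ 0 :=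
      Real.log_nonpos (by positivity) ((div_le_one hT).2 h)
    rw [excess, max_eq_left h1, min_eq_left h]; simp
  · have h1 : 1 < ‖q t‖ / T := (one_lt_div hT).2 h
    rw [excess, max_eq_right (Real.log_pos h1).le, min_eq_right h.le, Real.exp_neg,
      Real.exp_log (one_pos.trans h1)]
    have : 0 < ‖q t‖ := hT.trans h
    field_simp

theorem aemeasurable_excess {q : ℝ → ℂ} (hq : AEStronglyMeasurable q ϖ) (T : ℝ) :
    AEMeasurable (excess q T) ϖ :=
  aemeasurable_const.max (Real.measurable_log.comp_aemeasurable (hq.norm.aemeasurable.div_const T))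

/-- If the distribution function of `q` is `o(1/s)`, then the product of the second moments of
`min ‖q‖ T` and of `log⁺ (‖q‖ / T)` is as small as one wishes: the former is `o(T)` and the latter
is `o(1/T)`. -/
theorem SmallTail.exists_excess {q : ℝ → ℂ} (hq : AEStronglyMeasurable q ϖ) (h : SmallTail q)
    {δ : ℝ} (hδ : 0 < δ) : ∃ T : ℝ, 1 ≤ T ∧ MemLp (excess q T) 2 ϖ ∧
      ∫ t, excess q T t ^ 2 ∂ϖ ≤ δ ∧
      (∫ t, min ‖q t‖ T ^ 2 ∂ϖ) * ∫ t, excess q T t ^ 2 ∂ϖ ≤ δ ^ 2 := by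
  set η := δ / 4 with hη
  have hη0 : 0 < η := by positivity
  obtain ⟨s₀, hs₀, hs⟩ := h η hη0
  -- large enough for the contribution of `‖q‖ ≤ s₀` to be absorbed
  set T := max 1 (max s₀ (s₀ ^ 2 / η)) with hT
  have hT1 : 1 ≤ T := le_max_left _ _
  have hT0 : 0 < T := one_pos.trans_le hT1
  have hTs : s₀ ≤ T := (le_max_left _ _).trans (le_max_right _ _)
  have hTs2 : s₀ ^ 2 ≤ η * T := by
    have : s₀ ^ 2 / η ≤ T := (le_max_right _ _).trans (le_max_right _ _)
    rwa [div_le_iff₀ hη0, mul_comm] at this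
  have hem := aemeasurable_excess hq T
  have hmm : AEMeasurable (fun t => min ‖q t‖ T) ϖ := hq.norm.aemeasurable.min aemeasurable_const
  -- second moment of the excess
  have hE : ∫⁻ t, ENNReal.ofReal (excess q T t ^ 2) ∂ϖ ≤ ENNReal.ofReal (2 * η / T) := by
    rw [lintegral_sq_eq_lintegral_meas_lt (excess_nonneg q T) hem]
    have h1 : ∀ s ∈ Set.Ioi (0 : ℝ), ϖ {t | s < excess q T t} * ENNReal.ofReal (2 * s) ≤
        ENNReal.ofReal (2 * η / T) * ENNReal.ofReal (Real.exp (-s) * s ^ ((2 : ℝ) - 1)) := by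
      intro s hs0
      have hs0 : (0 : ℝ) < s := hs0
      have h2 : {t | s < excess q T t} ⊆ {t | T * Real.exp s < ‖q t‖} := by
        intro t ht
        have ht : s < max 0 (Real.log (‖q t‖ / T)) := ht
        have h3 : s < Real.log (‖q t‖ / T) := (lt_max_iff.1 ht).resolve_left hs0.not_gt
        have hqT : 0 < ‖q t‖ / T := by
          rcases (by positivity : 0 ≤ ‖q t‖ / T).eq_or_lt with h0 | h0
          · rw [← h0, Real.log_zero] at h3; exact absurd h3 hs0.not_gt
          · exact h0
        have h4 := (Real.lt_log_iff_exp_lt hqT).1 h3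
        rw [lt_div_iff₀ hT0, mul_comm] at h4
        exact h4
      have h3 : s₀ ≤ T * Real.exp s := by
        refine hTs.trans (le_mul_of_one_le_right hT0.le (Real.one_le_exp hs0.le))
      refine (mul_le_mul_left ((measure_mono h2).trans (hs _ h3)) _).trans ?_
      rw [← ENNReal.ofReal_mul (by positivity), ← ENNReal.ofReal_mul (by positivity)]
      refine ENNReal.ofReal_le_ofReal (le_of_eq ?_)
      norm_num
      rw [Real.exp_neg]
      have := Real.exp_pos s
      field_simp
    refine (setLIntegral_mono' measurableSet_Ioi h1).trans ?_
    rw [lintegral_const_mul' _ _ ENNReal.ofReal_ne_top,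
      ← ofReal_integral_eq_lintegral_ofReal (Real.GammaIntegral_convergent two_pos)]
    · rw [← Real.Gamma_eq_integral two_pos, Real.Gamma_two, ENNReal.ofReal_one, mul_one]
    · exact (ae_restrict_mem measurableSet_Ioi).mono fun s hs => by
        have : (0 : ℝ) < s := hs
        positivity
  -- second moment of the truncation
  have hM : ∫⁻ t, ENNReal.ofReal (min ‖q t‖ T ^ 2) ∂ϖ ≤ ENNReal.ofReal (4 * η * T) := by
    rw [lintegral_sq_eq_lintegral_meas_lt (fun t => le_min (norm_nonneg _) hT0.le) hmm]
    have h1 : ∀ s ∈ Set.Ioi (0 : ℝ), ϖ {t | s < min ‖q t‖ T} * ENNReal.ofReal (2 * s) ≤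
        (Set.Ioc 0 s₀).indicator (fun _ => ENNReal.ofReal (2 * s₀)) s +
        (Set.Ioc 0 T).indicator (fun _ => ENNReal.ofReal (2 * η)) s := by
      intro s hs0
      have hs0 : (0 : ℝ) < s := hs0
      rcases le_or_gt s s₀ with h2 | h2
      · rw [Set.indicator_of_mem (show s ∈ Set.Ioc 0 s₀ from ⟨hs0, h2⟩)]
        refine le_add_right ?_
        calc ϖ {t | s < min ‖q t‖ T} * ENNReal.ofReal (2 * s) ≤ 1 * ENNReal.ofReal (2 * s₀) := by
              gcongr; exact prob_le_one
          _ = _ := one_mul _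
      · rcases le_or_gt s T with h3 | h3
        · rw [Set.indicator_of_mem (show s ∈ Set.Ioc 0 T from ⟨hs0, h3⟩)]
          refine le_add_left ?_
          have h4 : {t | s < min ‖q t‖ T} ⊆ {t | s < ‖q t‖} := fun t ht => by
            have ht : s < min ‖q t‖ T := ht
            exact (lt_min_iff.1 ht).1
          refine (mul_le_mul_left ((measure_mono h4).trans (hs _ h2.le)) _).trans ?_
          rw [← ENNReal.ofReal_mul (by positivity)]
          refine ENNReal.ofReal_le_ofReal (le_of_eq ?_)
          field_simp
        · have h4 : {t | s < min ‖q t‖ T} = ∅ := by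
            ext t
            simp only [Set.mem_ofPred_eq, Set.mem_empty_iff_false, iff_false, not_lt]
            exact (min_le_right _ _).trans h3.le
          rw [h4]; simp
    refine (setLIntegral_mono' measurableSet_Ioi h1).trans
      ((setLIntegral_le_lintegral _ _).trans ?_)
    rw [lintegral_add_left (measurable_const.indicator measurableSet_Ioc),
      lintegral_indicator measurableSet_Ioc, lintegral_indicator measurableSet_Ioc,
      setLIntegral_const, setLIntegral_const, Real.volume_Ioc, Real.volume_Ioc,
      ← ENNReal.ofReal_mul (by positivity), ← ENNReal.ofReal_mul (by positivity),
      ← ENNReal.ofReal_add (by nlinarith) (by nlinarith)]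
    refine ENNReal.ofReal_le_ofReal ?_
    nlinarith
  have hEm : AEStronglyMeasurable (fun t => excess q T t ^ 2) ϖ :=
    (hem.pow_const 2).aestronglyMeasurable
  have hE' : ∫ t, excess q T t ^ 2 ∂ϖ ≤ 2 * η / T := by
    rw [integral_eq_lintegral_of_nonneg_ae (Eventually.of_forall fun t => sq_nonneg _) hEm]
    exact ENNReal.toReal_le_of_le_ofReal (by positivity) hE
  have hM' : ∫ t, min ‖q t‖ T ^ 2 ∂ϖ ≤ 4 * η * T := by
    rw [integral_eq_lintegral_of_nonneg_ae (Eventually.of_forall fun t => sq_nonneg _)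
      (hmm.pow_const 2).aestronglyMeasurable]
    exact ENNReal.toReal_le_of_le_ofReal (by positivity) hM
  refine ⟨T, hT1, ?_, ?_, ?_⟩
  · rw [memLp_two_iff_integrable_sq hem.aestronglyMeasurable]
    refine ⟨hEm, ?_⟩
    rw [hasFiniteIntegral_iff_ofReal (Eventually.of_forall fun t => sq_nonneg _)]
    exact hE.trans_lt ENNReal.ofReal_lt_top
  · refine hE'.trans ?_
    rw [div_le_iff₀ hT0]
    nlinarith
  · have h0 : 0 ≤ ∫ t, excess q T t ^ 2 ∂ϖ := integral_nonneg fun t => sq_nonneg _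
    calc _ ≤ (4 * η * T) * (2 * η / T) := mul_le_mul hM' hE' h0 (by positivity)
      _ = 8 * η ^ 2 := by field_simp; ring
      _ ≤ δ ^ 2 := by rw [hη]; nlinarith [sq_nonneg δ]

/-- Some translate of a measurable function has its reciprocal in weak `L²`: the image measure in
the plane has finite density at almost every point. -/
theorem exists_shift_small {u : ℝ → ℂ} (hu : AEMeasurable u ϖ) :
    ∃ (ξ : ℂ) (K : ℝ), ∀ r : ℝ, 0 < r → ϖ {t | ‖u t + ξ‖ < r} ≤ ENNReal.ofReal (K * r ^ 2) := by
  set ρ := Measure.map u ϖ with hρ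
  have : IsProbabilityMeasure ρ := Measure.isProbabilityMeasure_map hu
  obtain ⟨x, hx1, hx2⟩ := ((Besicovitch.ae_tendsto_rnDeriv ρ (volume : Measure ℂ)).and
    (Measure.rnDeriv_lt_top ρ volume)).exists
  obtain ⟨C, hC1, hC2⟩ := ENNReal.lt_iff_exists_nnreal_btwn.1 hx2
  have hev : ∀ᶠ r in 𝓝[>] (0 : ℝ), ρ (Metric.closedBall x r) ≤
      C * volume (Metric.closedBall x r) := by
    filter_upwards [hx1.eventually (gt_mem_nhds hC1), self_mem_nhdsWithin] with r hr hr0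
    have hr0 : (0 : ℝ) < r := hr0
    refine (ENNReal.div_le_iff_le_mul (Or.inl ?_) (Or.inl ?_)).1 hr.le
    · exact (Metric.measure_closedBall_pos _ _ hr0).ne'
    · exact measure_closedBall_lt_top.ne
  obtain ⟨r₀, hr₀, hr⟩ := mem_nhdsGT_iff_exists_Ioo_subset.1 hev
  have hr₀ : (0 : ℝ) < r₀ := hr₀
  refine ⟨-x, max (C * Real.pi) (1 / r₀ ^ 2), fun r hr0 => ?_⟩
  rcases lt_or_ge r r₀ with h | h
  · have h1 : ϖ {t | ‖u t + -x‖ < r} ≤ ρ (Metric.closedBall x r) := by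
      rw [hρ, Measure.map_apply_of_aemeasurable hu measurableSet_closedBall]
      refine measure_mono fun t ht => ?_
      rw [Set.mem_preimage, mem_closedBall_iff_norm, sub_eq_add_neg]
      exact le_of_lt ht
    refine h1.trans ((hr ⟨hr0, h⟩).trans ?_)
    rw [Complex.volume_closedBall]
    have h2 : (C : ℝ≥0∞) * (ENNReal.ofReal r ^ 2 * (NNReal.pi : ℝ≥0∞)) =
        ENNReal.ofReal (C * Real.pi * r ^ 2) := by
      rw [ENNReal.ofReal_mul (by positivity), ENNReal.ofReal_mul (by positivity),
        ENNReal.ofReal_pow hr0.le, ENNReal.ofReal_coe_nnreal, ← NNReal.coe_real_pi,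
        ENNReal.ofReal_coe_nnreal]
      ring
    rw [h2]
    exact ENNReal.ofReal_le_ofReal (by gcongr; exact le_max_left _ _)
  · refine prob_le_one.trans ?_
    rw [← ENNReal.ofReal_one]
    refine ENNReal.ofReal_le_ofReal ?_
    calc (1 : ℝ) = 1 / r₀ ^ 2 * r₀ ^ 2 := by field_simp
      _ ≤ max (C * Real.pi) (1 / r₀ ^ 2) * r ^ 2 := by
        gcongr; exact le_max_right _ _

/-! ### A reflection principle -/

theorem norm_schwarz_le {v : ℝ → ℝ} (hv : Integrable v ϖ) {z : ℂ} (hz : z ∈ UHP) :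
    ‖schwarz v z‖ ≤ (‖-I * (z + I)‖ * (1 + ‖z - I‖ / |z.im|) + 1) * ∫ t, |v t| ∂ϖ := by
  have hz' := (im_pos_of_mem hz).ne'
  rw [schwarz_eq_integral hv hz', ← integral_const_mul]
  refine norm_integral_le_of_norm_le (hv.abs.const_mul _) (Eventually.of_forall fun t => ?_)
  rw [norm_mul, norm_real, Real.norm_eq_abs]
  gcongr
  refine (norm_sub_le _ _).trans ?_
  rw [norm_mul, norm_one]
  gcongr
  exact norm_cker_le hz' t

theorem norm_exp_sub_conj_le (s : ℂ) : ‖exp s - conj (exp s)‖ ≤ 2 * Real.exp s.re * |s.im| := by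
  have h : exp s - conj (exp s) = (2 * (exp s).im : ℝ) * I := by
    rw [sub_conj]
  rw [h, norm_mul, norm_I, mul_one, norm_real, Real.norm_eq_abs, abs_mul, exp_im, abs_mul,
    Real.abs_exp, abs_two, mul_assoc]
  exact mul_le_mul_of_nonneg_left (mul_le_mul_of_nonneg_left Real.abs_sin_le_abs
    (Real.exp_pos _).le) zero_le_two

theorem integral_mul_sq_le {f g : ℝ → ℝ} {μ : Measure ℝ} (hf : MemLp f 2 μ) (hg : MemLp g 2 μ)
    (hf0 : ∀ t, 0 ≤ f t) (hg0 : ∀ t, 0 ≤ g t) :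
    ∫ t, f t * g t ∂μ ≤ √((∫ t, f t ^ 2 ∂μ) * ∫ t, g t ^ 2 ∂μ) := by
  have h := integral_mul_le_Lp_mul_Lq_of_nonneg (μ := μ) Real.HolderConjugate.two_two
    (Eventually.of_forall hf0) (Eventually.of_forall hg0) (by simpa using hf) (by simpa using hg)
  rw [Real.sqrt_mul (integral_nonneg fun t => sq_nonneg _), Real.sqrt_eq_rpow, Real.sqrt_eq_rpow]
  simpa using h

/-- If `Q = O F` and `Q' = O F'`, with `O` outer and `F`, `F'` in the Hardy class, satisfy
`c Q = conj Q'` on the line, then this identity persists in the half-plane as soon as the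
distribution function of `Q` is `o(1/s)`. Neither `Q` nor `Q'` needs to be summable: both are
multiplied by the outer function with modulus `min 1 (T / |Q|)`, which is nearly real on the line
relative to the size of `Q`. -/
theorem outer_mul_eq_conj {F F' : ℂ → ℂ} {f f' : ℝ → ℂ} (hF : HardyPair F f)
    (hF' : HardyPair F' f') {w : ℝ → ℝ} (hw : Integrable w ϖ) {c : ℂ} (hc : ‖c‖ = 1)
    (heq : ∀ᵐ t : ℝ, c * (outerBd w t * f t) = conj (outerBd w t * f' t))
    (htail : SmallTail fun t => outerBd w t * f t) {z : ℂ} (hz : z ∈ UHP) :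
    c * (outer w z * F z) = conj (outer w z * F' z) := by
  set q : ℝ → ℂ := fun t => outerBd w t * f t with hq
  set q' : ℝ → ℂ := fun t => outerBd w t * f' t with hq'
  have hwm := aestronglyMeasurable_poisson.2 (outerBd_spec hw).2.2
  have hqm : AEStronglyMeasurable q ϖ := hwm.mul hF.memLp.1
  have hnorm : ∀ᵐ t : ℝ, ‖q' t‖ = ‖q t‖ := by
    filter_upwards [heq] with t ht
    have := congrArg norm ht
    rw [norm_mul, hc, one_mul, RCLike.norm_conj] at this
    exact this.symm
  set B := ‖z + I‖ * (1 + ‖z - I‖ / |z.im|) + 1 with hB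
  have hB0 : 0 ≤ B := by positivity
  set B' := ‖-I * (z + I)‖ * (1 + ‖z - I‖ / |z.im|) + 1 with hB'
  have hB'0 : 0 ≤ B' := by positivity
  -- the estimate after multiplication by the truncating outer function `exp (-S ℓ)`
  have key : ∀ δ : ℝ, 0 < δ → ∃ o : ℂ, ‖o‖ ≤ B' * √δ ∧
      ‖c * (exp (-o) * (outer w z * F z)) - conj (exp (-o) * (outer w z * F' z))‖ ≤ 2 * B * δ := by
    intro δ hδ
    obtain ⟨T, hT1, hℓ, hℓ2, hprod⟩ := htail.exists_excess hqm hδ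
    have hT0 : 0 < T := one_pos.trans_le hT1
    set ℓ := excess q T with hℓdef
    have hℓ0 : ∀ t, 0 ≤ ℓ t := excess_nonneg q T
    have hℓi : Integrable ℓ ϖ := hℓ.integrable (by norm_num)
    set v : ℝ → ℝ := fun t => -ℓ t with hv
    have hvm : MemLp v 2 ϖ := hℓ.neg
    have hvi : Integrable v ϖ := hℓi.neg
    obtain ⟨s, hs, hsre, hsim⟩ := exists_hardyPair_schwarz hvm
    have hexp : ∀ᵐ t : ℝ, outerBd v t = exp (s t) := by
      refine boundary_ae_eq ?_
      filter_upwards [hs.radial] with t ht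
      exact (continuous_exp.tendsto _).comp ht
    have hsum := outerBd_add hvi hw
    have htr : ∀ᵐ t : ℝ, ‖outerBd v t * q t‖ = min ‖q t‖ T := by
      filter_upwards [(outerBd_spec hvi).2.1] with t ht
      rw [norm_mul, ht]
      exact exp_neg_excess_mul hT0 t
    have hbd : ∀ᵐ t : ℝ, ‖outerBd v t * q t‖ ≤ T := by
      filter_upwards [htr] with t ht
      rw [ht]; exact min_le_right _ _
    have hbd' : ∀ᵐ t : ℝ, ‖outerBd v t * q' t‖ ≤ T := by
      filter_upwards [hbd, hnorm] with t ht h1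
      rw [norm_mul, h1, ← norm_mul]; exact ht
    have hpair : ∀ {G : ℂ → ℂ} {g : ℝ → ℂ}, HardyPair G g →
        (∀ᵐ t : ℝ, ‖outerBd v t * (outerBd w t * g t)‖ ≤ T) →
        HardyPair (fun z => outer v z * (outer w z * G z))
          (fun t => outerBd v t * (outerBd w t * g t)) := by
      intro G g hG hb
      have h1 : ∀ᵐ t : ℝ, outerBd (fun t => v t + w t) t * g t =
          outerBd v t * (outerBd w t * g t) := by
        filter_upwards [hsum] with t ht
        rw [ht, mul_assoc]
      have h2 : MemLp (fun t => outerBd (fun t => v t + w t) t * g t) 2 ϖ := by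
        refine MemLp.of_bound ((aestronglyMeasurable_poisson.2
          (outerBd_spec (hvi.add hw)).2.2).mul hG.memLp.1) T ?_
        rw [ae_poissonMeasure]
        filter_upwards [h1, hb] with t h3 h4
        rw [h3]; exact h4
      refine (hG.mul_outer (hvi.add hw) h2).congr (fun x hx => ?_) ?_
      · change _ = outer (fun t => v t + w t) x * _
        rw [outer_add hvi hw hx, mul_assoc]
      · filter_upwards [h1] with t ht
        exact ht.symm
    have hP := hpair hF hbd
    have hP' := hpair hF' hbd'
    refine ⟨schwarz ℓ z, ?_, ?_⟩
    · refine (norm_schwarz_le hℓi hz).trans ?_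
      gcongr
      have h1 := integral_mul_sq_le (μ := ϖ) hℓ (memLp_const 1) hℓ0 (fun _ => zero_le_one)
      simp only [mul_one, one_pow, integral_const, probReal_univ, smul_eq_mul] at h1
      simp_rw [abs_of_nonneg (hℓ0 _)]
      exact h1.trans (Real.sqrt_le_sqrt hℓ2)
    · have hov : exp (-schwarz ℓ z) = outer v z := by rw [outer, hv, schwarz_neg]
      rw [hov, hP.eq_pext z hz, hP'.eq_pext z hz, ← pext_conj, ← pext_const_mul,
        ← pext_sub hz (hP.integrable.const_mul c) (integrable_conj hP'.integrable), pext]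
      have hsm : AEStronglyMeasurable (fun t => |(s t).im|) ϖ :=
        (continuous_im.comp_aestronglyMeasurable hs.memLp.1).norm
      have hsL : MemLp (fun t => |(s t).im|) 2 ϖ :=
        hs.memLp.norm.of_le hsm (Eventually.of_forall fun t => by
          simpa using abs_im_le_norm (s t))
      have hqL : MemLp (fun t => min ‖q t‖ T) 2 ϖ := by
        refine MemLp.of_bound (hqm.norm.aemeasurable.min
          aemeasurable_const).aestronglyMeasurable T (Eventually.of_forall fun t => ?_)
        rw [Real.norm_of_nonneg (le_min (norm_nonneg _) hT0.le)]
        exact min_le_right _ _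
      have hpt : ∀ᵐ t : ℝ, ‖(rho z t : ℂ) * (c * (outerBd v t * (outerBd w t * f t)) -
          conj (outerBd v t * (outerBd w t * f' t)))‖ ≤
          2 * B * (min ‖q t‖ T * |(s t).im|) := by
        filter_upwards [heq, hexp, hsre, (outerBd_spec hvi).2.1] with t h1 h2 h3 h4
        have h5 : c * (outerBd v t * (outerBd w t * f t)) -
            conj (outerBd v t * (outerBd w t * f' t)) =
            (outerBd v t - conj (outerBd v t)) * (c * q t) := by
          rw [map_mul, ← h1]; ring
        rw [h5, norm_mul, norm_mul, norm_mul, hc, one_mul, h2]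
        have h6 := norm_exp_sub_conj_le (s t)
        rw [h3] at h6
        have h7 : Real.exp (v t) * ‖q t‖ = min ‖q t‖ T := exp_neg_excess_mul hT0 t
        calc ‖(rho z t : ℂ)‖ * (‖exp (s t) - conj (exp (s t))‖ * ‖q t‖)
            ≤ B * (2 * Real.exp (v t) * |(s t).im| * ‖q t‖) := by
              gcongr
              exact norm_rho_le hz t
          _ = 2 * B * (min ‖q t‖ T * |(s t).im|) := by rw [← h7]; ring
      refine (norm_integral_le_of_norm_le ((hqL.integrable_mul hsL).const_mul (2 * B))
        (by rw [ae_poissonMeasure]; exact hpt)).trans ?_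
      change ∫ t, 2 * B * (min ‖q t‖ T * |(s t).im|) ∂ϖ ≤ _
      rw [integral_const_mul]
      gcongr
      refine (integral_mul_sq_le hqL hsL (fun t => le_min (norm_nonneg _) hT0.le)
        fun t => abs_nonneg _).trans ?_
      rw [Real.sqrt_le_left hδ.le]
      refine le_trans ?_ hprod
      refine mul_le_mul_of_nonneg_left ?_ (integral_nonneg fun t => sq_nonneg _)
      simpa [hv] using hsim
  -- passage to the limit
  choose o ho1 ho2 using fun n : ℕ => key (1 / ((n : ℝ) + 1)) Nat.one_div_pos_of_nat
  have hδ := tendsto_one_div_add_atTop_nhds_zero_nat (𝕜 := ℝ)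
  have hsq : Tendsto (fun n : ℕ => B' * √(1 / ((n : ℝ) + 1))) atTop (𝓝 0) := by
    have := ((Real.continuous_sqrt.tendsto 0).comp hδ).const_mul B'
    simpa using this
  have hoz : Tendsto (fun n => exp (-o n)) atTop (𝓝 1) := by
    have h1 : Tendsto o atTop (𝓝 0) := squeeze_zero_norm ho1 hsq
    have := (continuous_exp.tendsto _).comp h1.neg
    rwa [neg_zero, exp_zero] at this
  have hlim : Tendsto (fun n => c * (exp (-o n) * (outer w z * F z)) -
      conj (exp (-o n) * (outer w z * F' z))) atTop
      (𝓝 (c * (1 * (outer w z * F z)) - conj (1 * (outer w z * F' z)))) :=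
    ((hoz.mul_const _).const_mul c).sub ((continuous_conj.tendsto _).comp (hoz.mul_const _))
  have hzero : Tendsto (fun n => c * (exp (-o n) * (outer w z * F z)) -
      conj (exp (-o n) * (outer w z * F' z))) atTop (𝓝 0) := by
    refine squeeze_zero_norm ho2 ?_
    simpa using hδ.const_mul (2 * B)
  have := tendsto_nhds_unique hlim hzero
  rw [one_mul, one_mul] at this
  exact sub_eq_zero.1 this

/-! ### The Hardy space of the half-plane in terms of the Hardy class -/

/-- `f` is the boundary function of some function of the Hardy class. -/
def InHardy (f : ℝ → ℂ) : Prop := ∃ F, HardyPair F f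

namespace InHardy

theorem memLp {f : ℝ → ℂ} (h : InHardy f) : MemLp f 2 ϖ := h.choose_spec.memLp

theorem congr {f g : ℝ → ℂ} (h : InHardy f) (hg : g =ᵐ[volume] f) : InHardy g :=
  let ⟨F, hF⟩ := h
  ⟨F, hF.congr (fun _ _ => rfl) hg⟩

theorem add {f g : ℝ → ℂ} (hf : InHardy f) (hg : InHardy g) : InHardy fun t => f t + g t :=
  let ⟨_, hF⟩ := hf
  let ⟨_, hG⟩ := hg
  ⟨_, hF.add hG⟩

theorem const_mul {f : ℝ → ℂ} (hf : InHardy f) (c : ℂ) : InHardy fun t => c * f t :=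
  let ⟨_, hF⟩ := hf
  ⟨_, hF.const_mul c⟩

theorem mul {f g : ℝ → ℂ} (hf : InHardy f) (hg : InHardy g)
    (h : MemLp (fun t => f t * g t) 2 ϖ) : InHardy fun t => f t * g t :=
  let ⟨_, hF⟩ := hf
  let ⟨_, hG⟩ := hg
  ⟨_, hF.mul hG h⟩

theorem mul_of_bounded {f g : ℝ → ℂ} (hf : InHardy f) (hg : InHardy g) {C : ℝ}
    (hC : ∀ᵐ t : ℝ, ‖f t‖ ≤ C) : InHardy fun t => f t * g t := by
  refine hf.mul hg ((hg.memLp.const_mul (C : ℂ)).of_le (hf.memLp.1.mul hg.memLp.1) ?_)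
  rw [ae_poissonMeasure]
  filter_upwards [hC] with t ht
  rw [norm_mul, norm_mul, norm_real]
  gcongr
  exact ht.trans (Real.le_norm_self C)

theorem inner_mul {f : ℝ → ℂ} (hf : InHardy f) (θ : InnerFunction) :
    InHardy fun t => θ.bd t * f t :=
  mul_of_bounded ⟨_, θ.hardyPair⟩ hf (C := 1) (θ.norm_bd.mono fun _ h => h.le)

theorem mul_outer {f : ℝ → ℂ} (hf : InHardy f) {v : ℝ → ℝ} (hv : Integrable v ϖ)
    (h : MemLp (fun t => outerBd v t * f t) 2 ϖ) : InHardy fun t => outerBd v t * f t :=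
  let ⟨_, hF⟩ := hf
  ⟨_, hF.mul_outer hv h⟩

end InHardy

theorem hardyPair_zeta : HardyPair (fun z => (z - I) / (z + I)) zeta := by
  have hne : ∀ z : ℂ, 0 ≤ z.im → z + I ≠ 0 := fun z hz h => by
    have := congrArg Complex.im h
    simp at this; linarith
  refine hardyPair_of_bounded (C := 1) ?_ ?_ (Eventually.of_forall fun x => ?_)
  · exact (differentiableOn_id.sub_const I).div (differentiableOn_id.add_const I)
      fun z hz => hne z (im_pos_of_mem hz).le
  · intro z hz
    have h0 := hne z (im_pos_of_mem hz).le
    rw [norm_div, div_le_one (norm_pos_iff.2 h0), ← sq_le_sq₀ (norm_nonneg _) (norm_nonneg _),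
      ← normSq_eq_norm_sq, ← normSq_eq_norm_sq, normSq_apply, normSq_apply]
    have := im_pos_of_mem hz
    simp only [sub_re, sub_im, add_re, add_im, I_re, I_im]
    nlinarith
  · have hc : ContinuousAt (fun y : ℝ => ((x : ℂ) + y * I - I) / ((x : ℂ) + y * I + I)) 0 := by
      refine ContinuousAt.div (by fun_prop) (by fun_prop) ?_
      simpa using ofReal_add_I_ne_zero x
    have := hc.tendsto.mono_left (nhdsWithin_le_nhds (s := Set.Ioi 0))
    simpa [zeta] using this

theorem memLp_two_iff_poisson {f : ℝ → ℂ} :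
    MemLp f 2 volume ↔ MemLp (fun t : ℝ => ((t : ℂ) + I) * f t) 2 ϖ := by
  have hm : AEStronglyMeasurable (fun t : ℝ => ((t : ℂ) + I) * f t) volume ↔
      AEStronglyMeasurable f volume := by
    constructor
    · intro h
      refine (((by fun_prop : Continuous fun t : ℝ => (t : ℂ) + I).inv₀
        ofReal_add_I_ne_zero).aestronglyMeasurable.mul h).congr (Eventually.of_forall fun t => ?_)
      have := ofReal_add_I_ne_zero t
      simp [this]
    · exact fun h => (by fun_prop : Continuous fun t : ℝ => (t : ℂ) + I).aestronglyMeasurable.mul h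
  have key : ∀ t : ℝ, ‖((t : ℂ) + I) * f t‖ ^ 2 / (Real.pi * (1 + t ^ 2)) =
      Real.pi⁻¹ * ‖f t‖ ^ 2 := by
    intro t
    have h1 : ‖(t : ℂ) + I‖ ^ 2 = 1 + t ^ 2 := by
      rw [← normSq_eq_norm_sq, normSq_apply]; simp; ring
    have h2 : 1 + t ^ 2 ≠ 0 := by positivity
    rw [norm_mul, mul_pow, h1]
    field_simp
  constructor
  · intro h
    have h1 := aestronglyMeasurable_poisson.2 (hm.2 h.1)
    rw [memLp_two_iff_integrable_sq_norm h1, integrable_poisson_real]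
    simp_rw [key]
    exact ((memLp_two_iff_integrable_sq_norm h.1).1 h).const_mul _
  · intro h
    have h1 := hm.1 (aestronglyMeasurable_poisson.1 h.1)
    have h2 := (memLp_two_iff_integrable_sq_norm h.1).1 h
    rw [integrable_poisson_real] at h2
    simp_rw [key] at h2
    rw [memLp_two_iff_integrable_sq_norm h1]
    exact (integrable_const_mul_iff (by simp [Real.pi_ne_zero]) _).1 h2

theorem mem_H2_iff {f : L2} : f ∈ H2 ↔ InHardy fun t : ℝ => ((t : ℂ) + I) * f t := by
  have hm := memLp_two_iff_poisson.1 (Lp.memLp f)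
  have hc : ∀ z ∈ UHP, cint (fun t : ℝ => ((t : ℂ) + I) * f t) (conj z) =
      (Real.pi : ℂ)⁻¹ * ∫ t, cauchyKer (conj z) t * f t := by
    intro z hz
    rw [cint, integral_poisson, ← integral_const_mul]
    congr 1; ext t
    have h1 := ofReal_add_I_ne_zero t
    have h2 := ofReal_sub_I_ne_zero t
    have h3 : (t : ℂ) - conj z ≠ 0 :=
      ofReal_sub_ne_zero (by simpa using (im_pos_of_mem hz).ne') t
    rw [one_add_sq_eq, cker, cauchyKer]
    field_simp
  have hpi : (Real.pi : ℂ)⁻¹ ≠ 0 := by simp [Real.pi_ne_zero]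
  rw [mem_H2_iff_cauchyKer]
  constructor
  · intro h
    exact ⟨_, HardyPair.of_cint hm fun z hz => by rw [hc z hz, h z hz, mul_zero]⟩
  · rintro ⟨F, hF⟩ z hz
    have := hF.cint_conj hz
    rw [hc z hz] at this
    exact (mul_eq_zero.1 this).resolve_left hpi

/-- The orthogonal complement of `H²` consists of the complex conjugates of its elements. -/
theorem mem_H2_orthogonal_iff {w : L2} :
    w ∈ H2ᗮ ↔ InHardy fun t : ℝ => ((t : ℂ) + I) * conj (w t) := by
  have hwc : MemLp (fun t => conj (w t)) 2 volume := memLp_conj (Lp.memLp w)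
  have hco := hwc.coeFn_toLp
  have hiff : hwc.toLp _ ∈ H2 ↔ InHardy fun t : ℝ => ((t : ℂ) + I) * conj (w t) := by
    rw [mem_H2_iff]
    constructor <;> intro h <;> refine h.congr ?_ <;> filter_upwards [hco] with t ht <;> rw [ht]
  constructor
  · intro hw
    rw [← hiff, mem_H2_iff_cauchyKer]
    intro z hz
    have hk := memLp_cauchyKer (z := conj (conj z)) (by simpa using hz)
    have hk' : MemLp (cauchyKer (conj z)) 2 volume := by
      have := memLp_conj hk
      simpa only [conj_cauchyKer, conj_conj] using this
    have hkc := hk'.coeFn_toLp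
    have hkH : hk'.toLp _ ∈ H2 := by
      rw [mem_H2_iff]
      refine InHardy.congr ⟨_, hardyPair_kernel hz⟩ ?_
      filter_upwards [hkc] with t ht
      rw [ht, cker, map_div₀, conj_ofReal_sub_I, map_sub, conj_ofReal, cauchyKer]
      ring
    have h1 := Submodule.inner_left_of_mem_orthogonal hkH hw
    rw [MeasureTheory.L2.inner_def] at h1
    rw [← h1]
    refine integral_congr_ae ?_
    filter_upwards [hkc, hco] with t h2 h3
    rw [h2, h3, RCLike.inner_apply]
  · rintro ⟨G, hG⟩
    rw [Submodule.mem_orthogonal]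
    intro f hf
    obtain ⟨F, hF⟩ := mem_H2_iff.1 hf
    have hζ := hardyPair_zeta
    have hζm : MemLp (fun t : ℝ => zeta t * (((t : ℂ) + I) * conj (w t))) 2 ϖ :=
      hG.memLp.of_le (hζ.memLp.1.mul hG.memLp.1) (Eventually.of_forall fun t => by
        rw [norm_mul, norm_zeta, one_mul])
    have h1 := hF.pext_mul (hζ.mul hG hζm) I_mem_UHP
    rw [sub_self, zero_div, zero_mul, mul_zero, pext_I, integral_poisson] at h1
    have h2 : ∫ t, f t * conj (w t) = 0 := by
      have h3 : ∀ t : ℝ, ((t : ℂ) + I) * f t * (zeta t * (((t : ℂ) + I) * conj (w t))) /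
          (Real.pi * (1 + (t : ℂ) ^ 2)) = (Real.pi : ℂ)⁻¹ * (f t * conj (w t)) := by
        intro t
        have h1 := ofReal_add_I_ne_zero t
        have h2 := ofReal_sub_I_ne_zero t
        rw [one_add_sq_eq, zeta]
        field_simp
      simp_rw [h3] at h1
      rw [integral_const_mul] at h1
      exact (mul_eq_zero.1 h1).resolve_left (by simp [Real.pi_ne_zero])
    rw [MeasureTheory.L2.inner_def]
    have h3 := congrArg conj h2
    rw [← integral_conj, map_zero] at h3
    rw [← h3]
    congr 1; ext t
    rw [RCLike.inner_apply, map_mul, conj_conj, mul_comm]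

theorem conj_zeta_mul (t : ℝ) (a : ℂ) :
    conj (zeta t) * conj (((t : ℂ) + I) * a) = ((t : ℂ) + I) * conj a := by
  have h1 := ofReal_add_I_ne_zero t
  have h2 := ofReal_sub_I_ne_zero t
  rw [zeta, map_div₀, map_mul, conj_ofReal_add_I, conj_ofReal_sub_I]
  field_simp

/-- The space `p ∈ H²(ϖ)` with `ζ̄ U p̄ ∈ H²(ϖ)`, where `ζ(t) = (t - i)/(t + i)`. For inner `U` this
is the model space of `U`, and for `U = θ L̄` it is the kernel of the Toeplitz operator with symbol
`θ̄ L`, both transplanted by the factor `t + i`. -/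
structure CoHardy (U p : ℝ → ℂ) : Prop where
  mem : InHardy p
  mem_dual : InHardy fun t => conj (zeta t) * (U t * conj (p t))

theorem CoHardy.congr {U p q : ℝ → ℂ} (h : CoHardy U p) (hq : q =ᵐ[volume] p) : CoHardy U q := by
  refine ⟨h.mem.congr hq, h.mem_dual.congr ?_⟩
  filter_upwards [hq] with t ht
  rw [ht]

theorem CoHardy.add {U p q : ℝ → ℂ} (hp : CoHardy U p) (hq : CoHardy U q) :
    CoHardy U fun t => p t + q t := by
  refine ⟨hp.mem.add hq.mem, (hp.mem_dual.add hq.mem_dual).congr (Eventually.of_forall fun t => ?_)⟩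
  simp only [map_add]; ring

theorem CoHardy.const_mul {U p : ℝ → ℂ} (hp : CoHardy U p) (c : ℂ) :
    CoHardy U fun t => c * p t := by
  refine ⟨hp.mem.const_mul c, (hp.mem_dual.const_mul (conj c)).congr
    (Eventually.of_forall fun t => ?_)⟩
  simp only [map_mul]; ring

theorem mul_mem_H2_orthogonal_iff {U V : ℝ → ℂ} (hU : MemLp U ∞ volume) (f : L2)
    (hUV : ∀ᵐ t : ℝ, conj (U t) = V t) : mulL2 U hU f ∈ H2ᗮ ↔
      InHardy fun t : ℝ => conj (zeta t) * (V t * conj (((t : ℂ) + I) * f t)) := by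
  rw [mem_H2_orthogonal_iff]
  have h : (fun t : ℝ => ((t : ℂ) + I) * conj (mulL2 U hU f t)) =ᵐ[volume]
      fun t : ℝ => conj (zeta t) * (V t * conj (((t : ℂ) + I) * f t)) := by
    filter_upwards [coeFn_mulL2 U hU f, hUV] with t h1 h2
    rw [h1, map_mul, h2, mul_left_comm, mul_left_comm (conj (zeta t)), conj_zeta_mul]
  exact ⟨fun h' => h'.congr h.symm, fun h' => h'.congr h⟩

theorem mem_modelSpace_iff {θ : InnerFunction} {g : L2} :
    g ∈ modelSpace θ ↔ CoHardy θ.bd fun t : ℝ => ((t : ℂ) + I) * g t := by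
  have hc : MemLp (fun t => conj (θ.bd t)) ∞ volume := memLp_conj θ.memLp_bd
  have h1 : g ∈ (H2.map (mulL2 θ.bd θ.memLp_bd : L2 →ₗ[ℂ] L2))ᗮ ↔ mulL2 _ hc g ∈ H2ᗮ := by
    have hadj : ∀ f : L2, inner ℂ (mulL2 θ.bd θ.memLp_bd f) g = inner ℂ f (mulL2 _ hc g) := by
      intro f
      rw [MeasureTheory.L2.inner_def, MeasureTheory.L2.inner_def]
      refine integral_congr_ae ?_
      filter_upwards [coeFn_mulL2 _ θ.memLp_bd f, coeFn_mulL2 _ hc g] with t h1 h2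
      rw [h1, h2, RCLike.inner_apply, RCLike.inner_apply, map_mul]
      ring
    rw [Submodule.mem_orthogonal, Submodule.mem_orthogonal]
    constructor
    · intro h f hf
      rw [← hadj]
      exact h _ (Submodule.mem_map_of_mem hf)
    · rintro h _ ⟨f, hf, rfl⟩
      exact (hadj f).trans (h f hf)
  rw [modelSpace, Submodule.mem_inf, h1, mem_H2_iff,
    mul_mem_H2_orthogonal_iff hc g (V := θ.bd) (Eventually.of_forall fun t => conj_conj _)]
  exact ⟨fun h => ⟨h.1, h.2⟩, fun h => ⟨h.1, h.2⟩⟩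

theorem memLp_div_of_poisson {p : ℝ → ℂ} (hp : MemLp p 2 ϖ) :
    MemLp (fun t : ℝ => p t / ((t : ℂ) + I)) 2 volume := by
  rw [memLp_two_iff_poisson]
  refine (memLp_congr_ae (Eventually.of_forall fun t => ?_)).1 hp
  have := ofReal_add_I_ne_zero t
  field_simp

theorem coeFn_toLp_div {p : ℝ → ℂ} (hp : MemLp p 2 ϖ) :
    (fun t : ℝ => ((t : ℂ) + I) * ((memLp_div_of_poisson hp).toLp _ : L2) t) =ᵐ[volume] p := by
  filter_upwards [(memLp_div_of_poisson hp).coeFn_toLp] with t ht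
  have := ofReal_add_I_ne_zero t
  rw [ht]
  field_simp

theorem mem_toeplitzKernel_iff {θ L : InnerFunction} {f : H2} : f ∈ toeplitzKernel θ L ↔
    mulL2 _ (θ.memLp_conj_bd_mul L) (f : L2) ∈ H2ᗮ := by
  have h : f ∈ toeplitzKernel θ L ↔
      H2.orthogonalProjectionOnto (mulL2 _ (θ.memLp_conj_bd_mul L) (f : L2)) = 0 := Iff.rfl
  rw [h, Submodule.orthogonalProjectionOnto_eq_zero_iff]

theorem mem_dominanceSet_iff {θ L : InnerFunction} : L ∈ dominanceSet θ ↔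
    ∃ p, CoHardy (fun t => θ.bd t * conj (L.bd t)) p ∧ ¬ p =ᵐ[volume] 0 := by
  have hker : ∀ f : H2, f ∈ toeplitzKernel θ L ↔ CoHardy (fun t => θ.bd t * conj (L.bd t))
      fun t : ℝ => ((t : ℂ) + I) * (f : L2) t := by
    intro f
    have h1 := mem_toeplitzKernel_iff (θ := θ) (L := L) (f := f)
    rw [h1, mul_mem_H2_orthogonal_iff _ _ (V := fun t => θ.bd t * conj (L.bd t))
      (Eventually.of_forall fun t => by rw [map_mul, conj_conj])]
    exact ⟨fun h => ⟨mem_H2_iff.1 f.2, h⟩, fun h => h.mem_dual⟩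
  change toeplitzKernel θ L ≠ ⊥ ↔ _
  rw [Submodule.ne_bot_iff]
  constructor
  · rintro ⟨f, hf, hne⟩
    refine ⟨_, (hker f).1 hf, fun h0 => hne ?_⟩
    rw [← Submodule.coe_eq_zero, Lp.eq_zero_iff_ae_eq_zero]
    filter_upwards [h0] with t ht
    exact (mul_eq_zero.1 ht).resolve_left (ofReal_add_I_ne_zero t)
  · rintro ⟨p, hp, hne⟩
    have hco := coeFn_toLp_div hp.mem.memLp
    have hH : (memLp_div_of_poisson hp.mem.memLp).toLp _ ∈ H2 := mem_H2_iff.2 (hp.mem.congr hco)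
    refine ⟨⟨_, hH⟩, (hker _).2 (hp.congr hco), fun h0 => hne ?_⟩
    have h1 := congrArg (Subtype.val) h0
    rw [Submodule.coe_zero, Lp.eq_zero_iff_ae_eq_zero] at h1
    filter_upwards [h1, hco] with t h2 h3
    rw [← h3, h2]; simp

/-! ### Rigidity of Hardy functions -/

/-- If a product of two Hardy functions agrees on the line with a multiple of the conjugate of
another such product, then it is constant. -/
theorem mul_eq_const_of_eq_conj {P Q R S : ℂ → ℂ} {p q r s : ℝ → ℂ} (hP : HardyPair P p)
    (hQ : HardyPair Q q) (hR : HardyPair R r) (hS : HardyPair S s) {d : ℂ}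
    (h : ∀ᵐ t : ℝ, p t * q t = d * conj (r t * s t)) :
    (∀ z ∈ UHP, P z * Q z = P I * Q I) ∧ ∀ᵐ t : ℝ, p t * q t = P I * Q I := by
  have h1 : ∀ z ∈ UHP, P z * Q z = P I * Q I := by
    intro z hz
    refine eq_const_of_eq_conj (F := fun z => P z * Q z) (G := fun z => conj d * (R z * S z))
      (hP.analytic.mul hQ.analytic) ((hR.analytic.mul hS.analytic).const_mul _) (fun z hz => ?_) hz
    rw [← hP.pext_mul hQ hz, pext_congr h, pext_const_mul, pext_conj, hR.pext_mul hS hz,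
      map_mul (starRingEnd ℂ) (conj d), conj_conj]
  refine ⟨h1, ?_⟩
  filter_upwards [hP.radial, hQ.radial] with t hp hq
  refine tendsto_nhds_unique (hp.mul hq) (tendsto_const_nhds.congr' ?_)
  filter_upwards [self_mem_nhdsWithin] with y hy
  exact (h1 _ (ofReal_add_mul_I_mem hy)).symm

/-- An inner function of modulus one at `i` is constant. -/
theorem InnerFunction.bd_eq_const (θ : InnerFunction) (h : ‖θ.toFun I‖ = 1) :
    ∀ᵐ t : ℝ, θ.bd t = θ.toFun I := by
  set c := θ.toFun I with hc
  have hcc : conj c * c = 1 := by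
    rw [← normSq_eq_conj_mul_self, normSq_eq_norm_sq, h]; simp
  have hi : Integrable (fun t => 1 - conj c * θ.bd t) ϖ :=
    (integrable_const _).sub (θ.hardyPair.integrable.const_mul _)
  have h0 : ∫ t, (1 - conj c * θ.bd t).re ∂ϖ = 0 := by
    have h1 := θ.hardyPair.eq_pext I I_mem_UHP
    rw [pext_I, ← hc] at h1
    have h2 := integral_re (𝕜 := ℂ) hi
    simp only [RCLike.re_eq_complex_re] at h2
    rw [h2, integral_sub (integrable_const _) (θ.hardyPair.integrable.const_mul _),
      integral_const_mul, ← h1, hcc]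
    simp
  have hn : ∀ᵐ t : ℝ, ‖conj c * θ.bd t‖ = 1 := by
    filter_upwards [θ.norm_bd] with t ht
    rw [norm_mul, RCLike.norm_conj, h, ht, one_mul]
  have h2 := (integral_eq_zero_iff_of_nonneg_ae (by
    rw [EventuallyLE, ae_poissonMeasure]
    filter_upwards [hn] with t ht
    have := re_le_norm (conj c * θ.bd t)
    simp only [Pi.zero_apply, RCLike.re_eq_complex_re, sub_re, one_re]
    linarith) hi.re).1 h0
  rw [EventuallyEq, ae_poissonMeasure] at h2
  filter_upwards [h2, hn] with t h3 h4
  have h5 : (conj c * θ.bd t).re = 1 := by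
    simp only [Pi.zero_apply, RCLike.re_eq_complex_re, sub_re, one_re] at h3
    linarith
  have h6 : conj c * θ.bd t = 1 := by
    have h7 := normSq_eq_norm_sq (conj c * θ.bd t)
    rw [h4, normSq_apply, h5] at h7
    refine Complex.ext h5 ?_
    rw [one_im]
    nlinarith
  calc θ.bd t = (conj c * c) * θ.bd t := by rw [hcc, one_mul]
    _ = c * (conj c * θ.bd t) := by ring
    _ = c := by rw [h6, mul_one]

/-- Division by the Blaschke factor of `i`. -/
theorem HardyPair.inHardy_conj_zeta_mul {F : ℂ → ℂ} {f : ℝ → ℂ} (hF : HardyPair F f)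
    (h0 : F I = 0) : InHardy fun t => conj (zeta t) * f t := by
  have hm : MemLp (fun t => conj (zeta t) * f t) 2 ϖ := by
    refine hF.memLp.of_le ((continuous_conj.comp
      continuous_zeta).aestronglyMeasurable.mul hF.memLp.1) (Eventually.of_forall fun t => ?_)
    rw [norm_mul, RCLike.norm_conj, norm_zeta, one_mul]
  refine ⟨_, HardyPair.of_cint hm fun z hz => ?_⟩
  have hz' : (conj z).im ≠ 0 := by simpa using (im_pos_of_mem hz).ne'
  have hzI : conj z - I ≠ 0 := fun h => by
    have h1 := congrArg Complex.im h
    have h2 := im_pos_of_mem hz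
    simp at h1
    linarith
  have h1 : ∀ t : ℝ, cker (conj z) t * (conj (zeta t) * f t) =
      (1 + 2 * I / (conj z - I)) * (cker (conj z) t * f t) - 2 * I / (conj z - I) * f t := by
    intro t
    have h2 := ofReal_sub_ne_zero hz' t
    have h3 := ofReal_sub_I_ne_zero t
    rw [zeta, map_div₀, conj_ofReal_add_I, conj_ofReal_sub_I, cker]
    field_simp
    ring
  rw [cint]
  simp_rw [h1]
  rw [integral_sub ((integrable_cker_mul hz' hF.integrable).const_mul _)
    (hF.integrable.const_mul _), integral_const_mul, integral_const_mul]
  have h2 := hF.cint_conj hz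
  have h3 := hF.eq_pext I I_mem_UHP
  rw [pext_I, h0] at h3
  rw [cint] at h2
  rw [h2, ← h3, mul_zero, mul_zero, sub_zero]

theorem zeta_mul_conj (t : ℝ) : zeta t * conj (zeta t) = 1 := by
  rw [mul_conj, normSq_eq_norm_sq, norm_zeta]; simp

theorem InnerFunction.bd_mul_conj (θ : InnerFunction) : ∀ᵐ t : ℝ, θ.bd t * conj (θ.bd t) = 1 := by
  filter_upwards [θ.norm_bd] with t ht
  rw [mul_conj, normSq_eq_norm_sq, ht]; simp

/-- The model space of a constant inner function is trivial. -/
theorem CoHardy.eq_zero_of_norm_eq_one {θ : InnerFunction} (h : ‖θ.toFun I‖ = 1) {p : ℝ → ℂ}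
    (hp : CoHardy θ.bd p) : p =ᵐ[volume] 0 := by
  obtain ⟨P, hP⟩ := hp.mem
  obtain ⟨R, hR⟩ := hp.mem_dual
  have hζR : HardyPair _ fun t => zeta t * (conj (zeta t) * (θ.bd t * conj (p t))) :=
    hardyPair_zeta.mul hR (hR.memLp.of_le (hardyPair_zeta.memLp.1.mul hR.memLp.1)
      (Eventually.of_forall fun t => by rw [norm_mul, norm_zeta, one_mul]))
  have h1 := hP.pext_mul hζR I_mem_UHP
  rw [sub_self, zero_div, zero_mul, mul_zero, pext_I] at h1
  have h2 : ∫ t, p t * (zeta t * (conj (zeta t) * (θ.bd t * conj (p t)))) ∂ϖ =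
      θ.toFun I * ((∫ t, ‖p t‖ ^ 2 ∂ϖ : ℝ) : ℂ) := by
    have h3 := integral_ofReal (𝕜 := ℂ) (μ := ϖ) (f := fun t => ‖p t‖ ^ 2)
    simp only [coe_algebraMap] at h3
    rw [← h3, ← integral_const_mul]
    refine integral_congr_ae ?_
    rw [EventuallyEq, ae_poissonMeasure]
    filter_upwards [θ.bd_eq_const h] with t ht
    rw [← mul_assoc (zeta t), zeta_mul_conj, one_mul, ht, mul_left_comm, mul_conj,
      normSq_eq_norm_sq]
  rw [h2] at h1
  have hne : θ.toFun I ≠ 0 := by rw [← norm_ne_zero_iff, h]; exact one_ne_zero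
  have h3 := ofReal_eq_zero.1 ((mul_eq_zero.1 h1).resolve_left hne)
  have h4 := (integral_eq_zero_iff_of_nonneg (fun t => sq_nonneg _)
    ((memLp_two_iff_integrable_sq_norm hP.memLp.1).1 hP.memLp)).1 h3
  rw [EventuallyEq, ae_poissonMeasure] at h4
  filter_upwards [h4] with t ht
  simpa using ht

theorem CoHardy.inner_mul {θ L : InnerFunction} {p : ℝ → ℂ}
    (hp : CoHardy (fun t => θ.bd t * conj (L.bd t)) p) : CoHardy θ.bd fun t => L.bd t * p t := by
  refine ⟨hp.mem.inner_mul L, hp.mem_dual.congr (Eventually.of_forall fun t => ?_)⟩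
  simp only [map_mul]; ring

/-- Only nonconstant inner functions have a nonempty dominance set. -/
theorem norm_lt_one_of_mem_dominanceSet {θ L : InnerFunction} (h : L ∈ dominanceSet θ) :
    ‖θ.toFun I‖ < 1 := by
  refine lt_of_le_of_ne (θ.norm_le_one I_mem_UHP) fun h1 => ?_
  obtain ⟨p, hp, hne⟩ := mem_dominanceSet_iff.1 h
  refine hne ?_
  filter_upwards [hp.inner_mul.eq_zero_of_norm_eq_one h1, L.norm_bd] with t h2 h3
  refine (mul_eq_zero.1 h2).resolve_left (norm_ne_zero_iff.1 ?_)
  rw [h3]; exact one_ne_zero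

/-! ### The reproducing kernel of the model space at `i` -/

/-- The boundary values of `1 - conj θ(i) θ`, which corresponds to the reproducing kernel of the
model space of `θ` at the point `i`. -/
def modelKer (θ : InnerFunction) (t : ℝ) : ℂ := 1 - conj (θ.toFun I) * θ.bd t

theorem hardyPair_modelKer (θ : InnerFunction) :
    HardyPair (fun z => 1 + -conj (θ.toFun I) * θ.toFun z) (modelKer θ) :=
  ((HardyPair.const 1).add (θ.hardyPair.const_mul _)).congr (fun _ _ => rfl)
    (Eventually.of_forall fun t => by rw [modelKer]; ring)

theorem norm_modelKer_le (θ : InnerFunction) : ∀ᵐ t : ℝ, ‖modelKer θ t‖ ≤ 2 := by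
  filter_upwards [θ.norm_bd] with t ht
  refine (norm_sub_le _ _).trans ?_
  rw [norm_one, norm_mul, RCLike.norm_conj, ht, mul_one]
  linarith [θ.norm_le_one I_mem_UHP]

theorem le_norm_one_add (a b : ℂ) (hb : ‖b‖ ≤ 1) : 1 - ‖a‖ ≤ ‖1 + -conj a * b‖ := by
  have h1 : ‖conj a * b‖ ≤ ‖a‖ := by
    rw [norm_mul, RCLike.norm_conj]
    exact mul_le_of_le_one_right (norm_nonneg _) hb
  have h2 := norm_sub_norm_le (1 : ℂ) (conj a * b)
  rw [norm_one] at h2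
  rw [neg_mul, ← sub_eq_add_neg]
  linarith

theorem le_norm_modelKer (θ : InnerFunction) :
    ∀ᵐ t : ℝ, 1 - ‖θ.toFun I‖ ≤ ‖modelKer θ t‖ := by
  filter_upwards [θ.norm_bd] with t ht
  have := le_norm_one_add (θ.toFun I) (θ.bd t) ht.le
  rwa [neg_mul, ← sub_eq_add_neg] at this

theorem modelKer_ne_zero {θ : InnerFunction} (h : ‖θ.toFun I‖ < 1) :
    ∀ᵐ t : ℝ, modelKer θ t ≠ 0 := by
  filter_upwards [le_norm_modelKer θ] with t ht
  rw [← norm_pos_iff]; linarith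

theorem norm_modelKer_inv_le {θ : InnerFunction} (h : ‖θ.toFun I‖ < 1) :
    ∀ᵐ t : ℝ, ‖(modelKer θ t)⁻¹‖ ≤ (1 - ‖θ.toFun I‖)⁻¹ := by
  filter_upwards [le_norm_modelKer θ] with t ht
  rw [norm_inv]
  exact inv_anti₀ (by linarith) ht

theorem inHardy_modelKer_inv {θ : InnerFunction} (h : ‖θ.toFun I‖ < 1) :
    InHardy fun t => (modelKer θ t)⁻¹ := by
  have hb : ∀ z ∈ UHP, 1 - ‖θ.toFun I‖ ≤ ‖1 + -conj (θ.toFun I) * θ.toFun z‖ := fun z hz =>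
    le_norm_one_add _ _ (θ.norm_le_one hz)
  have hne : ∀ z ∈ UHP, 1 + -conj (θ.toFun I) * θ.toFun z ≠ 0 := fun z hz => by
    rw [← norm_pos_iff]; linarith [hb z hz]
  refine ⟨_, hardyPair_of_bounded
    ((hardyPair_modelKer θ).analytic.inv hne) (C := (1 - ‖θ.toFun I‖)⁻¹) (fun z hz => ?_) ?_⟩
  · rw [Pi.inv_apply, norm_inv]
    exact inv_anti₀ (by linarith) (hb z hz)
  · filter_upwards [(hardyPair_modelKer θ).radial, modelKer_ne_zero h] with t h1 h2
    exact h1.inv₀ h2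

theorem mul_conj_modelKer (θ : InnerFunction) :
    ∀ᵐ t : ℝ, θ.bd t * conj (modelKer θ t) = θ.bd t - θ.toFun I := by
  filter_upwards [θ.bd_mul_conj] with t ht
  rw [modelKer, map_sub, map_one, map_mul, conj_conj]
  linear_combination (-θ.toFun I) * ht

theorem coHardy_modelKer (θ : InnerFunction) : CoHardy θ.bd (modelKer θ) := by
  refine ⟨⟨_, hardyPair_modelKer θ⟩, ?_⟩
  have h1 := (θ.hardyPair.add (HardyPair.const (-θ.toFun I))).inHardy_conj_zeta_mul
    (add_neg_cancel _)
  refine h1.congr ?_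
  filter_upwards [mul_conj_modelKer θ] with t ht
  rw [ht, sub_eq_add_neg]

/-- A distinguished element of the dominance set of a nonconstant inner function `θ`: the inner
function `L = (θ - θ(i)) / (ζ (1 - conj θ(i) θ))`, for which the kernel of the Toeplitz operator
with symbol `θ̄ L` contains the reproducing kernel. -/
theorem exists_inner_modelKer {θ : InnerFunction} (h : ‖θ.toFun I‖ < 1) :
    ∃ L : InnerFunction, L ∈ dominanceSet θ ∧ ∀ᵐ t : ℝ,
      conj (zeta t) * (θ.bd t * (conj (L.bd t) * conj (modelKer θ t))) = modelKer θ t := by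
  have hk := coHardy_modelKer θ
  obtain ⟨S, hS⟩ := (inHardy_modelKer_inv h).mul_of_bounded hk.mem_dual (norm_modelKer_inv_le h)
  have hn : ∀ᵐ t : ℝ, ‖(modelKer θ t)⁻¹ *
      (conj (zeta t) * (θ.bd t * conj (modelKer θ t)))‖ = 1 := by
    filter_upwards [modelKer_ne_zero h, θ.norm_bd] with t h1 h2
    rw [norm_mul, norm_mul, norm_mul, norm_inv, RCLike.norm_conj, RCLike.norm_conj, norm_zeta, h2,
      one_mul, one_mul]
    exact inv_mul_cancel₀ (norm_ne_zero_iff.2 h1)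
  have hid : ∀ᵐ t : ℝ, conj (zeta t) *
      (θ.bd t * (conj ((hS.toInner hn).bd t) * conj (modelKer θ t))) = modelKer θ t := by
    filter_upwards [hS.toInner_bd hn, modelKer_ne_zero h, θ.bd_mul_conj] with t h1 h2 h3
    have h4 := zeta_mul_conj t
    have h5 : conj (modelKer θ t) ≠ 0 := by simpa using h2
    rw [h1]
    simp only [map_mul, map_inv₀, conj_conj]
    have h6 := inv_mul_cancel₀ h5
    linear_combination (zeta t * conj (zeta t) * (θ.bd t * conj (θ.bd t)) * modelKer θ t) * h6 +
      (modelKer θ t * (θ.bd t * conj (θ.bd t))) * h4 + modelKer θ t * h3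
  refine ⟨hS.toInner hn, ?_, hid⟩
  rw [mem_dominanceSet_iff]
  refine ⟨modelKer θ, ⟨hk.mem, hk.mem.congr ?_⟩, fun h0 => ?_⟩
  · filter_upwards [hid] with t ht
    rw [mul_assoc, ht]
  · obtain ⟨t, h1, h2⟩ := ((modelKer_ne_zero h).and h0).exists
    exact h1 h2

/-! ### Outer factors of elements of Toeplitz kernels -/

theorem inHardy_outerBd {v : ℝ → ℝ} (hv : Integrable v ϖ) (h : MemLp (outerBd v) 2 ϖ) :
    InHardy (outerBd v) := by
  have h1 : InHardy fun t => outerBd v t * 1 :=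
    InHardy.mul_outer ⟨_, HardyPair.const 1⟩ hv (by simpa using h)
  simpa using h1

theorem InHardy.factorization {f : ℝ → ℂ} (hf : InHardy f) (hne : ¬ f =ᵐ[volume] 0) :
    (∀ᵐ t : ℝ, f t ≠ 0) ∧ Integrable (fun t => Real.log ‖f t‖) ϖ ∧
      ∃ M : InnerFunction, f =ᵐ[volume] fun t => M.bd t * outerBd (fun t => Real.log ‖f t‖) t := by
  obtain ⟨F, hF⟩ := hf
  obtain ⟨z, hz, hFz⟩ : ∃ z ∈ UHP, F z ≠ 0 := by
    by_contra! hcon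
    exact hne (hF.ae_eq_of_eq (HardyPair.const 0) hcon)
  exact ⟨(hF.integrable_log hz hFz).1, (hF.integrable_log hz hFz).2,
    hF.exists_factorization hz hFz⟩

/-- The product of two inner functions. -/
theorem InnerFunction.exists_mul (L M : InnerFunction) :
    ∃ N : InnerFunction, ∀ᵐ t : ℝ, N.bd t = L.bd t * M.bd t := by
  obtain ⟨S, hS⟩ := InHardy.inner_mul ⟨_, M.hardyPair⟩ L
  have hn : ∀ᵐ t : ℝ, ‖L.bd t * M.bd t‖ = 1 := by
    filter_upwards [L.norm_bd, M.norm_bd] with t h1 h2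
    rw [norm_mul, h1, h2, one_mul]
  exact ⟨_, hS.toInner_bd hn⟩

/-- The inner factors of `p` and of its dual `ζ̄ U p̄` can be moved to the symbol: the outer factor
`o` of `p` satisfies `ζ̄ U M̄ ō = o`, where `M` is the product of the two inner factors. -/
theorem CoHardy.exists_outer {U p : ℝ → ℂ} (hU : ∀ᵐ t : ℝ, ‖U t‖ = 1) (hp : CoHardy U p)
    (hne : ¬ p =ᵐ[volume] 0) : (∀ᵐ t : ℝ, p t ≠ 0) ∧ Integrable (fun t => Real.log ‖p t‖) ϖ ∧
      InHardy (outerBd fun t => Real.log ‖p t‖) ∧ ∃ M : InnerFunction, ∀ᵐ t : ℝ,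
        conj (zeta t) * (U t * (conj (M.bd t) * conj (outerBd (fun t => Real.log ‖p t‖) t))) =
          outerBd (fun t => Real.log ‖p t‖) t := by
  obtain ⟨h0, hlog, M₁, hM₁⟩ := hp.mem.factorization hne
  have hnorm : ∀ᵐ t : ℝ, ‖conj (zeta t) * (U t * conj (p t))‖ = ‖p t‖ := by
    filter_upwards [hU] with t ht
    rw [norm_mul, norm_mul, RCLike.norm_conj, RCLike.norm_conj, norm_zeta, ht, one_mul, one_mul]
  obtain ⟨-, -, M₂, hM₂⟩ := hp.mem_dual.factorization fun hz => hne (by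
    filter_upwards [hz, hnorm] with t h1 h2
    rw [h1, Pi.zero_apply, norm_zero] at h2
    exact norm_eq_zero.1 h2.symm)
  have hoeq : outerBd (fun t => Real.log ‖conj (zeta t) * (U t * conj (p t))‖) =
      outerBd (fun t => Real.log ‖p t‖) := by
    unfold outerBd
    rw [outer_congr]
    filter_upwards [hnorm] with t ht
    rw [ht]
  rw [hoeq] at hM₂
  set o := outerBd (fun t => Real.log ‖p t‖) with ho
  have hom : MemLp o 2 ϖ := by
    refine hp.mem.memLp.of_le (aestronglyMeasurable_poisson.2 (outerBd_spec hlog).2.2) ?_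
    rw [ae_poissonMeasure]
    filter_upwards [(outerBd_spec hlog).2.1, h0] with t h1 h2
    rw [h1, Real.exp_log (norm_pos_iff.2 h2)]
  obtain ⟨M, hM⟩ := InnerFunction.exists_mul M₁ M₂
  refine ⟨h0, hlog, inHardy_outerBd hlog hom, M, ?_⟩
  filter_upwards [hM, hM₁, hM₂, M₂.bd_mul_conj] with t h1 h2 h3 h4
  rw [h2, map_mul] at h3
  rw [h1, map_mul]
  linear_combination conj (M₂.bd t) * h3 + o t * h4

/-! ### The multiplier of two Toeplitz equivalent inner functions -/

/-- If the inner function `M` times a Hardy function is the conjugate of a Hardy function and both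
Hardy functions have the same modulus, then `M` is constant. -/
theorem InnerFunction.norm_eq_one_of_mul_eq_conj (M : InnerFunction) {x y : ℝ → ℂ} (hx : InHardy x)
    (hy : InHardy y) (hne : ¬ x =ᵐ[volume] 0) (h : ∀ᵐ t : ℝ, M.bd t * x t = conj (y t)) :
    ‖M.toFun I‖ = 1 := by
  obtain ⟨X, hX⟩ := hx
  obtain ⟨Y, hY⟩ := hy
  obtain ⟨-, h2⟩ := mul_eq_const_of_eq_conj M.hardyPair hX (HardyPair.const 1) hY (d := 1)
    (by simpa using h)
  set k := M.toFun I * X I with hk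
  have hxk : ∀ᵐ t : ℝ, ‖x t‖ = ‖k‖ := by
    filter_upwards [h2, M.norm_bd] with t h3 h4
    rw [← h3, norm_mul, h4, one_mul]
  have hk0 : 0 < ‖k‖ := by
    rw [norm_pos_iff]
    intro h0
    refine hne ?_
    filter_upwards [hxk] with t ht
    rw [h0, norm_zero] at ht
    exact norm_eq_zero.1 ht
  refine le_antisymm (M.norm_le_one I_mem_UHP) ?_
  have h3 := hX.norm_le (hxk.mono fun _ h => h.le) I_mem_UHP
  have h4 : ‖k‖ ≤ ‖M.toFun I‖ * ‖k‖ := by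
    conv_lhs => rw [hk, norm_mul]
    gcongr
  exact (le_mul_iff_one_le_left hk0).1 h4

/-- For Toeplitz equivalent `A`, `B` there is a Hardy function `h` with `h̄ / h = c A B̄`. It is the
quotient of the outer part of an element of a Toeplitz kernel for `B` by the reproducing kernel
of the model space of `A`. -/
theorem exists_conj_eq_of_dominanceSet_eq {A B : InnerFunction}
    (hAB : dominanceSet A = dominanceSet B) (hA : ‖A.toFun I‖ < 1) :
    ∃ h : ℝ → ℂ, InHardy h ∧ (∀ᵐ t : ℝ, h t ≠ 0) ∧ ∃ c : ℂ, ‖c‖ = 1 ∧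
      ∀ᵐ t : ℝ, c * A.bd t * h t = B.bd t * conj (h t) := by
  obtain ⟨L, hLA, hL⟩ := exists_inner_modelKer hA
  have hLB : L ∈ dominanceSet B := hAB ▸ hLA
  obtain ⟨p, hp, hp0⟩ := mem_dominanceSet_iff.1 hLB
  have hU : ∀ᵐ t : ℝ, ‖B.bd t * conj (L.bd t)‖ = 1 := by
    filter_upwards [B.norm_bd, L.norm_bd] with t h1 h2
    rw [norm_mul, RCLike.norm_conj, h1, h2, one_mul]
  obtain ⟨-, hlog, ho, M, hM⟩ := hp.exists_outer hU hp0
  have ho0 := outerBd_ne_zero hlog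
  set o := outerBd fun t => Real.log ‖p t‖
  obtain ⟨N, hN⟩ := InnerFunction.exists_mul L M
  have hNB : N ∈ dominanceSet B := by
    rw [mem_dominanceSet_iff]
    refine ⟨o, ⟨ho, ho.congr ?_⟩, fun h0 => ?_⟩
    · filter_upwards [hN, hM] with t h1 h2
      rw [h1, map_mul]
      linear_combination h2
    · obtain ⟨t, h1, h2⟩ := (ho0.and h0).exists
      exact h1 h2
  have hNA : N ∈ dominanceSet A := hAB ▸ hNB
  obtain ⟨q, hq, hq0⟩ := mem_dominanceSet_iff.1 hNA
  have hg := inHardy_modelKer_inv hA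
  have hgb := norm_modelKer_inv_le hA
  have hg0 := modelKer_ne_zero hA
  have hM1 : ‖M.toFun I‖ = 1 := by
    refine M.norm_eq_one_of_mul_eq_conj (hg.mul_of_bounded hq.mem hgb)
      (hg.mul_of_bounded hq.mem_dual hgb) (fun h0 => hq0 ?_) ?_
    · filter_upwards [h0, hg0] with t h1 h2
      exact (mul_eq_zero.1 h1).resolve_left (inv_ne_zero h2)
    · filter_upwards [hN, hL, hg0] with t h1 h2 h3
      have h4 : conj (modelKer A t) ≠ 0 := by simpa using h3
      have h5 := congrArg conj h2
      rw [h1]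
      simp only [map_mul, map_inv₀, conj_conj] at h5 ⊢
      field_simp
      linear_combination -M.bd t * q t * h5
  refine ⟨fun t => (modelKer A t)⁻¹ * o t, hg.mul_of_bounded ho hgb, ?_, M.toFun I, hM1, ?_⟩
  · filter_upwards [hg0, ho0] with t h1 h2
    exact mul_ne_zero (inv_ne_zero h1) h2
  · filter_upwards [M.bd_eq_const hM1, M.bd_mul_conj, hM, hL, hg0] with t h1 h2 h3 h4 h5
    have h6 : conj (modelKer A t) ≠ 0 := by simpa using h5
    rw [h1] at h2 h3
    simp only [map_mul, map_inv₀]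
    field_simp
    linear_combination -M.toFun I * A.bd t * conj (modelKer A t) * h3 +
      B.bd t * conj (o t) * M.toFun I * conj (M.toFun I) * h4 +
      B.bd t * modelKer A t * conj (o t) * h2

theorem memLp_log_norm {h : ℝ → ℂ} (h1 : MemLp h 2 ϖ) (h2 : MemLp (fun t => (h t)⁻¹) 2 ϖ) :
    MemLp (fun t => Real.log ‖h t‖) 2 ϖ := by
  refine (h1.norm.add h2.norm).of_le
    (Real.measurable_log.comp_aemeasurable h1.1.norm.aemeasurable).aestronglyMeasurable
    (Eventually.of_forall fun t => ?_)
  have h3 : 0 ≤ ‖h t‖ + ‖h t‖⁻¹ := by positivity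
  rw [Pi.add_apply, norm_inv, Real.norm_of_nonneg h3, Real.norm_eq_abs]
  rcases (norm_nonneg (h t)).eq_or_lt with h0 | h0
  · rw [← h0]; simp
  · have h4 := Real.log_le_sub_one_of_pos h0
    have h5 := Real.log_le_sub_one_of_pos (inv_pos.2 h0)
    rw [Real.log_inv] at h5
    have h6 := inv_pos.2 h0
    rw [abs_le]
    constructor <;> linarith

/-- For nonconstant Toeplitz equivalent `A`, `B` the function `h` with `h̄ / h = c A B̄` can be
chosen outer, with `h` and `1 / h` in the Hardy class: the product of `h` and of its counterpart for
`(B, A)` is a constant. -/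
theorem exists_outer_of_dominanceSet_eq {A B : InnerFunction}
    (hAB : dominanceSet A = dominanceSet B) (hA : ‖A.toFun I‖ < 1) (hB : ‖B.toFun I‖ < 1) :
    ∃ u : ℝ → ℝ, MemLp u 2 ϖ ∧ InHardy (outerBd u) ∧ InHardy (outerBd fun t => -u t) ∧
      ∃ c : ℂ, ‖c‖ = 1 ∧ ∀ᵐ t : ℝ, c * A.bd t * outerBd u t = B.bd t * conj (outerBd u t) := by
  obtain ⟨h, hh, hh0, c, hc, hrel⟩ := exists_conj_eq_of_dominanceSet_eq hAB hA
  obtain ⟨h', hh', hh0', c', hc', hrel'⟩ := exists_conj_eq_of_dominanceSet_eq hAB.symm hB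
  have hcc : conj c * c = 1 := by
    rw [← normSq_eq_conj_mul_self, normSq_eq_norm_sq, hc]; simp
  have hcc' : conj c' * c' = 1 := by
    rw [← normSq_eq_conj_mul_self, normSq_eq_norm_sq, hc']; simp
  obtain ⟨K, hK⟩ : ∃ K : ℂ, ∀ᵐ t : ℝ, h t * h' t = K := by
    obtain ⟨H, hH⟩ := hh
    obtain ⟨H', hH'⟩ := hh'
    refine ⟨_, (mul_eq_const_of_eq_conj hH hH' hH hH' (d := conj c * conj c') ?_).2⟩
    filter_upwards [hrel, hrel', A.bd_mul_conj, B.bd_mul_conj] with t h1 h2 h3 h4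
    rw [map_mul]
    have h5 : A.bd t ≠ 0 := fun h0 => by simp [h0] at h3
    have h6 : B.bd t ≠ 0 := fun h0 => by simp [h0] at h4
    refine mul_left_cancel₀ (mul_ne_zero h5 h6) ?_
    linear_combination conj c * conj c' * (conj (h' t) * A.bd t * h1 +
      c * A.bd t * h t * h2) - A.bd t * B.bd t * h t * h' t * (hcc + conj c * c * hcc')
  have hK0 : K ≠ 0 := by
    obtain ⟨t, h1, h2, h3⟩ := (hK.and (hh0.and hh0')).exists
    rw [← h1]; exact mul_ne_zero h2 h3
  have hinv : InHardy fun t => (h t)⁻¹ := by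
    refine (hh'.const_mul K⁻¹).congr ?_
    filter_upwards [hK, hh0, hh0'] with t h1 h2 h3
    rw [← h1]
    field_simp
  have hne : ∀ {f : ℝ → ℂ}, (∀ᵐ t : ℝ, f t ≠ 0) → ¬ f =ᵐ[volume] 0 := fun hf h0 => by
    obtain ⟨t, h1, h2⟩ := (hf.and h0).exists
    exact h1 h2
  obtain ⟨-, hlog, m, hm⟩ := hh.factorization (hne hh0)
  obtain ⟨-, -, m', hm'⟩ := hinv.factorization (hne (hh0.mono fun t ht => inv_ne_zero ht))
  have hlogi : (fun t => Real.log ‖(h t)⁻¹‖) = fun t => -Real.log ‖h t‖ := by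
    ext t; rw [norm_inv, Real.log_inv]
  rw [hlogi] at hm'
  set u : ℝ → ℝ := fun t => Real.log ‖h t‖ with hu
  have hm1 : ∀ᵐ t : ℝ, m.bd t * m'.bd t = 1 := by
    filter_upwards [hm, hm', outerBd_neg hlog, outerBd_ne_zero hlog, hh0] with t h1 h2 h3 h4 h5
    rw [h3] at h2
    have h6 : (m.bd t * outerBd u t) * (m'.bd t * (outerBd u t)⁻¹) = 1 := by
      rw [← h1, ← h2, mul_inv_cancel₀ h5]
    field_simp at h6
    exact h6
  have hmI : ‖m.toFun I‖ = 1 := by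
    have h1 := m.hardyPair.pext_mul m'.hardyPair I_mem_UHP
    rw [pext_congr (g := fun _ => 1) hm1, pext_const I_mem_UHP] at h1
    have h2 := congrArg norm h1
    rw [norm_one, norm_mul] at h2
    have h3 := m.norm_le_one I_mem_UHP
    have h4 := m'.norm_le_one I_mem_UHP
    refine le_antisymm h3 ?_
    rw [h2]
    exact mul_le_of_le_one_right (norm_nonneg _) h4
  set m₀ := m.toFun I with hm₀
  have hmm : conj m₀ * m₀ = 1 := by
    rw [← normSq_eq_conj_mul_self, normSq_eq_norm_sq, hmI]; simp
  have hm₀0 : m₀ ≠ 0 := by rw [← norm_ne_zero_iff, hmI]; exact one_ne_zero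
  have hho : ∀ᵐ t : ℝ, h t = m₀ * outerBd u t := by
    filter_upwards [hm, m.bd_eq_const hmI] with t h1 h2
    rw [hm₀, ← h2]; exact h1
  refine ⟨u, memLp_log_norm hh.memLp hinv.memLp, ?_, ?_, c * m₀ ^ 2, ?_, ?_⟩
  · refine (hh.const_mul m₀⁻¹).congr ?_
    filter_upwards [hho] with t h1
    rw [h1]
    field_simp
  · refine (hinv.const_mul m₀).congr ?_
    filter_upwards [hho, outerBd_neg hlog] with t h1 h2
    rw [h2, h1]
    field_simp
  · rw [norm_mul, norm_pow, hc, hmI]; norm_num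
  · filter_upwards [hho, hrel] with t h1 h2
    rw [h1, map_mul] at h2
    linear_combination m₀ * h2 + B.bd t * conj (outerBd u t) * hmm

/-! ### The multiplier property -/

theorem SmallTail.congr_norm {p q : ℝ → ℂ} (hp : SmallTail p) (h : ∀ᵐ t : ℝ, ‖q t‖ = ‖p t‖) :
    SmallTail q := by
  intro δ hδ
  obtain ⟨s₀, h0, hs⟩ := hp δ hδ
  refine ⟨s₀, h0, fun s hs' => le_trans (le_of_eq (measure_congr ?_)) (hs s hs')⟩
  rw [← ae_poissonMeasure] at h
  filter_upwards [h] with t ht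
  change (s < ‖q t‖) = (s < ‖p t‖)
  rw [ht]

/-- The outer function `o` with `ō / o = c A B̄` multiplies the model space of `A` into that of `B`.
The only question is square summability of `o p`. A generic multiple of the reproducing kernel of
the model space of `B` is added to `o p`, so that the reciprocal of the sum is in weak `L²`. By
the inclusion of dominance sets the sum is the quotient of a Hardy function and a function `Q` to
which the reflection principle `outer_mul_eq_conj` applies, and `Q` is constant. -/
theorem CoHardy.outerBd_mul {A B : InnerFunction} (hsub : dominanceSet A ⊆ dominanceSet B)
    (hB : ‖B.toFun I‖ < 1) {u : ℝ → ℝ} (hu : Integrable u ϖ)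
    (hou : InHardy (outerBd fun t => -u t)) {c : ℂ} (hc : ‖c‖ = 1)
    (hrel : ∀ᵐ t : ℝ, c * A.bd t * outerBd u t = B.bd t * conj (outerBd u t)) {p : ℝ → ℂ}
    (hp : CoHardy A.bd p) : CoHardy B.bd fun t => outerBd u t * p t := by
  have hcc : conj c * c = 1 := by
    rw [← normSq_eq_conj_mul_self, normSq_eq_norm_sq, hc]; simp
  have ho0 := outerBd_ne_zero hu
  have hom := aestronglyMeasurable_poisson.2 (outerBd_spec hu).2.2
  -- it suffices to prove square summability
  suffices hmem : MemLp (fun t => outerBd u t * p t) 2 ϖ by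
    have hmem' : MemLp (fun t => outerBd u t * (conj (zeta t) * (A.bd t * conj (p t)))) 2 ϖ := by
      refine hmem.of_le (hom.mul hp.mem_dual.memLp.1) ?_
      rw [ae_poissonMeasure]
      filter_upwards [A.norm_bd] with t ht
      rw [norm_mul, norm_mul, norm_mul, RCLike.norm_conj, RCLike.norm_conj, norm_zeta, ht, norm_mul,
        one_mul, one_mul]
    refine ⟨hp.mem.mul_outer hu hmem, ((hp.mem_dual.mul_outer hu hmem').const_mul c).congr ?_⟩
    filter_upwards [hrel] with t ht
    rw [map_mul]
    linear_combination -conj (zeta t) * conj (p t) * ht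
  set g := modelKer B with hg
  have hg0 : ∀ᵐ t : ℝ, g t ≠ 0 := modelKer_ne_zero hB
  have hgK := coHardy_modelKer B
  have hginv := inHardy_modelKer_inv hB
  have hgb := norm_modelKer_le B
  have hou' := outerBd_neg hu
  -- the reproducing kernel divided by the outer function
  have hgo : CoHardy A.bd fun t => g t * outerBd (fun t => -u t) t := by
    refine ⟨hgK.mem.mul_of_bounded hou hgb, ((hgK.mem_dual.mul_of_bounded hou (C := 2) ?_).const_mul
      (conj c)).congr ?_⟩
    · filter_upwards [hgb, B.norm_bd] with t h1 h2
      rw [norm_mul, norm_mul, RCLike.norm_conj, RCLike.norm_conj, norm_zeta, h2, one_mul, one_mul]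
      exact h1
    · filter_upwards [hrel, hou', ho0] with t h1 h2 h3
      have h4 : conj (outerBd u t) ≠ 0 := by simpa using h3
      rw [h2, map_mul, map_inv₀]
      field_simp
      linear_combination conj (zeta t) * conj (g t) * (conj c * h1 - A.bd t * outerBd u t * hcc)
  have hx : AEMeasurable (fun t => (g t)⁻¹ * (outerBd u t * p t)) ϖ :=
    (hginv.memLp.1.mul (hom.mul hp.mem.memLp.1)).aemeasurable
  obtain ⟨ξ, K, hξ⟩ := exists_shift_small hx
  set p₁ : ℝ → ℂ := fun t => p t + ξ * (g t * outerBd (fun t => -u t) t) with hp₁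
  have hp₁H : CoHardy A.bd p₁ := hp.add (hgo.const_mul ξ)
  have hop₁ : ∀ᵐ t : ℝ, outerBd u t * p₁ t = outerBd u t * p t + ξ * g t := by
    filter_upwards [hou', ho0] with t h1 h2
    simp only [hp₁]
    rw [h1]
    field_simp
  have hgoal : MemLp (fun t => outerBd u t * p₁ t) 2 ϖ →
      MemLp (fun t => outerBd u t * p t) 2 ϖ := by
    intro h
    refine (memLp_congr_ae ?_).1 (h.sub (hgK.mem.memLp.const_mul ξ))
    rw [EventuallyEq, ae_poissonMeasure]
    filter_upwards [hop₁] with t ht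
    rw [Pi.sub_apply, ht, add_sub_cancel_right]
  refine hgoal ?_
  by_cases hz : p₁ =ᵐ[volume] 0
  · refine (memLp_congr_ae ?_).1 (MemLp.zero' (ε := ℂ) (μ := ϖ) (p := 2))
    rw [EventuallyEq, ae_poissonMeasure]
    filter_upwards [hz] with t ht
    rw [ht]; simp
  obtain ⟨hp0, hlog, ho₁, M, hM⟩ := hp₁H.exists_outer A.norm_bd hz
  set v : ℝ → ℝ := fun t => Real.log ‖p₁ t‖ with hv
  have ho₁0 := outerBd_ne_zero hlog
  have hMA : M ∈ dominanceSet A := by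
    rw [mem_dominanceSet_iff]
    refine ⟨outerBd v, ⟨ho₁, ho₁.congr ?_⟩, fun h0 => ?_⟩
    · filter_upwards [hM] with t ht
      linear_combination ht
    · obtain ⟨t, h1, h2⟩ := (ho₁0.and h0).exists
      exact h1 h2
  obtain ⟨f, hf, hf0⟩ := mem_dominanceSet_iff.1 (hsub hMA)
  obtain ⟨F, hF⟩ := hf.mem
  obtain ⟨F', hF'⟩ := hf.mem_dual
  set w : ℝ → ℝ := fun t => -(u t + v t) with hw
  have hwi : Integrable w ϖ := (hu.add hlog).neg
  have hwbd : ∀ᵐ t : ℝ, outerBd w t = (outerBd u t * outerBd v t)⁻¹ := by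
    filter_upwards [outerBd_neg (hu.add hlog), outerBd_add hu hlog] with t h1 h2
    rw [← h2]; exact h1
  have heq : ∀ᵐ t : ℝ, conj c * (outerBd w t * f t) =
      conj (outerBd w t * (conj (zeta t) * (B.bd t * conj (M.bd t) * conj (f t)))) := by
    filter_upwards [hwbd, hrel, hM, ho0, ho₁0] with t h1 h2 h3 h4 h5
    have h7 : conj (outerBd u t) ≠ 0 := by simpa using h4
    have h8 : conj (outerBd v t) ≠ 0 := by simpa using h5
    have h9 := congrArg conj h2
    have h10 := congrArg conj h3
    rw [h1]
    simp only [map_mul, map_inv₀, conj_conj] at h9 h10 ⊢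
    field_simp
    linear_combination (zeta t * M.bd t * f t * outerBd v t) * h9 -
      (conj c * conj (outerBd u t) * f t) * h10
  have htail : SmallTail fun t => outerBd w t * f t := by
    have ha : MemLp (fun t => (g t)⁻¹ * f t) 2 ϖ :=
      (hginv.mul_of_bounded hf.mem (norm_modelKer_inv_le hB)).memLp
    refine (smallTail_mul (b := fun t => ((g t)⁻¹ * (outerBd u t * p t) + ξ)⁻¹) ha (K := K)
      fun s hs => ?_).congr_norm ?_
    · have h1 := hξ s⁻¹ (inv_pos.2 hs)
      rw [inv_pow, ← div_eq_mul_inv] at h1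
      refine (measure_mono fun t ht => ?_).trans h1
      have ht : s < ‖((g t)⁻¹ * (outerBd u t * p t) + ξ)⁻¹‖ := ht
      rw [norm_inv] at ht
      exact (lt_inv_comm₀ hs (inv_pos.1 (hs.trans ht))).1 ht
    · filter_upwards [hwbd, hg0, hop₁, (outerBd_spec hlog).2.1, hp0] with t h1 h2 h3 h4 h5
      have h6 : (g t)⁻¹ * (outerBd u t * p t) + ξ = (g t)⁻¹ * (outerBd u t * p₁ t) := by
        rw [h3]
        field_simp
      have h7 : ‖outerBd v t‖ = ‖p₁ t‖ := by rw [h4, hv, Real.exp_log (norm_pos_iff.2 h5)]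
      rw [h6, h1]
      simp only [norm_mul, norm_inv, h7]
      have h8 := norm_ne_zero_iff.2 h2
      field_simp
  have hrefl := fun z (hz : z ∈ UHP) =>
    outer_mul_eq_conj hF hF' hwi (c := conj c) (by rwa [RCLike.norm_conj]) heq htail hz
  have hdo := differentiableOn_outer hwi
  have hconst : ∀ z ∈ UHP, conj c * (outer w z * F z) = conj c * (outer w I * F I) := fun z hz =>
    eq_const_of_eq_conj (F := fun z => conj c * (outer w z * F z))
      (G := fun z => outer w z * F' z) ((hdo.mul hF.analytic).const_mul _) (hdo.mul hF'.analytic)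
      hrefl hz
  have hc0 : conj c ≠ 0 := fun h0 => by simp [h0] at hcc
  set κ := outer w I * F I with hκ
  have hbd : ∀ᵐ t : ℝ, outerBd w t * f t = κ := by
    filter_upwards [(outerBd_spec hwi).1, hF.radial] with t h1 h2
    refine tendsto_nhds_unique (h1.mul h2) (tendsto_const_nhds.congr' ?_)
    filter_upwards [self_mem_nhdsWithin] with y hy
    exact (mul_left_cancel₀ hc0 (hconst _ (ofReal_add_mul_I_mem hy))).symm
  have hfeq : ∀ᵐ t : ℝ, f t = κ * (outerBd u t * outerBd v t) := by
    filter_upwards [hbd, hwbd, ho0, ho₁0] with t h1 h2 h3 h4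
    rw [← h1, h2]
    field_simp
  have hκ0 : κ ≠ 0 := fun h0 => hf0 (by
    filter_upwards [hfeq] with t ht
    rw [ht, h0, zero_mul]; rfl)
  -- `|o p₁| = |f| / |κ|`
  refine (hf.mem.memLp.const_mul κ⁻¹).of_le (hom.mul hp₁H.mem.memLp.1) ?_
  rw [ae_poissonMeasure]
  filter_upwards [hfeq, (outerBd_spec hlog).2.1, hp0] with t h1 h4 h5
  have h7 : ‖outerBd v t‖ = ‖p₁ t‖ := by rw [h4, hv, Real.exp_log (norm_pos_iff.2 h5)]
  rw [h1, inv_mul_cancel_left₀ hκ0, norm_mul, norm_mul, h7]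

/-! ### Multipliers and dominance sets -/

/-- If `o` maps the model space of `A` into that of `B`, then it maps the kernel of the Toeplitz
operator with symbol `Ā L` into that of `B̄ L`: if `p` is in the former, then `L p` is in the model
space of `A`, and `o p` is in the Hardy class because `o` is outer and `|o p| = |o L p|`. -/
theorem dominanceSet_subset_of_mul {A B : InnerFunction} {u : ℝ → ℝ} (hu : Integrable u ϖ) {d : ℂ}
    (hd : d ≠ 0) (h : ∀ p, CoHardy A.bd p → CoHardy B.bd fun t => d * outerBd u t * p t) :
    dominanceSet A ⊆ dominanceSet B := by
  intro L hL
  obtain ⟨p, hp, hp0⟩ := mem_dominanceSet_iff.1 hL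
  have h1 := h _ hp.inner_mul
  have hm : MemLp (fun t => outerBd u t * p t) 2 ϖ := by
    refine (h1.mem.memLp.const_mul d⁻¹).of_le ((aestronglyMeasurable_poisson.2
      (outerBd_spec hu).2.2).mul hp.mem.memLp.1) ?_
    rw [ae_poissonMeasure]
    filter_upwards [L.norm_bd] with t ht
    rw [mul_assoc d, inv_mul_cancel_left₀ hd, norm_mul, norm_mul, norm_mul, ht, one_mul]
  rw [mem_dominanceSet_iff]
  refine ⟨fun t => d * (outerBd u t * p t), ⟨(hp.mem.mul_outer hu hm).const_mul d,
    h1.mem_dual.congr (Eventually.of_forall fun t => ?_)⟩, fun h0 => hp0 ?_⟩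
  · simp only [map_mul]; ring
  · filter_upwards [h0, outerBd_ne_zero hu] with t h2 h3
    exact (mul_eq_zero.1 ((mul_eq_zero.1 h2).resolve_left hd)).resolve_left h3

theorem exists_mem_modelSpace {θ : InnerFunction} {p : ℝ → ℂ} (hp : CoHardy θ.bd p) :
    ∃ f : modelSpace θ, (fun t : ℝ => ((t : ℂ) + I) * (f : L2) t) =ᵐ[volume] p := by
  have hco := coeFn_toLp_div hp.mem.memLp
  exact ⟨⟨_, mem_modelSpace_iff.2 (hp.congr hco)⟩, hco⟩

theorem coHardy_of_linearMap {A B : InnerFunction} {b : ℝ → ℂ} (T : modelSpace A → modelSpace B)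
    (hT : ∀ f, ((T f : L2) : ℝ → ℂ) =ᵐ[volume] fun t => b t * (f : L2) t) {p : ℝ → ℂ}
    (hp : CoHardy A.bd p) : CoHardy B.bd fun t => b t * p t := by
  obtain ⟨f, hf⟩ := exists_mem_modelSpace hp
  refine (mem_modelSpace_iff.1 (T f).2).congr ?_
  filter_upwards [hf, hT f] with t h1 h2
  rw [h2, ← h1]; ring

theorem isClosed_modelSpace (θ : InnerFunction) : IsClosed (modelSpace θ : Set L2) :=
  isClosed_H2.inter (Submodule.isClosed_orthogonal _)

instance (θ : InnerFunction) : CompleteSpace (modelSpace θ) :=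
  (isClosed_modelSpace θ).completeSpace_coe

theorem exists_map_of_coHardy {A B : InnerFunction} {b : ℝ → ℂ}
    (h : ∀ p, CoHardy A.bd p → CoHardy B.bd fun t => b t * p t) (f : modelSpace A) :
    ∃ g : modelSpace B, ((g : L2) : ℝ → ℂ) =ᵐ[volume] fun t => b t * (f : L2) t := by
  obtain ⟨g, hg⟩ := exists_mem_modelSpace (h _ (mem_modelSpace_iff.1 f.2))
  refine ⟨g, ?_⟩
  filter_upwards [hg] with t ht
  refine mul_left_cancel₀ (ofReal_add_I_ne_zero t) ?_
  rw [ht]; ring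

/-- Almost everywhere convergence of a subsequence of an `L²`-convergent sequence. -/
theorem exists_subseq_ae_tendsto {f : ℕ → L2} {g : L2} (h : Tendsto f atTop (𝓝 g)) :
    ∃ ns : ℕ → ℕ, StrictMono ns ∧
      ∀ᵐ t : ℝ, Tendsto (fun i => f (ns i) t) atTop (𝓝 (g t)) :=
  (tendstoInMeasure_of_tendsto_Lp h).exists_seq_tendsto_ae

/-- A multiplication operator between model spaces is bounded, by the closed graph theorem. -/
theorem continuous_of_multiplier {A B : InnerFunction} {b : ℝ → ℂ}
    (T : modelSpace A →ₗ[ℂ] modelSpace B)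
    (hT : ∀ f, ((T f : L2) : ℝ → ℂ) =ᵐ[volume] fun t => b t * (f : L2) t) : Continuous T := by
  refine T.continuous_of_seq_closed_graph fun f x y hf hy => ?_
  obtain ⟨ns, hns, h1⟩ := exists_subseq_ae_tendsto ((continuous_subtype_val.tendsto x).comp hf)
  obtain ⟨ms, hms, h2⟩ := exists_subseq_ae_tendsto
    (((continuous_subtype_val.tendsto y).comp hy).comp hns.tendsto_atTop)
  refine Subtype.ext (Lp.ext ?_)
  have h3 := ae_all_iff.2 fun n => hT (f n)
  filter_upwards [h1, h2, h3, hT x] with t h4 h5 h6 h7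
  rw [h7]
  refine tendsto_nhds_unique h5 (((h4.comp hms.tendsto_atTop).const_mul (b t)).congr fun i => ?_)
  exact (h6 _).symm

theorem isBoundedInvertibleMultiplier_of_coHardy {A B : InnerFunction} {h : ℂ → ℂ} {b : ℝ → ℂ}
    (hb : boundary h =ᵐ[volume] b) (hb0 : ∀ᵐ t : ℝ, b t ≠ 0)
    (h1 : ∀ p, CoHardy A.bd p → CoHardy B.bd fun t => b t * p t)
    (h2 : ∀ p, CoHardy B.bd p → CoHardy A.bd fun t => (b t)⁻¹ * p t) :
    IsBoundedInvertibleMultiplier h A B := by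
  choose T hT using exists_map_of_coHardy h1
  choose S hS using exists_map_of_coHardy h2
  have hTadd : ∀ f g, T (f + g) = T f + T g := fun f g => Subtype.ext (Lp.ext (by
    filter_upwards [hT (f + g), hT f, hT g, Lp.coeFn_add (f : L2) (g : L2),
      Lp.coeFn_add (T f : L2) (T g : L2)] with t h3 h4 h5 h6 h7
    rw [h3]
    simp only [Submodule.coe_add]
    rw [h6, h7, Pi.add_apply, Pi.add_apply, h4, h5]; ring))
  have hTsmul : ∀ (c : ℂ) (f), T (c • f) = c • T f := fun c f => Subtype.ext (Lp.ext (by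
    filter_upwards [hT (c • f), hT f, Lp.coeFn_smul c (f : L2),
      Lp.coeFn_smul c (T f : L2)] with t h3 h4 h6 h7
    rw [h3]
    simp only [Submodule.coe_smul]
    rw [h6, h7, Pi.smul_apply, Pi.smul_apply, h4, smul_eq_mul, smul_eq_mul]; ring))
  have hST : ∀ f, S (T f) = f := fun f => Subtype.ext (Lp.ext (by
    filter_upwards [hS (T f), hT f, hb0] with t h3 h4 h5
    rw [h3, h4, inv_mul_cancel_left₀ h5]))
  have hTS : ∀ f, T (S f) = f := fun f => Subtype.ext (Lp.ext (by
    filter_upwards [hT (S f), hS f, hb0] with t h3 h4 h5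
    rw [h3, h4, mul_inv_cancel_left₀ h5]))
  let e : modelSpace A ≃ₗ[ℂ] modelSpace B :=
    { toFun := T, map_add' := hTadd, map_smul' := hTsmul, invFun := S, left_inv := hST,
      right_inv := hTS }
  have hc : Continuous e := continuous_of_multiplier (e : modelSpace A →ₗ[ℂ] modelSpace B) hT
  refine ⟨e.toContinuousLinearEquivOfContinuous hc, fun f => ?_⟩
  filter_upwards [hb, hT f] with t h3 h4
  rw [h3]; exact h4

/-- Multiplication by an outer function between model spaces forces equality of the dominance
sets; arguments play no role here. -/
theorem dominanceSet_eq_of_multiplier {A B : InnerFunction} {h : ℂ → ℂ} (ho : IsOuter h)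
    (hm : IsBoundedInvertibleMultiplier h A B) : dominanceSet A = dominanceSet B := by
  obtain ⟨u, hu, c, hc, hh⟩ := ho
  rw [poissonSummable_iff] at hu
  obtain ⟨T, hT⟩ := hm
  have hc0 : c ≠ 0 := by rw [← norm_ne_zero_iff, hc]; exact one_ne_zero
  have hb : boundary h =ᵐ[volume] fun t => c * outerBd u t := by
    refine boundary_ae_eq ?_
    filter_upwards [(outerBd_spec hu).1] with x hx
    refine (hx.const_mul c).congr' ?_
    filter_upwards [self_mem_nhdsWithin] with y hy
    exact (hh _ (ofReal_add_mul_I_mem hy)).symm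
  have hT' : ∀ f, ((T f : L2) : ℝ → ℂ) =ᵐ[volume] fun t => c * outerBd u t * (f : L2) t := by
    intro f
    filter_upwards [hT f, hb] with t h1 h2
    rw [h1, h2]
  have hS' : ∀ g, ((T.symm g : L2) : ℝ → ℂ) =ᵐ[volume]
      fun t => c⁻¹ * outerBd (fun t => -u t) t * (g : L2) t := by
    intro g
    filter_upwards [hT' (T.symm g), outerBd_neg hu, outerBd_ne_zero hu] with t h1 h2 h3
    rw [T.apply_symm_apply] at h1
    rw [h1, h2]
    field_simp
  refine Set.Subset.antisymm ?_ ?_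
  · exact dominanceSet_subset_of_mul hu hc0 fun p hp => coHardy_of_linearMap T hT' hp
  · exact dominanceSet_subset_of_mul hu.neg (inv_ne_zero hc0) fun p hp =>
      coHardy_of_linearMap T.symm hS' hp

/-- Toeplitz equivalent inner functions have an outer multiplier between their model spaces. -/
theorem exists_multiplier_of_dominanceSet_eq {A B : InnerFunction}
    (hAB : dominanceSet A = dominanceSet B) : ∃ u : ℝ → ℝ, MemLp u 2 ϖ ∧
      (∃ c : ℂ, ‖c‖ = 1 ∧ ∀ᵐ t : ℝ, c * A.bd t * outerBd u t = B.bd t * conj (outerBd u t)) ∧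
      (∀ p, CoHardy A.bd p → CoHardy B.bd fun t => outerBd u t * p t) ∧
      ∀ p, CoHardy B.bd p → CoHardy A.bd fun t => (outerBd u t)⁻¹ * p t := by
  by_cases hA : ‖A.toFun I‖ < 1
  · have hB : ‖B.toFun I‖ < 1 := by
      obtain ⟨L, hL, -⟩ := exists_inner_modelKer hA
      exact norm_lt_one_of_mem_dominanceSet (hAB ▸ hL)
    obtain ⟨u, hu, ho, ho', c, hc, hrel⟩ := exists_outer_of_dominanceSet_eq hAB hA hB
    have hui : Integrable u ϖ := hu.integrable (by norm_num)
    have hcc : conj c * c = 1 := by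
      rw [← normSq_eq_conj_mul_self, normSq_eq_norm_sq, hc]; simp
    refine ⟨u, hu, ⟨c, hc, hrel⟩, fun p hp => hp.outerBd_mul hAB.subset hB hui ho' hc hrel,
      fun p hp => ?_⟩
    have hrel' : ∀ᵐ t : ℝ, conj c * B.bd t * outerBd (fun t => -u t) t =
        A.bd t * conj (outerBd (fun t => -u t) t) := by
      filter_upwards [hrel, outerBd_neg hui, outerBd_ne_zero hui] with t h1 h2 h3
      have h4 : conj (outerBd u t) ≠ 0 := by simpa using h3
      rw [h2, map_inv₀]
      field_simp
      linear_combination -conj c * h1 + A.bd t * outerBd u t * hcc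
    refine (hp.outerBd_mul hAB.superset hA hui.neg (c := conj c) ?_ ?_ hrel').congr ?_
    · change InHardy (outerBd fun t => - -u t)
      simpa only [neg_neg] using ho
    · rwa [RCLike.norm_conj]
    · filter_upwards [outerBd_neg hui] with t ht
      change _ = outerBd (fun t => -u t) t * _
      rw [ht]
  · -- both functions are constant and both model spaces are trivial
    have hB : ¬ ‖B.toFun I‖ < 1 := fun hB => hA (by
      obtain ⟨L, hL, -⟩ := exists_inner_modelKer hB
      exact norm_lt_one_of_mem_dominanceSet (hAB.symm ▸ hL))
    have hA1 := le_antisymm (A.norm_le_one I_mem_UHP) (not_lt.1 hA)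
    have hB1 := le_antisymm (B.norm_le_one I_mem_UHP) (not_lt.1 hB)
    have h1 : outerBd (fun _ => 0) =ᵐ[volume] fun _ => 1 := by
      refine boundary_ae_eq (Eventually.of_forall fun x => ?_)
      simp [outer, schwarz]
    have hzero : ∀ {U p : ℝ → ℂ}, p =ᵐ[volume] 0 → CoHardy U p := fun {U p} hp => by
      refine ⟨InHardy.congr ⟨_, HardyPair.const 0⟩ hp, InHardy.congr ⟨_, HardyPair.const 0⟩ ?_⟩
      filter_upwards [hp] with t ht
      simp [ht]
    refine ⟨fun _ => 0, memLp_const 0, ⟨B.toFun I * conj (A.toFun I), ?_, ?_⟩, fun p hp => ?_,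
      fun p hp => ?_⟩
    · rw [norm_mul, RCLike.norm_conj, hA1, hB1, one_mul]
    · have hAA : conj (A.toFun I) * A.toFun I = 1 := by
        rw [← normSq_eq_conj_mul_self, normSq_eq_norm_sq, hA1]; simp
      filter_upwards [h1, A.bd_eq_const hA1, B.bd_eq_const hB1] with t h2 h3 h4
      rw [h2, h3, h4, map_one]
      linear_combination B.toFun I * hAA
    · refine hzero ?_
      filter_upwards [hp.eq_zero_of_norm_eq_one hA1] with t ht
      rw [ht]; simp
    · refine hzero ?_
      filter_upwards [hp.eq_zero_of_norm_eq_one hB1] with t ht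
      rw [ht]; simp

/-! ### Arguments -/

theorem expConj_eq (φ : ℝ → ℝ) (z : ℂ) : expConj φ z = exp (-I * schwarz φ z) := by
  rw [expConj, harmonicConj, poissonExt]
  congr 1
  conv_rhs => rw [← re_add_im (schwarz φ z)]
  linear_combination ((schwarz φ z).im : ℂ) * I_mul_I

theorem eq_schwarz_of_re {F : ℂ → ℂ} (hF : DifferentiableOn ℂ F UHP) {v : ℝ → ℝ}
    (hv : Integrable v ϖ) (hre : ∀ z ∈ UHP, (F z).re = ∫ t, rho z t * v t ∂ϖ)
    (hI : F I = (∫ t, v t ∂ϖ : ℝ)) {z : ℂ} (hz : z ∈ UHP) : schwarz v z = F z := by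
  have h := eq_const_of_re_eq_zero (F := fun z => schwarz v z - F z)
    ((differentiableOn_schwarz hv).sub hF)
    (fun z hz => by rw [sub_re, re_schwarz hv hz, hre z hz, sub_self]) hz
  rw [schwarz_I hv, hI, sub_self] at h
  exact sub_eq_zero.1 h

/-- The boundary values of an outer function with square summable logarithm in polar form. The
function `φ = κ - ũ` is the one for which `exp (φ̃ - i φ)` is proportional to the outer function. -/
theorem exists_conjugate {u : ℝ → ℝ} (hu : MemLp u 2 ϖ) : ∃ w : ℝ → ℝ, Measurable w ∧
    Integrable w ϖ ∧ (∀ᵐ t : ℝ, outerBd u t = exp (u t + I * w t)) ∧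
    ∀ (κ : ℝ), ∀ z ∈ UHP, expConj (fun t => κ - w t) z =
      exp (-I * κ - (∫ t, u t ∂ϖ : ℝ)) * outer u z := by
  have hui : Integrable u ϖ := hu.integrable (by norm_num)
  obtain ⟨s, hs, hsre, -⟩ := exists_hardyPair_schwarz hu
  have him : AEStronglyMeasurable (fun t => (s t).im) volume :=
    continuous_im.comp_aestronglyMeasurable (aestronglyMeasurable_poisson.1 hs.memLp.1)
  have hw := him.ae_eq_mk
  set w := him.mk _ with hwdef
  have hwp : (fun t => (s t).im) =ᵐ[ϖ] w := by rwa [EventuallyEq, ae_poissonMeasure]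
  have hwi : Integrable w ϖ := (integrable_congr hwp).1 hs.integrable.im
  have hwint : ∀ z ∈ UHP, ∫ t, rho z t * w t ∂ϖ = (schwarz u z).im := by
    intro z hz
    have h1 := integral_im (𝕜 := ℂ) (integrable_rho_mul hz hs.integrable)
    rw [hs.eq_pext z hz, pext]
    simp only [RCLike.im_eq_complex_im] at h1
    rw [← h1]
    refine integral_congr_ae ?_
    filter_upwards [hwp] with t ht
    rw [← ht, im_ofReal_mul]
  refine ⟨w, him.stronglyMeasurable_mk.measurable, hwi, ?_, fun κ z hz => ?_⟩
  · refine boundary_ae_eq ?_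
    filter_upwards [hs.radial, hsre, hw] with t h1 h2 h3
    have h4 : (u t : ℂ) + I * w t = s t := by
      rw [← h2, ← h3, mul_comm I, re_add_im]
    rw [h4]
    exact (continuous_exp.tendsto _).comp h1
  · set u₀ : ℝ := ∫ t, u t ∂ϖ with hu₀
    have h1 : schwarz (fun t => κ - w t) z = κ + I * schwarz u z - I * u₀ := by
      refine eq_schwarz_of_re (v := fun t => κ - w t) (F := fun z => κ + I * schwarz u z - I * u₀)
        ((((differentiableOn_schwarz hui).const_mul I).const_add _).sub_const _)
        ((integrable_const κ).sub hwi) (fun z hz => ?_) ?_ hz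
      · simp_rw [mul_sub]
        rw [integral_sub (integrable_rho_mul_real hz (integrable_const κ))
          (integrable_rho_mul_real hz hwi), integral_mul_const, integral_rho_real hz, hwint z hz]
        simp [sub_eq_add_neg]
      · have h2 := hwint I I_mem_UHP
        simp only [rho_I, one_mul] at h2
        rw [integral_sub (integrable_const κ) hwi, h2, schwarz_I hui]
        simp [hu₀]
    rw [expConj_eq, h1, outer, ← exp_add]
    congr 1
    linear_combination (u₀ - schwarz u z) * I_mul_I

theorem exists_measurable_arg (θ : InnerFunction) :
    ∃ β : ℝ → ℝ, Measurable β ∧ ∀ᵐ t : ℝ, θ.bd t = exp (I * β t) := by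
  have hm := θ.memLp_bd.1
  refine ⟨fun t => arg (hm.mk _ t), measurable_arg.comp hm.stronglyMeasurable_mk.measurable, ?_⟩
  filter_upwards [hm.ae_eq_mk, θ.norm_bd] with t h1 h2
  rw [← h1]
  have h3 := norm_mul_exp_arg_mul_I (θ.bd t)
  rw [h2, ofReal_one, one_mul, mul_comm] at h3
  exact h3.symm

theorem isArgument_of_eq_exp {θ : InnerFunction} {α : ℝ → ℝ} (hα : Measurable α)
    (h : ∀ᵐ t : ℝ, θ.bd t = exp (I * α t)) : IsArgument θ α := by
  refine ⟨hα, ?_⟩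
  filter_upwards [h] with t ht
  exact ⟨1, one_pos, by rw [ht, div_self (exp_ne_zero _), ofReal_one]⟩

theorem isOuter_of_eq {h : ℂ → ℂ} {u : ℝ → ℝ} (hu : Integrable u ϖ) {κ : ℝ}
    (hh : ∀ z ∈ UHP, h z = exp (-I * κ - (∫ t, u t ∂ϖ : ℝ)) * outer u z) : IsOuter h := by
  set u₀ : ℝ := ∫ t, u t ∂ϖ with hu₀
  refine ⟨fun t => u t - u₀, poissonSummable_iff.2 (hu.sub (integrable_const _)), exp (-I * κ), ?_,
    fun z hz => ?_⟩
  · rw [Complex.norm_exp]; simp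
  · have h1 : schwarz (fun t => u t - u₀) z = schwarz u z - u₀ := by
      refine eq_schwarz_of_re (v := fun t => u t - u₀) (F := fun z => schwarz u z - u₀)
        ((differentiableOn_schwarz hu).sub_const _) (hu.sub (integrable_const _))
        (fun z hz => ?_) ?_ hz
      · simp_rw [mul_sub]
        rw [integral_sub (integrable_rho_mul_real hz hu)
          (integrable_rho_mul_real hz (integrable_const _)), integral_mul_const,
          integral_rho_real hz, ← re_schwarz hu hz]
        simp
      · rw [integral_sub hu (integrable_const _), schwarz_I hu]
        simp [hu₀]
    rw [hh z hz, h1, outer, ← exp_add, ← exp_add]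
    congr 1
    ring

/-- Toeplitz equivalent inner functions have arguments whose half-difference `φ` produces the outer
multiplier `exp (φ̃ - i φ)`. -/
theorem exists_arguments {A B : InnerFunction} (hAB : dominanceSet A = dominanceSet B) :
    ∃ α β φ : ℝ → ℝ, IsArgument A α ∧ IsArgument B β ∧ (∀ x : ℝ, φ x = (1 / 2) * (α x - β x)) ∧
      PoissonSummable φ ∧ IsOuter (expConj φ) ∧
      IsBoundedInvertibleMultiplier (expConj φ) A B := by
  obtain ⟨u, hu, ⟨c, hc, hrel⟩, h1, h2⟩ := exists_multiplier_of_dominanceSet_eq hAB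
  have hui : Integrable u ϖ := hu.integrable (by norm_num)
  obtain ⟨w, hwm, hwi, hwexp, hexp⟩ := exists_conjugate hu
  obtain ⟨β, hβm, hβ⟩ := exists_measurable_arg B
  -- `exp (2 i κ) = c̄`, so that `A B̄ = exp (2 i (κ - w))`
  set κ : ℝ := arg (conj c) / 2 with hκ
  have hcκ : exp (2 * (I * κ)) * c = 1 := by
    have h3 := norm_mul_exp_arg_mul_I (conj c)
    rw [RCLike.norm_conj, hc, ofReal_one, one_mul] at h3
    have h4 : 2 * (I * (κ : ℂ)) = arg (conj c) * I := by
      rw [hκ]; push_cast; ring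
    rw [h4, h3, ← normSq_eq_conj_mul_self, normSq_eq_norm_sq, hc]; simp
  set φ : ℝ → ℝ := fun t => κ - w t with hφ
  have hφm : Measurable φ := measurable_const.sub hwm
  have hbd : boundary (expConj φ) =ᵐ[volume]
      fun t => exp (-I * κ - (∫ t, u t ∂ϖ : ℝ)) * outerBd u t := by
    refine boundary_ae_eq ?_
    filter_upwards [(outerBd_spec hui).1] with x hx
    refine (hx.const_mul _).congr' ?_
    filter_upwards [self_mem_nhdsWithin] with y hy
    exact (hexp κ _ (ofReal_add_mul_I_mem hy)).symm
  refine ⟨fun t => β t + 2 * φ t, β, φ, ?_, isArgument_of_eq_exp hβm hβ, fun x => by ring,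
    poissonSummable_iff.2 ((integrable_const κ).sub hwi), isOuter_of_eq hui (hexp κ), ?_⟩
  · refine isArgument_of_eq_exp (hβm.add (hφm.const_mul 2)) ?_
    filter_upwards [hrel, hwexp, hβ] with t h3 h4 h5
    have h6 : conj (outerBd u t) = exp (u t - I * w t) := by
      rw [h4, ← exp_conj]; simp [sub_eq_add_neg]
    have h7 : exp (I * ((β t + 2 * φ t : ℝ) : ℂ)) =
        B.bd t * exp (2 * (I * κ)) * exp (u t - I * w t) * exp (-(u t + I * w t)) := by
      rw [h5, ← exp_add, ← exp_add, ← exp_add]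
      congr 1
      rw [hφ]; push_cast; ring
    have h8 : exp ((u t : ℂ) + I * w t) * exp (-((u t : ℂ) + I * w t)) = 1 := by
      rw [← exp_add, add_neg_cancel, exp_zero]
    rw [h6, h4] at h3
    rw [h7]
    linear_combination exp (2 * (I * κ)) * exp (-((u t : ℂ) + I * w t)) * h3 -
      A.bd t * (exp ((u t : ℂ) + I * w t) * exp (-((u t : ℂ) + I * w t))) * hcκ - A.bd t * h8
  · refine isBoundedInvertibleMultiplier_of_coHardy hbd ?_ (fun p hp => ?_) fun p hp => ?_
    · filter_upwards [outerBd_ne_zero hui] with t ht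
      exact mul_ne_zero (exp_ne_zero _) ht
    · refine ((h1 p hp).const_mul (exp (-I * κ - (∫ t, u t ∂ϖ : ℝ)))).congr
        (Eventually.of_forall fun t => ?_)
      exact mul_assoc _ _ _
    · refine ((h2 p hp).const_mul (exp (-I * κ - (∫ t, u t ∂ϖ : ℝ)))⁻¹).congr
        (Eventually.of_forall fun t => ?_)
      beta_reduce
      rw [mul_inv, mul_assoc]

end ToeplitzOrder

end

theorem theorem4 (I J : ToeplitzOrder.InnerFunction) :
    ToeplitzOrder.ToeplitzEquivalent I J ↔
      ∃ α β φ : ℝ → ℝ,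
        ToeplitzOrder.IsArgument I α ∧ ToeplitzOrder.IsArgument J β ∧
        (∀ x : ℝ, φ x = (1 / 2) * (α x - β x)) ∧
        ToeplitzOrder.PoissonSummable φ ∧
        ToeplitzOrder.IsOuter (ToeplitzOrder.expConj φ) ∧
        ToeplitzOrder.IsBoundedInvertibleMultiplier (ToeplitzOrder.expConj φ) I J := by
  constructor
  · exact fun h => ToeplitzOrder.exists_arguments h
  · rintro ⟨α, β, φ, -, -, -, -, ho, hm⟩
    exact ToeplitzOrder.dominanceSet_eq_of_multiplier ho hm
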